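/- **Setting.** For every $n$ let $X_1,\dots,X_n$ (that is, $X_{n,1},\dots,X_{n,n}$) be independent random elements of a measurable space $\mathcal X$, not necessarily identically distributed. Fix a degree $m\ge 1$. For a sample size $N$ let $I_N^m$ be the set of $m$-tuples of pairwise distinct elements of $\{1,\dots,N\}$. For a weight function $a:I_N^m\to\mathbb R$ and a measurable kernel $h:\mathcal X^m\to\mathbb R$ (no symmetry is assumed) put $$U_N(a,h;x_1,\dots,x_N)=\frac{(N-m)!}{N!}\sum_{(i_1,\dots,i_m)\in I_N^m}a(i_1,\dots,i_m)\,h(x_{i_1},\dots,x_{i_m}).$$ Let $U_n=U_n(a_n,h_n;X_1,\dots,X_n)$ and $\sigma_n^2=\operatorname{Var}(U_n)$. Let $b=b_n$ be block lengths with $b_n\le n$ and $b_n\to\infty$. Let $a'_n$ and $h'_n$ be the weights and kernel used for blocks at stage $n$ (for instance $a_b,h_b$, or $a_n,h_n$), and put $U_{b,i}=U_b(a'_n,h'_n;X_i,\dots,X_{i+b-1})$ for $1\le i\le n-b+1$. Given the data, let $U_{b,i}^*=U_b(a'_n,h'_n;X^*_1,\dots,X^*_b)$, where $X_1^*,\dots,X_b^*$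 are independent draws with replacement from the empirical distribution of $\{X_i,\dots,X_{i+b-1}\}$, and let $\operatorname{Var}^*$ be the conditional variance given the data. With deterministic scale parameters $c_n\neq 0$ (the tuning parameters of the procedure) put $$V_n^*=\frac{1}{c_n(n-b+1)}\sum_{i=1}^{n-b+1}\operatorname{Var}^*(U_{b,i}^*).$$ **Bootstrap-variance conditions.** Consider a sequence of samples $X_1,\dots,X_N$ of independent variables with laws $P_1,\dots,P_N$, of sizes $N\to\infty$, with weights $a$ and kernel $h$, all depending on the stage. Write $\sigma^2=\operatorname{Var}(U_N(a,h;X_1,\dots,X_N))$ and $\theta(\mathbf i)=E\,h(X_{i_1},\dots,X_{i_m})$ for $\mathbf i\in I_N^m$. Let $f^{(l)}_{\mathbf i}(x)$ be the integral of $h(y_1,\dots,y_{l-1},x,y_{l+1},\dots,y_m)$ with respect to $\prod_{k\ne l}P_{i_k}(dy_k)$, and put $$h_{1,i}(x)=\frac{(N-m)!}{(N-1)!}\sum_{l=1}^m\ \sum_{\mathbf i\in I_N^m,\ i_l=i}a(\mathbf i)\{f^{(l)}_{\mathbf i}(x)-\theta(\mathbf i)\},\qquad V=\operatorname{Var}\Big\{\frac1N\sum_{i=1}^N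 h_{1,i}(X_i)\Big\}.$$ Let $A_{K,q}$ be the average of $|a(\mathbf i^{(1)})\cdots a(\mathbf i^{(K)})|$ over all $K$-tuples of elements of $I_N^m$ that have at least $q$ indices in common (and $0$ if there are none). Let $M_1=\max_{\mathbf i,\mathbf j\in I_N^m}|\theta(\mathbf i)-\theta(\mathbf j)|$. Let $$M_2=\max\big|E[E\{h(X_{\mathbf r})h(X_{\mathbf s})\mid X_{k_p}\}]-E[E\{h(X_{\mathbf k})h(X_{\mathbf s})\mid X_{k_p}\}]\big|,$$ where the maximum is over $1\le p,q\le m$ and $\mathbf r,\mathbf s,\mathbf k\in I_N^m$ such that $\mathbf r,\mathbf s$ have exactly the index $r_p=s_q$ in common and $\mathbf k,\mathbf s$ have exactly the index $k_p=s_q$ in common. The conditions are: 1. $V>0$ at all sufficiently late stages, and there are numbers $M>0$, depending only on the stage, with $E\{h(X_{i_1},\dots,X_{i_m})^4\}\le M$ for all $\mathbf i\in I_N^m$, with $N^{-2}V^{-1}A_{2,2}M^{1/2}\to0$ and $N^{-2}V^{-3/2}A_{3,1}M^{3/4}\to0$; 2. there is a constant $C$ such that, at all sufficiently late stages and for all $k_1,\dots,k_m\in\{1,\dots,N\}$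 (repetitions allowed), $E\{h(X_{k_1},\dots,X_{k_m})^2\}\le C$ and $\int h^2\,d(P_{k_1}\otimes\cdots\otimes P_{k_m})\le C$; 3. $\frac1N\sum_{i,j=1}^N\big\{\frac{h_{1,i}(X_j)}{N\sigma}\big\}^2\to1$ in probability, $\frac1{N^2}\sum_{i=1}^N\big\{\sum_{j=1}^N\frac{h_{1,i}(X_j)}{N\sigma}\big\}^2\to0$ in probability, and $N^{-1}\sigma^{-2}A_{2,1}\{M_1^2+M_2+N^{-1}\}\to0$. **Theorem.** Assume that for every choice of indices $i_n\in\{1,\dots,n-b_n+1\}$ the sequence of blocks $\{X_{i_n},\dots,X_{i_n+b_n-1}\}$, with weights $a'_n$ and kernel $h'_n$, satisfies the bootstrap-variance conditions (with $N=b_n$, as $n\to\infty$). Assume further that there are numbers $\sigma_b^2$ (depending on $n$ but not on the block) with $\operatorname{Var}(U_{b,i_n})=\sigma_b^2(1+o(1))$ for every such choice, and numbers $\zeta_{n,b}>0$ with $\sigma_b^2/\sigma_n^2=\zeta_{n,b}(1+o(1))$. Then $$\sigma_n^{-2}V_n^*-\operatorname{Var}(\sigma_n^{-1}U_n)=\frac{\zeta_{n,b}}{c_n}\,(1+o_P(1))-1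 ,$$ that is, there are random variables $R_n\to0$ in probability such that for all sufficiently large $n$ the left-hand side equals $\frac{\zeta_{n,b}}{c_n}(1+R_n)-1$. -/

import Mathlib

open MeasureTheory ProbabilityTheory Filter Topology Asymptotics
open scoped Nat ENNReal

noncomputable section

namespace WeightedU

/-! The index set `I_N^m` of `m`-tuples of pairwise distinct indices of a sample of size `N` is the
type `Fin m ↪ Fin N` (indices start at `0`). -/

section Statistic

variable {𝓧 : Type*} {m N : ℕ}

/-- The weighted U-statistic of degree `m` with weight function `a` and kernel `h`, evaluated at a
sample `x` of size `N`. Neither `a` nor `h` is assumed symmetric. -/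
def uStat (a : (Fin m → Fin N) → ℝ) (h : (Fin m → 𝓧) → ℝ) (x : Fin N → 𝓧) : ℝ :=
  ((N - m)! : ℝ) / (N ! : ℝ) * ∑ I : Fin m ↪ Fin N, a I * h (fun l => x (I l))

/-- The bootstrap variance `Var*` of the weighted U-statistic, given the data `x`: the bootstrap
sample is `x (J 0), …, x (J (N - 1))`, where `J 0, …, J (N - 1)` are independent and uniform on
`Fin N` (so that `J` is uniform on the set of all maps `Fin N → Fin N`); that is, the bootstrap
sample consists of `N` independent draws, with replacement, from the empirical distribution
of `x`. -/
def bootVar (a : (Fin m → Fin N) → ℝ) (h : (Fin m → 𝓧) → ℝ) (x : Fin N → 𝓧) : ℝ :=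
  variance (fun J : Fin N → Fin N => uStat a h (fun k => x (J k))) (uniformOn Set.univ)

/-- The indices that occur in each of the `K` index tuples. -/
def commonIndices {K : ℕ} (I : Fin K → (Fin m ↪ Fin N)) : Finset (Fin N) :=
  Finset.univ.filter fun x => ∀ k, ∃ l, I k l = x

/-- The collection `(I_N^m)_{≥ q}^{⊗ K}` of all `K`-tuples of elements of `I_N^m` with at least `q`
indices in common. -/
def sharingTuples (m N K q : ℕ) : Finset (Fin K → (Fin m ↪ Fin N)) :=
  Finset.univ.filter fun I => q ≤ (commonIndices I).card

/-- The average weight `A_{K,q}`. -/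
def avgWeight (a : (Fin m → Fin N) → ℝ) (K q : ℕ) : ℝ :=
  ((sharingTuples m N K q).card : ℝ)⁻¹ * ∑ I ∈ sharingTuples m N K q, |∏ k, a (I k)|

end Statistic

section Population

variable {𝓧 : Type*} [MeasurableSpace 𝓧] {m N : ℕ} {Ω : Type*} [MeasurableSpace Ω]

/-- `θ(i_1, …, i_m) = E h(X_{i_1}, …, X_{i_m})`. -/
def theta (P : Measure Ω) (X : Fin N → Ω → 𝓧) (h : (Fin m → 𝓧) → ℝ) (I : Fin m ↪ Fin N) : ℝ :=
  ∫ ω, h (fun l => X (I l) ω) ∂P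

/-- `f^{(l)}_{(i_1, …, i_m) \ i_l}(x)`: the `l`-th argument of `h` is `x`, and every other argument
`y_k` is integrated against the law of `X_{i_k}`. (The coordinate `y_l` is integrated too, but the
integrand does not depend on it.) -/
def proj (P : Measure Ω) (X : Fin N → Ω → 𝓧) (h : (Fin m → 𝓧) → ℝ) (I : Fin m ↪ Fin N)
    (l : Fin m) (x : 𝓧) : ℝ :=
  ∫ y, h (Function.update y l x) ∂(Measure.pi fun k => P.map (X (I k)))

/-- The first order expansion `h_{1,i}` of the kernel for `X_i`. The tuples
`π_l(i; i_1, …, i_{m-1})`, with `i_1, …, i_{m-1}` distinct and different from `i`, are exactly the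
elements `I` of `I_N^m` with `I l = i`. -/
def hOne (P : Measure Ω) (X : Fin N → Ω → 𝓧) (a : (Fin m → Fin N) → ℝ) (h : (Fin m → 𝓧) → ℝ)
    (i : Fin N) (x : 𝓧) : ℝ :=
  ((N - m)! : ℝ) / ((N - 1)! : ℝ) *
    ∑ l : Fin m, ∑ I ∈ Finset.univ.filter (fun I : Fin m ↪ Fin N => I l = i),
      a I * (proj P X h I l x - theta P X h I)

/-- `V = Var (N⁻¹ ∑ i, h_{1,i}(X_i))`. -/
def mainVar (P : Measure Ω) (X : Fin N → Ω → 𝓧) (a : (Fin m → Fin N) → ℝ)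
    (h : (Fin m → 𝓧) → ℝ) : ℝ :=
  variance (fun ω => (N : ℝ)⁻¹ * ∑ i : Fin N, hOne P X a h i (X i ω)) P

/-- The variance `σ²` of the U-statistic of the sample `X`. -/
def uVar (P : Measure Ω) (X : Fin N → Ω → 𝓧) (a : (Fin m → Fin N) → ℝ)
    (h : (Fin m → 𝓧) → ℝ) : ℝ :=
  variance (fun ω => uStat a h (fun k => X k ω)) P

/-- `M_1`, the maximal difference between two of the means `θ`. -/
def meanGap (P : Measure Ω) (X : Fin N → Ω → 𝓧) (h : (Fin m → 𝓧) → ℝ) : ℝ :=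
  ⨆ t : (Fin m ↪ Fin N) × (Fin m ↪ Fin N), |theta P X h t.1 - theta P X h t.2|

/-- The quantity `E [E {h(X_r) h(X_s) | X_i}]`. -/
def crossMoment (P : Measure Ω) (X : Fin N → Ω → 𝓧) (h : (Fin m → 𝓧) → ℝ)
    (r s : Fin m ↪ Fin N) (i : Fin N) : ℝ :=
  ∫ ω, (P[fun ω' => h (fun l => X (r l) ω') * h (fun l => X (s l) ω') |
    MeasurableSpace.comap (X i) inferInstance]) ω ∂P

/-- The configurations `(p, q, r, s, k)` over which the maximum `M_2` is taken: `r` and `s` have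
exactly the index `r_p = s_q` in common, and so do `k` and `s`, with `k_p = s_q`. -/
abbrev CrossConfig (m N : ℕ) : Type :=
  {t : (Fin m × Fin m) × ((Fin m ↪ Fin N) × (Fin m ↪ Fin N) × (Fin m ↪ Fin N)) //
    commonIndices ![t.2.1, t.2.2.1] = {t.2.2.1 t.1.2} ∧ t.2.1 t.1.1 = t.2.2.1 t.1.2 ∧
    commonIndices ![t.2.2.2, t.2.2.1] = {t.2.2.1 t.1.2} ∧ t.2.2.2 t.1.1 = t.2.2.1 t.1.2}

/-- `M_2`, the maximum of `|E [E {h(X_r) h(X_s) | X_{k_p}}] - E [E {h(X_k) h(X_s) | X_{k_p}}]|`. -/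
def crossGap (P : Measure Ω) (X : Fin N → Ω → 𝓧) (h : (Fin m → 𝓧) → ℝ) : ℝ :=
  ⨆ t : CrossConfig m N,
    |crossMoment P X h t.1.2.1 t.1.2.2.1 (t.1.2.2.2 t.1.1.1) -
      crossMoment P X h t.1.2.2.2 t.1.2.2.1 (t.1.2.2.2 t.1.1.1)|

end Population

section Asymptotic

variable {𝓧 : Type*} [MeasurableSpace 𝓧] {m : ℕ}
variable {Ω : ℕ → Type*} [∀ n, MeasurableSpace (Ω n)]

/-- Convergence in probability to a constant, where the probability space may change with `n`. -/
def TendstoInProb (P : ∀ n, Measure (Ω n)) (Y : ∀ n, Ω n → ℝ) (c : ℝ) : Prop :=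
  ∀ ε : ℝ, 0 < ε → Tendsto (fun n => P n {ω | ε ≤ |Y n ω - c|}) atTop (𝓝 0)

/-- The conditions for consistent bootstrap variance estimation, for a sequence of samples: the
`n`-th sample `X n` has size `N n`, and its U-statistic has weight function `a n` and
kernel `h n`. -/
structure BootstrapConditions (P : ∀ n, Measure (Ω n)) (N : ℕ → ℕ)
    (X : ∀ n, Fin (N n) → Ω n → 𝓧) (a : ∀ n, (Fin m → Fin (N n)) → ℝ)
    (h : ℕ → (Fin m → 𝓧) → ℝ) : Prop where
  /-- The quantities `V(n)`, by which the conditions below divide, are not zero. -/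
  mainVar_pos : ∀ᶠ n in atTop, 0 < mainVar (P n) (X n) (a n) (h n)
  /-- The conditions for asymptotic normality: fourth moments, and the two rate conditions. -/
  normality : ∃ M : ℕ → ℝ, (∀ n, 0 < M n) ∧
    (∀ n, ∀ I : Fin m ↪ Fin (N n),
      Integrable (fun ω => h n (fun l => X n (I l) ω) ^ 4) (P n) ∧
      ∫ ω, h n (fun l => X n (I l) ω) ^ 4 ∂(P n) ≤ M n) ∧
    Tendsto (fun n => (N n : ℝ) ^ (-2 : ℝ) * (mainVar (P n) (X n) (a n) (h n)) ^ (-1 : ℝ) *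
      avgWeight (a n) 2 2 * M n ^ (1 / 2 : ℝ)) atTop (𝓝 0) ∧
    Tendsto (fun n => (N n : ℝ) ^ (-2 : ℝ) * (mainVar (P n) (X n) (a n) (h n)) ^ (-3 / 2 : ℝ) *
      avgWeight (a n) 3 1 * M n ^ (3 / 4 : ℝ)) atTop (𝓝 0)
  /-- Bounded second moments `E h(X_{k_1}, …, X_{k_m})²`, where indices may repeat; a repeated index
  stands for one and the same variable, or for independent copies of it. -/
  vonMises : ∃ C : ℝ, ∀ᶠ n in atTop, ∀ k : Fin m → Fin (N n),
    (Integrable (fun ω => h n (fun l => X n (k l) ω) ^ 2) (P n) ∧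
      ∫ ω, h n (fun l => X n (k l) ω) ^ 2 ∂(P n) ≤ C) ∧
    (Integrable (fun y => h n y ^ 2) (Measure.pi fun l => (P n).map (X n (k l))) ∧
      ∫ y, h n y ^ 2 ∂(Measure.pi fun l => (P n).map (X n (k l))) ≤ C)
  /-- First homogeneity condition. -/
  homogeneity_one : TendstoInProb P (fun n ω => (N n : ℝ)⁻¹ * ∑ i, ∑ j,
    (hOne (P n) (X n) (a n) (h n) i (X n j ω) /
      ((N n : ℝ) * √(uVar (P n) (X n) (a n) (h n)))) ^ 2) 1
  /-- Second homogeneity condition. -/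
  homogeneity_two : TendstoInProb P (fun n ω => ((N n : ℝ) ^ 2)⁻¹ * ∑ i, (∑ j,
    hOne (P n) (X n) (a n) (h n) i (X n j ω) /
      ((N n : ℝ) * √(uVar (P n) (X n) (a n) (h n)))) ^ 2) 0
  /-- Third homogeneity condition. -/
  homogeneity_three : Tendsto (fun n => (N n : ℝ)⁻¹ * (uVar (P n) (X n) (a n) (h n))⁻¹ *
    avgWeight (a n) 2 1 * (meanGap (P n) (X n) (h n) ^ 2 + crossGap (P n) (X n) (h n) +
      (N n : ℝ)⁻¹)) atTop (𝓝 0)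

end Asymptotic

section Block

variable {𝓧 : Type*} {m : ℕ}

/-- The block of length `b` of the sequence `x` that starts at index `i`. -/
def block (b i : ℕ) (x : ℕ → 𝓧) : Fin b → 𝓧 := fun k => x (i + k)

/-- The moving-block resampling estimator `V*`, for the sample `x 0, …, x (n - 1)`, block length `b`
and scale parameter `c`: the average, over the `n - b + 1` blocks of length `b`, of the bootstrap
variances of the block U-statistic, divided by `c`. -/
def movingBlockVar (n b : ℕ) (c : ℝ) (a : (Fin m → Fin b) → ℝ) (h : (Fin m → 𝓧) → ℝ)
    (x : ℕ → 𝓧) : ℝ :=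
  1 / (c * ((n : ℝ) - (b : ℝ) + 1)) * ∑ i ∈ Finset.range (n - b + 1), bootVar a h (block b i x)

end Block

end WeightedU

end

/-! Given the data, a resampled block is an i.i.d. sample from the uniform law on the block,
so the Hájek decomposition applies to it conditionally: the bootstrap variance is
`N⁻³ ∑ᵢ ∑ⱼ ĥᵢ(X_j)²`, where `ĥᵢ` is the first order expansion of the kernel under the bootstrap
distribution, up to an error that only involves pairs of tuples sharing two indices. The projections
under the bootstrap distribution are averages of the kernel over all tuples of the block, and they
are `L²`-close to the true projections: their squared distance is of order `M_1² + M_2 + N⁻¹`. Hence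
`ĥᵢ(X_j)` may be replaced by `h_{1,i}(X_j)`, where tuples containing `j` outside the free position
are negligible and are dropped, because only fourth moments at distinct indices are controlled.

By the first homogeneity condition the normalized sum `∑ᵢ ∑ⱼ h_{1,i}(X_j)²` tends to `1` in
probability. The fourth moments and the rate for `A_{3,1}` make its variance vanish, which improves
the convergence to convergence in `L¹`. An `L¹` bound can be tested on the worst block of each
stage, so it is uniform over the blocks, and it survives averaging over dependent blocks. -/

namespace WeightedU

section ProductMeasure

variable {ι : Type*} {α : ι → Type*} [∀ i, MeasurableSpace (α i)]

theorem measurable_set_piecewise (A : Set ι) [DecidablePred (· ∈ A)] :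
    Measurable fun z : (∀ i, α i) × (∀ i, α i) => A.piecewise z.1 z.2 := by
  refine measurable_pi_lambda _ fun i => ?_
  by_cases hi : i ∈ A <;> simp only [Set.piecewise, hi, if_true, if_false] <;> fun_prop

theorem map_piecewise_prod_pi [Fintype ι] (A : Set ι) [DecidablePred (· ∈ A)]
    (μ : ∀ i, Measure (α i)) [∀ i, IsProbabilityMeasure (μ i)] :
    ((Measure.pi μ).prod (Measure.pi μ)).map (fun z => A.piecewise z.1 z.2) = Measure.pi μ := by
  refine (Measure.pi_eq fun s hs => ?_).symm
  have preimage_box : (fun z : (∀ i, α i) × (∀ i, α i) => A.piecewise z.1 z.2) ⁻¹' Set.univ.pi s =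
      Set.univ.pi (A.piecewise s fun _ => Set.univ) ×ˢ
        Set.univ.pi (A.piecewise (fun _ => Set.univ) s) := by
    ext z
    simp only [Set.mem_preimage, Set.mem_pi, Set.mem_univ, true_imp_iff, Set.mem_prod,
      ← forall_and]
    refine forall_congr' fun i => ?_
    by_cases hi : i ∈ A <;> simp [hi]
  rw [Measure.map_apply (measurable_set_piecewise A) (MeasurableSet.univ_pi hs), preimage_box,
    Measure.prod_prod, Measure.pi_pi, Measure.pi_pi, ← Finset.prod_mul_distrib]
  refine Finset.prod_congr rfl fun i _ => ?_
  by_cases hi : i ∈ A <;> simp [hi]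

theorem measurable_prod_update [DecidableEq ι] (l : ι) :
    Measurable fun z : α l × (∀ i, α i) => Function.update z.2 l z.1 :=
  measurable_update'.comp measurable_swap

theorem map_update_prod_pi [Fintype ι] [DecidableEq ι] (ν : ∀ i, Measure (α i))
    [∀ i, IsProbabilityMeasure (ν i)] (l : ι) (μ : Measure (α l)) [IsProbabilityMeasure μ] :
    (μ.prod (Measure.pi ν)).map (fun z => Function.update z.2 l z.1) =
      Measure.pi (Function.update ν l μ) := by
  have (i : ι) : IsProbabilityMeasure (Function.update ν l μ i) := by
    rcases eq_or_ne i l with rfl | hi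
    · simpa
    · simpa [hi] using inferInstanceAs (IsProbabilityMeasure (ν i))
  refine (Measure.pi_eq fun s hs => ?_).symm
  have preimage_box : (fun z : α l × (∀ i, α i) => Function.update z.2 l z.1) ⁻¹' Set.univ.pi s =
      s l ×ˢ Set.univ.pi (Function.update s l Set.univ) := by
    ext z
    simp only [Set.mem_preimage, Set.mem_prod, Set.mem_univ_pi,
      Function.forall_update_iff z.2 fun i x => x ∈ s i,
      Function.forall_update_iff s fun i t => z.2 i ∈ t, Set.mem_univ, true_and]
  rw [Measure.map_apply (measurable_prod_update l) (MeasurableSet.univ_pi hs), preimage_box,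
    Measure.prod_prod, Measure.pi_pi, ← Finset.mul_prod_erase _ _ (Finset.mem_univ l),
    ← Finset.mul_prod_erase _ _ (Finset.mem_univ l)]
  simp only [Function.update_self, measure_univ, one_mul]
  congr 1
  refine Finset.prod_congr rfl fun i hi => ?_
  simp [Finset.ne_of_mem_erase hi]

end ProductMeasure

section Independence

variable {ι : Type*} [Finite ι] {α : ι → Type*} [∀ i, MeasurableSpace (α i)]
  {Ω : Type*} [MeasurableSpace Ω] {P : Measure Ω} [IsProbabilityMeasure P]
  {X : ∀ i, Ω → α i}

theorem map_piecewise_independent_copy (hX : ∀ i, Measurable (X i)) (hind : iIndepFun X P)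
    (A : Set ι) [DecidablePred (· ∈ A)] :
    (P.prod P).map (fun z => A.piecewise (X · z.1) (X · z.2)) = P.map fun ω i => X i ω := by
  cases nonempty_fintype ι
  have hX' : Measurable fun ω i => X i ω := measurable_pi_lambda _ hX
  have hprob (i : ι) : IsProbabilityMeasure (P.map (X i)) :=
    Measure.isProbabilityMeasure_map (hX i).aemeasurable
  have hlaw := map_piecewise_prod_pi A fun i => P.map (X i)
  rwa [← hind.map_fun_eq_pi_map fun i => (hX i).aemeasurable, Measure.map_prod_map _ _ hX' hX',
    Measure.map_map (measurable_set_piecewise A) (hX'.prodMap hX')] at hlaw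

theorem integral_eq_integral_piecewise (hX : ∀ i, Measurable (X i)) (hind : iIndepFun X P)
    (A : Set ι) [DecidablePred (· ∈ A)] {F : (∀ i, α i) → ℝ} (hF : Measurable F)
    (hint : Integrable (fun ω => F fun i => X i ω) P) :
    ∫ ω, F (fun i => X i ω) ∂P =
      ∫ ω, ∫ ω', F (A.piecewise (X · ω) (X · ω')) ∂P ∂P := by
  have hX' : Measurable fun ω i => X i ω := measurable_pi_lambda _ hX
  have hm : Measurable fun z : Ω × Ω => A.piecewise (X · z.1) (X · z.2) :=
    (measurable_set_piecewise A).comp (hX'.prodMap hX')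
  have hmap := map_piecewise_independent_copy hX hind A
  have hprod : Integrable (fun z : Ω × Ω => F (A.piecewise (X · z.1) (X · z.2))) (P.prod P) := by
    refine (integrable_map_measure hF.aestronglyMeasurable hm.aemeasurable).1 ?_
    rw [hmap]
    exact (integrable_map_measure hF.aestronglyMeasurable hX'.aemeasurable).2 hint
  rw [← integral_prod _ hprod, ← integral_map hm.aemeasurable hF.aestronglyMeasurable, hmap,
    integral_map hX'.aemeasurable hF.aestronglyMeasurable]

theorem integral_mul_of_dependsOn_compl (hX : ∀ i, Measurable (X i)) (hind : iIndepFun X P)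
    {A : Set ι} {f g : (∀ i, α i) → ℝ} (hf : Measurable f) (hg : Measurable g)
    (hgA : DependsOn g A) (hfA : DependsOn f Aᶜ)
    (hint : Integrable (fun ω => g (fun i => X i ω) * f fun i => X i ω) P) :
    ∫ ω, g (fun i => X i ω) * f (fun i => X i ω) ∂P =
      (∫ ω, g (fun i => X i ω) ∂P) * ∫ ω, f (fun i => X i ω) ∂P := by
  classical
  have hg_piecewise (x y : ∀ i, α i) : g (A.piecewise x y) = g x :=
    hgA fun i hi => A.piecewise_eq_of_mem x y hi
  have hf_piecewise (x y : ∀ i, α i) : f (A.piecewise x y) = f y :=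
    hfA fun i hi => A.piecewise_eq_of_notMem x y hi
  rw [integral_eq_integral_piecewise hX hind A (F := fun x => g x * f x) (hg.mul hf) hint]
  simp only [hg_piecewise, hf_piecewise, integral_const_mul, integral_mul_const]

end Independence

section EvenPowers

variable {α β : Type*} [MeasurableSpace α] [MeasurableSpace β] {μ : Measure α} {n : ℕ}

theorem integrable_of_integrable_even_pow [IsFiniteMeasure μ] {f : α → ℝ} (hn : Even n)
    (hn0 : n ≠ 0) (hf : AEStronglyMeasurable f μ) (hint : Integrable (fun x => f x ^ n) μ) :
    Integrable f μ := by
  refine Integrable.mono' ((integrable_const (1 : ℝ)).add hint) hf (.of_forall fun x => ?_)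
  rw [Pi.add_apply, Real.norm_eq_abs, ← hn.pow_abs]
  rcases le_total |f x| 1 with h | h
  · linarith [pow_nonneg (abs_nonneg (f x)) n]
  · linarith [le_self_pow₀ h hn0]

theorem even_pow_integral_le [IsProbabilityMeasure μ] {f : α → ℝ} (hn : Even n) (hn0 : n ≠ 0)
    (hf : AEStronglyMeasurable f μ) (hint : Integrable (fun x => f x ^ n) μ) :
    (∫ x, f x ∂μ) ^ n ≤ ∫ x, f x ^ n ∂μ :=
  hn.convexOn_pow.map_integral_le (continuous_pow n).continuousOn isClosed_univ
    (by simp) (integrable_of_integrable_even_pow hn hn0 hf hint) hint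

variable {ν : Measure β} [IsProbabilityMeasure ν] [SFinite μ] {f : α × β → ℝ}

theorem ae_even_pow_integral_prod_le (hn : Even n) (hn0 : n ≠ 0) (hf : Measurable f)
    (hint : Integrable (fun z => f z ^ n) (μ.prod ν)) :
    ∀ᵐ x ∂μ, (∫ y, f (x, y) ∂ν) ^ n ≤ ∫ y, f (x, y) ^ n ∂ν := by
  filter_upwards [hint.prod_right_ae] with x hx
  exact even_pow_integral_le hn hn0 (hf.comp measurable_prodMk_left).aestronglyMeasurable hx

theorem integrable_even_pow_integral_prod (hn : Even n) (hn0 : n ≠ 0) (hf : Measurable f)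
    (hint : Integrable (fun z => f z ^ n) (μ.prod ν)) :
    Integrable (fun x => (∫ y, f (x, y) ∂ν) ^ n) μ := by
  refine Integrable.mono' hint.integral_prod_left
    (hf.stronglyMeasurable.integral_prod_right'.measurable.pow_const n).aestronglyMeasurable ?_
  filter_upwards [ae_even_pow_integral_prod_le hn hn0 hf hint] with x hx
  rwa [Real.norm_eq_abs, abs_of_nonneg (hn.pow_nonneg _)]

theorem integral_even_pow_integral_prod_le (hn : Even n) (hn0 : n ≠ 0) (hf : Measurable f)
    (hint : Integrable (fun z => f z ^ n) (μ.prod ν)) :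
    ∫ x, (∫ y, f (x, y) ∂ν) ^ n ∂μ ≤ ∫ z, f z ^ n ∂(μ.prod ν) := by
  rw [integral_prod _ hint]
  exact integral_mono_ae (integrable_even_pow_integral_prod hn hn0 hf hint)
    hint.integral_prod_left (ae_even_pow_integral_prod_le hn hn0 hf hint)

end EvenPowers

section ReplaceIndex

variable {m N : ℕ}

/-- The index tuple `I` with its `l`-th entry replaced by `j`, an index that does not occur at any
other place of `I`. -/
def replaceIndex (I : Fin m ↪ Fin N) (l : Fin m) (j : Fin N) (hj : ∀ k, k ≠ l → I k ≠ j) :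
    Fin m ↪ Fin N where
  toFun := Function.update I l j
  inj' := by
    intro k k' hkk
    simp only [Function.update_apply] at hkk
    split_ifs at hkk with hk hk' hk'
    · rw [hk, hk']
    · exact absurd hkk.symm (hj k' hk')
    · exact absurd hkk (hj k hk)
    · exact I.injective hkk

theorem coe_replaceIndex (I : Fin m ↪ Fin N) (l : Fin m) (j : Fin N)
    (hj : ∀ k, k ≠ l → I k ≠ j) : ⇑(replaceIndex I l j hj) = Function.update I l j := rfl

@[simp] theorem replaceIndex_self (I : Fin m ↪ Fin N) (l : Fin m) (j : Fin N)
    (hj : ∀ k, k ≠ l → I k ≠ j) : replaceIndex I l j hj l = j := by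
  simp [coe_replaceIndex]

theorem replaceIndex_of_ne (I : Fin m ↪ Fin N) (l : Fin m) (j : Fin N)
    (hj : ∀ k, k ≠ l → I k ≠ j) {k : Fin m} (hk : k ≠ l) : replaceIndex I l j hj k = I k := by
  simp [coe_replaceIndex, hk]

end ReplaceIndex

section Projection

variable {𝓧 : Type*} [MeasurableSpace 𝓧] {m N : ℕ} {Ω : Type*} [MeasurableSpace Ω]
  {P : Measure Ω} [IsProbabilityMeasure P] {X : Fin N → Ω → 𝓧} {h : (Fin m → 𝓧) → ℝ}

theorem isProbabilityMeasure_law (hX : ∀ i, Measurable (X i)) (i : Fin N) :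
    IsProbabilityMeasure (P.map (X i)) :=
  Measure.isProbabilityMeasure_map (hX i).aemeasurable

theorem map_tuple (hX : ∀ i, Measurable (X i)) (hind : iIndepFun X P) (I : Fin m ↪ Fin N) :
    P.map (fun ω l => X (I l) ω) = Measure.pi fun l => P.map (X (I l)) :=
  (iIndepFun_iff_map_fun_eq_pi_map fun l => (hX (I l)).aemeasurable).1
    (hind.precomp I.injective)

theorem integral_tuple (hX : ∀ i, Measurable (X i)) (hind : iIndepFun X P) {f : (Fin m → 𝓧) → ℝ}
    (hf : Measurable f) (I : Fin m ↪ Fin N) :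
    ∫ y, f y ∂(Measure.pi fun k => P.map (X (I k))) = ∫ ω, f (fun k => X (I k) ω) ∂P := by
  rw [← map_tuple hX hind I, integral_map (measurable_pi_lambda _ fun k => hX (I k)).aemeasurable
    hf.aestronglyMeasurable]

theorem integrable_tuple (hX : ∀ i, Measurable (X i)) (hind : iIndepFun X P)
    {f : (Fin m → 𝓧) → ℝ} (hf : Measurable f) (I : Fin m ↪ Fin N) :
    Integrable f (Measure.pi fun k => P.map (X (I k))) ↔
      Integrable (fun ω => f (fun k => X (I k) ω)) P := by
  rw [← map_tuple hX hind I]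
  exact integrable_map_measure hf.aestronglyMeasurable
    (measurable_pi_lambda _ fun k => hX (I k)).aemeasurable

theorem measurable_proj (hX : ∀ i, Measurable (X i)) (hh : Measurable h)
    (I : Fin m ↪ Fin N) (l : Fin m) : Measurable (proj P X h I l) := by
  have := isProbabilityMeasure_law (P := P) hX
  exact (hh.comp (measurable_prod_update l)).stronglyMeasurable.integral_prod_right'.measurable

theorem proj_eq_integral_update (hX : ∀ i, Measurable (X i)) (hind : iIndepFun X P)
    (hh : Measurable h) (I : Fin m ↪ Fin N) (l : Fin m) (x : 𝓧) :
    proj P X h I l x = ∫ ω, h (Function.update (fun k => X (I k) ω) l x) ∂P :=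
  integral_tuple hX hind (hh.comp measurable_update_left) I

theorem proj_eq_integral_dirac (hX : ∀ i, Measurable (X i)) (hh : Measurable h)
    (I : Fin m ↪ Fin N) (l : Fin m) (x : 𝓧) :
    proj P X h I l x = ∫ y, h y ∂(Measure.pi
      (Function.update (fun k => P.map (X (I k))) l (Measure.dirac x))) := by
  have := isProbabilityMeasure_law (P := P) hX
  have hm : Measurable fun z : 𝓧 × (Fin m → 𝓧) => Function.update z.2 l z.1 :=
    measurable_prod_update l
  rw [← map_update_prod_pi, integral_map hm.aemeasurable hh.aestronglyMeasurable,
    Measure.dirac_prod, integral_map (f := fun z : 𝓧 × (Fin m → 𝓧) => h (Function.update z.2 l z.1))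
      measurable_prodMk_left.aemeasurable (hh.comp hm).aestronglyMeasurable]
  rfl

theorem proj_congr (hX : ∀ i, Measurable (X i)) (hh : Measurable h)
    {I J : Fin m ↪ Fin N} {l : Fin m} (hIJ : ∀ k, k ≠ l → I k = J k) (x : 𝓧) :
    proj P X h I l x = proj P X h J l x := by
  rw [proj_eq_integral_dirac hX hh, proj_eq_integral_dirac hX hh]
  congr 2
  ext1 k
  rcases eq_or_ne k l with rfl | hk
  · simp
  · simp [hk, hIJ k hk]

theorem integral_mul_proj (hX : ∀ i, Measurable (X i)) (hind : iIndepFun X P) (hh : Measurable h)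
    {A : Set (Fin N)} {g : (Fin N → 𝓧) → ℝ} (hg : Measurable g) (hgA : DependsOn g A)
    {I : Fin m ↪ Fin N} {p : Fin m} (hI : ∀ l, I l ∈ A ↔ l = p)
    (hint : Integrable (fun ω => g (fun i => X i ω) * h (fun l => X (I l) ω)) P) :
    ∫ ω, g (fun i => X i ω) * proj P X h I p (X (I p) ω) ∂P =
      ∫ ω, g (fun i => X i ω) * h (fun l => X (I l) ω) ∂P := by
  classical
  have hg_piecewise (x y : Fin N → 𝓧) : g (A.piecewise x y) = g x :=
    hgA fun i hi => A.piecewise_eq_of_mem x y hi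
  have tuple_piecewise (x y : Fin N → 𝓧) :
      (fun l => A.piecewise x y (I l)) = Function.update (fun l => y (I l)) p (x (I p)) := by
    ext1 l
    rcases eq_or_ne l p with rfl | hl
    · simp [(hI l).2 rfl]
    · simp [(hI l).not.2 hl, hl]
  rw [integral_eq_integral_piecewise hX hind A (F := fun x => g x * h fun l => x (I l))
    (hg.mul (hh.comp (by fun_prop))) hint]
  simp only [hg_piecewise, tuple_piecewise, integral_const_mul,
    ← proj_eq_integral_update hX hind hh]

section Moments

variable {n : ℕ} (hX : ∀ i, Measurable (X i)) (hh : Measurable h) {I : Fin m ↪ Fin N}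
  {l : Fin m} {j : Fin N} (hn : Even n) (hn0 : n ≠ 0)
include hX hh hn hn0

theorem integrable_proj_even_pow (hint : Integrable (fun y => h y ^ n)
    (Measure.pi fun k => P.map (X (Function.update I l j k)))) :
    Integrable (fun ω => proj P X h I l (X j ω) ^ n) P := by
  have := isProbabilityMeasure_law (P := P) hX
  have hm : Measurable fun z : 𝓧 × (Fin m → 𝓧) => Function.update z.2 l z.1 :=
    measurable_prod_update l
  rw [funext fun k => Function.apply_update (fun _ i => P.map (X i)) I l j k,
    ← map_update_prod_pi] at hint
  exact (integrable_even_pow_integral_prod hn hn0 (hh.comp hm)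
    (hint.comp_measurable hm)).comp_measurable (hX j)

theorem integral_proj_even_pow_le (hint : Integrable (fun y => h y ^ n)
    (Measure.pi fun k => P.map (X (Function.update I l j k)))) :
    ∫ ω, proj P X h I l (X j ω) ^ n ∂P ≤
      ∫ y, h y ^ n ∂(Measure.pi fun k => P.map (X (Function.update I l j k))) := by
  have := isProbabilityMeasure_law (P := P) hX
  have hm : Measurable fun z : 𝓧 × (Fin m → 𝓧) => Function.update z.2 l z.1 :=
    measurable_prod_update l
  rw [funext fun k => Function.apply_update (fun _ i => P.map (X i)) I l j k,
    ← map_update_prod_pi] at hint ⊢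
  rw [integral_map hm.aemeasurable (hh.pow_const n).aestronglyMeasurable,
    ← integral_map (f := fun x => proj P X h I l x ^ n) (hX j).aemeasurable
      ((measurable_proj hX hh I l).pow_const n).aestronglyMeasurable]
  exact integral_even_pow_integral_prod_le hn hn0 (hh.comp hm) (hint.comp_measurable hm)

end Moments

end Projection

section SecondMoments

variable {Ω : Type*} [MeasurableSpace Ω] {P : Measure Ω}

theorem integral_sum_mul_sum {ι κ : Type*} (s : Finset ι) (t : Finset κ) (c : ι → ℝ) (d : κ → ℝ)
    {f : ι → Ω → ℝ} {g : κ → Ω → ℝ} (hf : ∀ i ∈ s, MemLp (f i) 2 P)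
    (hg : ∀ j ∈ t, MemLp (g j) 2 P) :
    ∫ ω, (∑ i ∈ s, c i * f i ω) * (∑ j ∈ t, d j * g j ω) ∂P =
      ∑ i ∈ s, ∑ j ∈ t, c i * d j * ∫ ω, f i ω * g j ω ∂P := by
  have hfg : ∀ i ∈ s, ∀ j ∈ t, Integrable (fun ω => c i * f i ω * (d j * g j ω)) P :=
    fun i hi j hj => ((hf i hi).const_mul _).integrable_mul ((hg j hj).const_mul _)
  simp only [Finset.sum_mul_sum]
  rw [integral_finsetSum _ fun i hi => integrable_finsetSum _ (hfg i hi)]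
  refine Finset.sum_congr rfl fun i hi => ?_
  rw [integral_finsetSum _ (hfg i hi)]
  simp only [mul_mul_mul_comm (c i), integral_const_mul]

theorem integral_sum_sq {ι : Type*} (s : Finset ι) (c : ι → ℝ)
    {f : ι → Ω → ℝ} (hf : ∀ i ∈ s, MemLp (f i) 2 P) :
    ∫ ω, (∑ i ∈ s, c i * f i ω) ^ 2 ∂P =
      ∑ i ∈ s, ∑ j ∈ s, c i * c j * ∫ ω, f i ω * f j ω ∂P := by
  simp only [pow_two]
  exact integral_sum_mul_sum s s c c hf hf

theorem integral_add_sq_of_integral_mul_eq_zero {f g : Ω → ℝ} (hf : MemLp f 2 P)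
    (hg : MemLp g 2 P) (hfg : ∫ ω, f ω * g ω ∂P = 0) :
    ∫ ω, (f ω + g ω) ^ 2 ∂P = ∫ ω, f ω ^ 2 ∂P + ∫ ω, g ω ^ 2 ∂P := by
  have hcross : Integrable (fun ω => 2 * f ω * g ω) P := (hf.const_mul 2).integrable_mul hg
  have hsum : Integrable (fun ω => f ω ^ 2 + 2 * f ω * g ω) P := hf.integrable_sq.add hcross
  simp only [add_sq]
  rw [integral_add hsum hg.integrable_sq,
    integral_add hf.integrable_sq hcross]
  simp only [mul_assoc, integral_const_mul, hfg, mul_zero, add_zero]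

theorem abs_integral_mul_le {f g : Ω → ℝ} (hf : MemLp f 2 P) (hg : MemLp g 2 P) {K : ℝ}
    (hfK : ∫ ω, f ω ^ 2 ∂P ≤ K) (hgK : ∫ ω, g ω ^ 2 ∂P ≤ K) : |∫ ω, f ω * g ω ∂P| ≤ K := by
  calc |∫ ω, f ω * g ω ∂P| ≤ ∫ ω, |f ω * g ω| ∂P := abs_integral_le_integral_abs
    _ ≤ ∫ ω, 2⁻¹ * (f ω ^ 2 + g ω ^ 2) ∂P := by
        refine integral_mono (hf.integrable_mul hg).abs
          ((hf.integrable_sq.add hg.integrable_sq).const_mul _) fun ω => ?_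
        simp only [abs_mul]
        nlinarith [sq_nonneg (|f ω| - |g ω|), sq_abs (f ω), sq_abs (g ω)]
    _ = 2⁻¹ * (∫ ω, f ω ^ 2 ∂P + ∫ ω, g ω ^ 2 ∂P) := by
        rw [integral_const_mul, integral_add hf.integrable_sq hg.integrable_sq]
    _ ≤ K := by linarith

end SecondMoments

section Weights

variable {m N : ℕ}

/-- The factor `(N - m)! / (N - 1)!` of `h_{1,i}`; it is `N` times the factor of the U-statistic. -/
noncomputable def normFactor (m N : ℕ) : ℝ := ((N - m)! : ℝ) / ((N - 1)! : ℝ)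

theorem normFactor_nonneg (m N : ℕ) : 0 ≤ normFactor m N := by
  unfold normFactor; positivity

theorem inv_mul_normFactor (hN : 0 < N) :
    (N : ℝ)⁻¹ * normFactor m N = ((N - m)! : ℝ) / (N ! : ℝ) := by
  rw [normFactor, ← Nat.mul_factorial_pred hN.ne']
  push_cast
  field_simp

/-- The sum over the `K`-tuples that `avgWeight a K q` averages, normalized as in `K` factors
`h_{1,i}`. -/
noncomputable def sharedWeight (a : (Fin m → Fin N) → ℝ) (K q : ℕ) : ℝ :=
  normFactor m N ^ K * ∑ I ∈ sharingTuples m N K q, |∏ k, a (I k)|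

theorem sharedWeight_nonneg (a : (Fin m → Fin N) → ℝ) (K q : ℕ) : 0 ≤ sharedWeight a K q :=
  mul_nonneg (pow_nonneg (normFactor_nonneg _ _) _) (Finset.sum_nonneg fun _ _ => abs_nonneg _)

/-- The coefficient with which the projection of the kernel at `I` on its `l`-th argument,
`t = (l, I)`, enters `h_{1,i}`. -/
noncomputable def coef (a : (Fin m → Fin N) → ℝ) (i : Fin N) (t : Fin m × (Fin m ↪ Fin N)) : ℝ :=
  if t.2 t.1 = i then normFactor m N * a t.2 else 0

theorem sum_coef_mul (a : (Fin m → Fin N) → ℝ) (i : Fin N) (Z : Fin m → (Fin m ↪ Fin N) → ℝ) :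
    ∑ t : Fin m × (Fin m ↪ Fin N), coef a i t * Z t.1 t.2 =
      normFactor m N * ∑ l : Fin m,
        ∑ I ∈ Finset.univ.filter (fun I : Fin m ↪ Fin N => I l = i), a I * Z l I := by
  rw [Fintype.sum_prod_type, Finset.mul_sum]
  refine Finset.sum_congr rfl fun l _ => ?_
  rw [Finset.mul_sum, Finset.sum_filter]
  refine Finset.sum_congr rfl fun I _ => ?_
  simp only [coef, ite_mul, zero_mul, mul_assoc]

theorem mem_commonIndices_pair {I J : Fin m ↪ Fin N} {x : Fin N} :
    x ∈ commonIndices ![I, J] ↔ (∃ l, I l = x) ∧ ∃ l, J l = x := by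
  simp [commonIndices, Fin.forall_fin_two]

theorem sum_sharingTuples_two (q : ℕ) (f : (Fin m ↪ Fin N) → (Fin m ↪ Fin N) → ℝ) :
    ∑ I ∈ sharingTuples m N 2 q, f (I 0) (I 1) =
      ∑ I, ∑ J, if ![I, J] ∈ sharingTuples m N 2 q then f I J else 0 := by
  rw [← Fintype.sum_prod_type', ← (finTwoArrowEquiv (Fin m ↪ Fin N)).sum_comp,
    ← Finset.sum_filter]
  refine Finset.sum_congr ?_ fun I _ => rfl
  ext I
  have eta : ![I 0, I 1] = I := (FinVec.etaExpand_eq I)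
  simp [eta]

end Weights

/-- A sample of independent variables, together with a kernel that is square integrable at every
tuple of distinct indices: the setting of the Hájek decomposition. -/
structure SquareIntegrable {𝓧 Ω : Type*} [MeasurableSpace 𝓧] [MeasurableSpace Ω] {m N : ℕ}
    (P : Measure Ω) (X : Fin N → Ω → 𝓧) (h : (Fin m → 𝓧) → ℝ) : Prop where
  measurable_sample : ∀ i, Measurable (X i)
  indep : iIndepFun X P
  measurable_kernel : Measurable h
  memLp : ∀ I : Fin m ↪ Fin N, MemLp (fun ω => h fun l => X (I l) ω) 2 P

section Hajek

variable {𝓧 : Type*} [MeasurableSpace 𝓧] {m N : ℕ} {Ω : Type*} [MeasurableSpace Ω]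
  {P : Measure Ω} {X : Fin N → Ω → 𝓧} {h : (Fin m → 𝓧) → ℝ} {a : (Fin m → Fin N) → ℝ}

/-- The summand `f^{(l)}_I - θ(I)` of `h_{1,i}`: the projection of the kernel at `I` on its `l`-th
argument, centered. -/
noncomputable def centeredProj (P : Measure Ω) (X : Fin N → Ω → 𝓧) (h : (Fin m → 𝓧) → ℝ)
    (I : Fin m ↪ Fin N) (l : Fin m) (x : 𝓧) : ℝ :=
  proj P X h I l x - theta P X h I

/-- What remains of the kernel at `I` after subtraction of its mean and its centered projections. -/
noncomputable def residual (P : Measure Ω) (X : Fin N → Ω → 𝓧) (h : (Fin m → 𝓧) → ℝ)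
    (I : Fin m ↪ Fin N) (x : Fin N → 𝓧) : ℝ :=
  h (fun l => x (I l)) - theta P X h I - ∑ p, centeredProj P X h I p (x (I p))

theorem hOne_eq_sum (i : Fin N) (x : 𝓧) : hOne P X a h i x =
    ∑ t : Fin m × (Fin m ↪ Fin N), coef a i t * centeredProj P X h t.2 t.1 x :=
  (sum_coef_mul a i fun l I => centeredProj P X h I l x).symm

theorem inv_mul_sum_hOne (hN : 0 < N) (x : Fin N → 𝓧) :
    (N : ℝ)⁻¹ * ∑ i, hOne P X a h i (x i) = ((N - m)! : ℝ) / (N ! : ℝ) *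
      ∑ I : Fin m ↪ Fin N, a I * ∑ p, centeredProj P X h I p (x (I p)) := by
  have collapse (t : Fin m × (Fin m ↪ Fin N)) :
      ∑ i, coef a i t * centeredProj P X h t.2 t.1 (x i) =
        normFactor m N * (a t.2 * centeredProj P X h t.2 t.1 (x (t.2 t.1))) := by
    simp only [coef, ite_mul, zero_mul, Finset.sum_ite_eq, Finset.mem_univ, if_true, mul_assoc]
  simp only [hOne_eq_sum]
  rw [Finset.sum_comm, Finset.sum_congr rfl fun t _ => collapse t, ← Finset.mul_sum, ← mul_assoc,
    inv_mul_normFactor hN, Fintype.sum_prod_type_right]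
  simp only [Finset.mul_sum]

theorem uStat_eq_hajek (hN : 0 < N) (x : Fin N → 𝓧) :
    uStat a h x = ((N - m)! : ℝ) / (N ! : ℝ) * ∑ I : Fin m ↪ Fin N, a I * theta P X h I +
      ((N : ℝ)⁻¹ * ∑ i, hOne P X a h i (x i) +
      ∑ I : Fin m ↪ Fin N, (N : ℝ)⁻¹ * normFactor m N * a I * residual P X h I x) := by
  rw [inv_mul_sum_hOne hN, inv_mul_normFactor hN, uStat]
  simp only [mul_assoc]
  rw [← Finset.mul_sum, ← mul_add, ← mul_add, ← Finset.sum_add_distrib, ← Finset.sum_add_distrib]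
  congr 1
  refine Finset.sum_congr rfl fun I _ => ?_
  rw [residual]
  ring

theorem dependsOn_residual (I : Fin m ↪ Fin N) :
    DependsOn (residual P X h I) (Set.range I) := by
  intro x y hxy
  have coord_eq (l : Fin m) : x (I l) = y (I l) := hxy _ ⟨l, rfl⟩
  simp only [residual, coord_eq]

variable [IsProbabilityMeasure P]

theorem measurable_centeredProj (hX : ∀ i, Measurable (X i)) (hh : Measurable h)
    (I : Fin m ↪ Fin N) (l : Fin m) : Measurable (centeredProj P X h I l) :=
  (measurable_proj hX hh I l).sub_const _

theorem measurable_residual (hX : ∀ i, Measurable (X i)) (hh : Measurable h) (I : Fin m ↪ Fin N) :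
    Measurable (residual P X h I) :=
  ((hh.comp (by fun_prop)).sub_const _).sub <| Finset.measurable_sum _ fun p _ =>
    (measurable_centeredProj hX hh I p).comp (measurable_pi_apply _)

theorem measurable_hOne (hX : ∀ i, Measurable (X i)) (hh : Measurable h) (i : Fin N) :
    Measurable (hOne P X a h i) := by
  simp only [funext (hOne_eq_sum i)]
  exact Finset.measurable_sum _ fun t _ => (measurable_centeredProj hX hh t.2 t.1).const_mul _

namespace SquareIntegrable

theorem memLp_proj (H : SquareIntegrable P X h) (I : Fin m ↪ Fin N) (l : Fin m) :
    MemLp (fun ω => proj P X h I l (X (I l) ω)) 2 P := by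
  have hm := (measurable_proj (P := P) H.measurable_sample H.measurable_kernel I l).comp
    (H.measurable_sample (I l))
  refine (memLp_two_iff_integrable_sq hm.aestronglyMeasurable).2 <|
    integrable_proj_even_pow H.measurable_sample H.measurable_kernel even_two two_ne_zero ?_
  rw [Function.update_eq_self]
  exact (integrable_tuple H.measurable_sample H.indep (H.measurable_kernel.pow_const 2) I).2
    (H.memLp I).integrable_sq

theorem memLp_centeredProj (H : SquareIntegrable P X h) (I : Fin m ↪ Fin N) (l : Fin m) :
    MemLp (fun ω => centeredProj P X h I l (X (I l) ω)) 2 P :=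
  (H.memLp_proj I l).sub (memLp_const _)

theorem memLp_residual (H : SquareIntegrable P X h) (I : Fin m ↪ Fin N) :
    MemLp (fun ω => residual P X h I fun i => X i ω) 2 P :=
  ((H.memLp I).sub (memLp_const _)).sub <|
    memLp_finsetSum Finset.univ fun p _ => H.memLp_centeredProj I p

section Orthogonality

variable {A : Set (Fin N)} {g : (Fin N → 𝓧) → ℝ} {I : Fin m ↪ Fin N} {p : Fin m}

theorem integral_mul_centeredProj_of_mem (H : SquareIntegrable P X h) (hg : Measurable g)
    (hgA : DependsOn g A) (hg2 : MemLp (fun ω => g fun i => X i ω) 2 P)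
    (hI : ∀ l, I l ∈ A ↔ l = p) :
    ∫ ω, g (fun i => X i ω) * centeredProj P X h I p (X (I p) ω) ∂P =
      ∫ ω, g (fun i => X i ω) * (h (fun l => X (I l) ω) - theta P X h I) ∂P := by
  have hgh : Integrable (fun ω => g (fun i => X i ω) * h fun l => X (I l) ω) P :=
    hg2.integrable_mul (H.memLp I)
  have hgp : Integrable (fun ω => g (fun i => X i ω) * proj P X h I p (X (I p) ω)) P :=
    hg2.integrable_mul (H.memLp_proj I p)
  have hgθ : Integrable (fun ω => g (fun i => X i ω) * theta P X h I) P :=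
    (hg2.integrable one_le_two).mul_const _
  simp only [centeredProj, mul_sub]
  rw [integral_sub hgp hgθ, integral_sub hgh hgθ,
    integral_mul_proj H.measurable_sample H.indep H.measurable_kernel hg hgA hI hgh]

theorem integral_mul_kernel_sub_theta (H : SquareIntegrable P X h) (hg : Measurable g)
    (hgA : DependsOn g A) (hg2 : MemLp (fun ω => g fun i => X i ω) 2 P) (hI : ∀ l, I l ∉ A) :
    ∫ ω, g (fun i => X i ω) * (h (fun l => X (I l) ω) - theta P X h I) ∂P = 0 := by
  rw [integral_mul_of_dependsOn_compl H.measurable_sample H.indep (A := A)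
    (f := fun x => h (fun l => x (I l)) - theta P X h I)
    ((H.measurable_kernel.comp (by fun_prop)).sub_const _) hg hgA
    (fun x y hxy => by simp only [fun l => hxy (I l) (hI l)])
    (hg2.integrable_mul ((H.memLp I).sub (memLp_const _))),
    integral_sub ((H.memLp I).integrable one_le_two) (integrable_const _)]
  simp [theta]

theorem integral_centeredProj (H : SquareIntegrable P X h) (I : Fin m ↪ Fin N) (p : Fin m) :
    ∫ ω, centeredProj P X h I p (X (I p) ω) ∂P = 0 := by
  have centered := H.integral_mul_kernel_sub_theta (A := ∅) (g := fun _ => 1) (I := I)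
    measurable_const (fun _ _ _ => rfl) (memLp_const _) (fun _ => Set.notMem_empty _)
  rw [← H.integral_mul_centeredProj_of_mem (A := {I p}) (p := p) measurable_const
    (fun _ _ _ => rfl) (memLp_const _) (by simp)] at centered
  simpa using centered

theorem integral_mul_centeredProj_of_notMem (H : SquareIntegrable P X h) (hg : Measurable g)
    (hgA : DependsOn g A) (hg2 : MemLp (fun ω => g fun i => X i ω) 2 P) (hp : I p ∉ A) :
    ∫ ω, g (fun i => X i ω) * centeredProj P X h I p (X (I p) ω) ∂P = 0 := by
  rw [integral_mul_of_dependsOn_compl H.measurable_sample H.indep (A := A)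
    (f := fun x => centeredProj P X h I p (x (I p)))
    ((measurable_centeredProj H.measurable_sample H.measurable_kernel I p).comp
      (measurable_pi_apply _)) hg hgA (fun x y hxy => by simp only [hxy (I p) hp])
    (hg2.integrable_mul (H.memLp_centeredProj I p)), H.integral_centeredProj, mul_zero]

theorem integral_mul_residual (H : SquareIntegrable P X h) (hg : Measurable g)
    (hgA : DependsOn g A) (hg2 : MemLp (fun ω => g fun i => X i ω) 2 P)
    (hA : ∀ l l', I l ∈ A → I l' ∈ A → l = l') :
    ∫ ω, g (fun i => X i ω) * residual P X h I (fun i => X i ω) ∂P = 0 := by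
  have hgh : Integrable (fun ω =>
      g (fun i => X i ω) * (h (fun l => X (I l) ω) - theta P X h I)) P :=
    hg2.integrable_mul ((H.memLp I).sub (memLp_const _))
  have hgp (p : Fin m) : Integrable (fun ω =>
      g (fun i => X i ω) * centeredProj P X h I p (X (I p) ω)) P :=
    hg2.integrable_mul (H.memLp_centeredProj I p)
  simp only [residual, mul_sub _ (_ - _), Finset.mul_sum]
  rw [integral_sub hgh (integrable_finsetSum _ fun p _ => hgp p),
    integral_finsetSum _ fun p _ => hgp p, sub_eq_zero]
  by_cases hex : ∃ p, I p ∈ A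
  · obtain ⟨p, hp⟩ := hex
    rw [Finset.sum_eq_single p, H.integral_mul_centeredProj_of_mem hg hgA hg2
      fun l => ⟨fun hl => hA l p hl hp, fun e => e ▸ hp⟩]
    · exact fun q _ hq =>
        H.integral_mul_centeredProj_of_notMem hg hgA hg2 fun hqA => hq (hA q p hqA hp)
    · simp
  · push Not at hex
    rw [H.integral_mul_kernel_sub_theta hg hgA hg2 hex, Finset.sum_eq_zero fun q _ =>
      H.integral_mul_centeredProj_of_notMem hg hgA hg2 (hex q)]

end Orthogonality

theorem integral_residual (H : SquareIntegrable P X h) (I : Fin m ↪ Fin N) :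
    ∫ ω, residual P X h I (fun i => X i ω) ∂P = 0 := by
  simpa using H.integral_mul_residual (I := I) (A := ∅) (g := fun _ => 1) measurable_const
    (fun _ _ _ => rfl) (memLp_const _) (by simp)

theorem integral_apply_mul_residual (H : SquareIntegrable P X h) (I : Fin m ↪ Fin N) (j : Fin N)
    {f : 𝓧 → ℝ} (hf : Measurable f) (hf2 : MemLp (fun ω => f (X j ω)) 2 P) :
    ∫ ω, f (X j ω) * residual P X h I (fun i => X i ω) ∂P = 0 :=
  H.integral_mul_residual (A := {j}) (g := fun x => f (x j)) (hf.comp (measurable_pi_apply _))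
    (fun x y hxy => by simp only [hxy j rfl]) hf2
    (fun _ _ hl hl' => I.injective (hl.trans hl'.symm))

theorem integral_residual_mul_residual (H : SquareIntegrable P X h) {I J : Fin m ↪ Fin N}
    (hIJ : ![I, J] ∉ sharingTuples m N 2 2) :
    ∫ ω, residual P X h I (fun i => X i ω) * residual P X h J (fun i => X i ω) ∂P = 0 := by
  refine H.integral_mul_residual (measurable_residual H.measurable_sample H.measurable_kernel I)
    (dependsOn_residual I) (H.memLp_residual I) ?_
  rintro l l' ⟨k, hk⟩ ⟨k', hk'⟩
  by_contra hne
  refine hIJ (Finset.mem_filter.2 ⟨Finset.mem_univ _, Finset.one_lt_card.2 ⟨J l, ?_, J l', ?_, ?_⟩⟩)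
  · exact mem_commonIndices_pair.2 ⟨⟨k, hk⟩, ⟨l, rfl⟩⟩
  · exact mem_commonIndices_pair.2 ⟨⟨k', hk'⟩, ⟨l', rfl⟩⟩
  · exact fun e => hne (J.injective e)

theorem memLp_theta_add_sum_centeredProj (H : SquareIntegrable P X h) (I : Fin m ↪ Fin N) :
    MemLp (fun ω => theta P X h I + ∑ p, centeredProj P X h I p (X (I p) ω)) 2 P :=
  have memLp_sum : MemLp (fun ω => ∑ p, centeredProj P X h I p (X (I p) ω)) 2 P :=
    memLp_finsetSum _ fun p _ => H.memLp_centeredProj I p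
  (memLp_const (theta P X h I)).add memLp_sum

theorem integral_theta_add_sum_centeredProj_mul_residual (H : SquareIntegrable P X h)
    (I : Fin m ↪ Fin N) :
    ∫ ω, (theta P X h I + ∑ p, centeredProj P X h I p (X (I p) ω)) *
      residual P X h I (fun i => X i ω) ∂P = 0 := by
  have hθR : Integrable (fun ω => theta P X h I * residual P X h I fun i => X i ω) P :=
    ((H.memLp_residual I).integrable one_le_two).const_mul _
  have hcR (p : Fin m) : Integrable (fun ω =>
      centeredProj P X h I p (X (I p) ω) * residual P X h I fun i => X i ω) P :=
    (H.memLp_centeredProj I p).integrable_mul (H.memLp_residual I)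
  simp only [add_mul, Finset.sum_mul]
  rw [integral_add hθR (integrable_finsetSum _ fun p _ => hcR p), integral_const_mul,
    H.integral_residual, integral_finsetSum _ fun p _ => hcR p, mul_zero, zero_add]
  exact Finset.sum_eq_zero fun p _ => H.integral_apply_mul_residual I (I p)
    (measurable_centeredProj H.measurable_sample H.measurable_kernel I p)
    (H.memLp_centeredProj I p)

theorem integral_residual_sq_le (H : SquareIntegrable P X h) (I : Fin m ↪ Fin N) :
    ∫ ω, residual P X h I (fun i => X i ω) ^ 2 ∂P ≤ ∫ ω, h (fun k => X (I k) ω) ^ 2 ∂P := by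
  have kernel_eq (ω : Ω) : h (fun k => X (I k) ω) =
      theta P X h I + ∑ p, centeredProj P X h I p (X (I p) ω) +
        residual P X h I fun i => X i ω := by
    rw [residual]
    ring
  simp only [kernel_eq]
  rw [integral_add_sq_of_integral_mul_eq_zero (H.memLp_theta_add_sum_centeredProj I)
    (H.memLp_residual I) (H.integral_theta_add_sum_centeredProj_mul_residual I)]
  exact le_add_of_nonneg_left (integral_nonneg fun ω => sq_nonneg _)

theorem memLp_hOne (H : SquareIntegrable P X h) (i : Fin N) :
    MemLp (fun ω => hOne P X a h i (X i ω)) 2 P := by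
  simp only [hOne_eq_sum]
  refine memLp_finsetSum _ fun t _ => ?_
  by_cases ht : t.2 t.1 = i
  · exact ht ▸ (H.memLp_centeredProj t.2 t.1).const_mul _
  · simp [coef, ht]

theorem integral_hOne (H : SquareIntegrable P X h) (i : Fin N) :
    ∫ ω, hOne P X a h i (X i ω) ∂P = 0 := by
  have summand (t : Fin m × (Fin m ↪ Fin N)) :
      Integrable (fun ω => coef a i t * centeredProj P X h t.2 t.1 (X i ω)) P ∧
        ∫ ω, coef a i t * centeredProj P X h t.2 t.1 (X i ω) ∂P = 0 := by
    by_cases ht : t.2 t.1 = i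
    · rw [integral_const_mul, ← ht, H.integral_centeredProj, mul_zero]
      exact ⟨((H.memLp_centeredProj t.2 t.1).integrable one_le_two).const_mul _, rfl⟩
    · simp [coef, ht]
  simp only [hOne_eq_sum]
  rw [integral_finsetSum _ fun t _ => (summand t).1]
  exact Finset.sum_eq_zero fun t _ => (summand t).2

theorem memLp_inv_mul_sum_hOne (H : SquareIntegrable P X h) :
    MemLp (fun ω => (N : ℝ)⁻¹ * ∑ i, hOne P X a h i (X i ω)) 2 P :=
  (memLp_finsetSum _ fun i _ => H.memLp_hOne i).const_mul _

theorem integral_inv_mul_sum_hOne (H : SquareIntegrable P X h) :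
    ∫ ω, (N : ℝ)⁻¹ * ∑ i, hOne P X a h i (X i ω) ∂P = 0 := by
  rw [integral_const_mul, integral_finsetSum _ fun i _ => (H.memLp_hOne i).integrable one_le_two,
    Finset.sum_eq_zero fun i _ => H.integral_hOne i, mul_zero]

theorem mainVar_eq_sum (H : SquareIntegrable P X h) :
    mainVar P X a h = ((N : ℝ) ^ 2)⁻¹ * ∑ i, ∫ ω, hOne P X a h i (X i ω) ^ 2 ∂P := by
  have variance_sum := IndepFun.variance_sum (μ := P) (X := fun i ω => hOne P X a h i (X i ω))
    (s := Finset.univ) (fun i _ => H.memLp_hOne i) fun i _ j _ hij => (H.indep.indepFun hij).comp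
      (measurable_hOne H.measurable_sample H.measurable_kernel i)
      (measurable_hOne H.measurable_sample H.measurable_kernel j)
  rw [Finset.sum_fn] at variance_sum
  rw [mainVar, variance_const_mul, inv_pow, variance_sum]
  simp only [fun i => variance_of_integral_eq_zero
    (H.memLp_hOne (a := a) i).aestronglyMeasurable.aemeasurable (H.integral_hOne i)]

theorem uVar_eq_mainVar_add (H : SquareIntegrable P X h) (hN : 0 < N) :
    uVar P X a h = mainVar P X a h + ∫ ω, (∑ I : Fin m ↪ Fin N,
      (N : ℝ)⁻¹ * normFactor m N * a I * residual P X h I (fun i => X i ω)) ^ 2 ∂P := by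
  set L : Ω → ℝ := fun ω => (N : ℝ)⁻¹ * ∑ i, hOne P X a h i (X i ω) with L_def
  set Q : Ω → ℝ := fun ω => ∑ I : Fin m ↪ Fin N,
    (N : ℝ)⁻¹ * normFactor m N * a I * residual P X h I (fun i => X i ω) with Q_def
  have hL : MemLp L 2 P := H.memLp_inv_mul_sum_hOne
  have hQ : MemLp Q 2 P := memLp_finsetSum _ fun I _ => (H.memLp_residual I).const_mul _
  have orthogonal : ∫ ω, L ω * Q ω ∂P = 0 := by
    simp only [L_def, Q_def, Finset.mul_sum Finset.univ _ (N : ℝ)⁻¹]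
    rw [integral_sum_mul_sum _ _ _ _ (fun i _ => H.memLp_hOne i) fun I _ => H.memLp_residual I]
    refine Finset.sum_eq_zero fun i _ => Finset.sum_eq_zero fun I _ => ?_
    rw [H.integral_apply_mul_residual I i
      (measurable_hOne H.measurable_sample H.measurable_kernel i) (H.memLp_hOne i), mul_zero]
  have mean_Q : ∫ ω, Q ω ∂P = 0 := by
    rw [integral_finsetSum _ fun I _ =>
      ((H.memLp_residual I).integrable one_le_two).const_mul _]
    simp only [integral_const_mul, H.integral_residual, mul_zero, Finset.sum_const_zero]
  have mean_add : ∫ ω, L ω + Q ω ∂P = 0 := by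
    rw [integral_add (hL.integrable one_le_two) (hQ.integrable one_le_two),
      H.integral_inv_mul_sum_hOne, mean_Q, add_zero]
  have hLQ : MemLp (fun ω => L ω + Q ω) 2 P := hL.add hQ
  rw [uVar, funext fun ω => uStat_eq_hajek (P := P) (X := X) hN fun k => X k ω,
    variance_const_add hLQ.aestronglyMeasurable,
    variance_of_integral_eq_zero hLQ.aestronglyMeasurable.aemeasurable mean_add,
    integral_add_sq_of_integral_mul_eq_zero hL hQ orthogonal, mainVar,
    variance_of_integral_eq_zero hL.aestronglyMeasurable.aemeasurable H.integral_inv_mul_sum_hOne]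

theorem mainVar_le_uVar (H : SquareIntegrable P X h) (hN : 0 < N) :
    mainVar P X a h ≤ uVar P X a h := by
  rw [H.uVar_eq_mainVar_add hN]
  exact le_add_of_nonneg_right (integral_nonneg fun ω => sq_nonneg _)

theorem uVar_le_mainVar_add (H : SquareIntegrable P X h) (hN : 0 < N) {K : ℝ}
    (hK : ∀ I : Fin m ↪ Fin N, ∫ ω, h (fun k => X (I k) ω) ^ 2 ∂P ≤ K) :
    uVar P X a h ≤ mainVar P X a h + ((N : ℝ) ^ 2)⁻¹ * sharedWeight a 2 2 * K := by
  have pair_le (I J : Fin m ↪ Fin N) :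
      ((N : ℝ)⁻¹ * normFactor m N * a I) * ((N : ℝ)⁻¹ * normFactor m N * a J) *
        ∫ ω, residual P X h I (fun i => X i ω) * residual P X h J (fun i => X i ω) ∂P ≤
      if ![I, J] ∈ sharingTuples m N 2 2 then
        ((N : ℝ)⁻¹ * normFactor m N) ^ 2 * (|a I * a J| * K) else 0 := by
    split_ifs with hIJ
    · have moment_le := abs_integral_mul_le (H.memLp_residual I) (H.memLp_residual J)
        ((H.integral_residual_sq_le I).trans (hK I)) ((H.integral_residual_sq_le J).trans (hK J))
      rw [mul_mul_mul_comm, ← pow_two, mul_assoc]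
      refine mul_le_mul_of_nonneg_left ((le_abs_self _).trans ?_) (sq_nonneg _)
      rw [abs_mul]
      exact mul_le_mul_of_nonneg_left moment_le (abs_nonneg _)
    · rw [H.integral_residual_mul_residual hIJ, mul_zero]
  rw [H.uVar_eq_mainVar_add hN, integral_sum_sq _ _ fun I _ => H.memLp_residual I]
  refine add_le_add_right
    ((Finset.sum_le_sum fun I _ => Finset.sum_le_sum fun J _ => pair_le I J).trans_eq ?_) _
  rw [← sum_sharingTuples_two 2 fun I J =>
    ((N : ℝ)⁻¹ * normFactor m N) ^ 2 * (|a I * a J| * K), ← Finset.mul_sum, ← Finset.sum_mul,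
    sharedWeight]
  simp only [Fin.prod_univ_two]
  ring

end SquareIntegrable

end Hajek

section Uniform

theorem integral_uniformOn_univ {α : Type*} [Fintype α] [MeasurableSpace α]
    [MeasurableSingletonClass α] (f : α → ℝ) :
    ∫ x, f x ∂(uniformOn (Set.univ : Set α)) = (Fintype.card α : ℝ)⁻¹ * ∑ x, f x := by
  rw [integral_fintype Integrable.of_finite, Finset.mul_sum]
  refine Finset.sum_congr rfl fun x _ => ?_
  rw [smul_eq_mul, Measure.real, uniformOn_univ]
  simp

theorem uniformOn_univ_pi {ι α : Type*} [Fintype ι] [Finite α] [MeasurableSpace α]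
    [MeasurableSingletonClass α] :
    (uniformOn Set.univ : Measure (ι → α)) = Measure.pi fun _ => uniformOn Set.univ := by
  classical
  cases nonempty_fintype α
  refine Measure.ext_of_singleton fun f => ?_
  rw [Measure.pi_singleton, uniformOn_univ]
  simp [uniformOn_univ, ENNReal.inv_pow]

end Uniform

section Bootstrap

variable {𝓧 : Type*} {m N : ℕ}

/-- The average of `h(x_{k_1}, …, x_{k_m})` over all index tuples, repetitions allowed: the mean of
the kernel under the bootstrap distribution. -/
noncomputable def tupleAvg (h : (Fin m → 𝓧) → ℝ) (x : Fin N → 𝓧) : ℝ :=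
  ((N : ℝ) ^ m)⁻¹ * ∑ k : Fin m → Fin N, h fun l => x (k l)

/-- The average of `h(x_{k_1}, …, x_{k_m})` over all index tuples with `k_l = j`: the projection of
the kernel on its `l`-th argument under the bootstrap distribution. -/
noncomputable def projAvg (h : (Fin m → 𝓧) → ℝ) (x : Fin N → 𝓧) (l : Fin m) (j : Fin N) : ℝ :=
  ((N : ℝ) ^ m)⁻¹ * ∑ k : Fin m → Fin N, h fun l' => x (Function.update k l j l')

/-- The value at `x j` of the first order expansion `h_{1,i}` of the kernel under the bootstrap
distribution. -/
noncomputable def bootOne (a : (Fin m → Fin N) → ℝ) (h : (Fin m → 𝓧) → ℝ) (x : Fin N → 𝓧)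
    (i j : Fin N) : ℝ :=
  ∑ t : Fin m × (Fin m ↪ Fin N), coef a i t * (projAvg h x t.1 j - tupleAvg h x)

/-- The resampled indices `J 0, …, J (N - 1)` under the bootstrap distribution. -/
def resampledIndex (i : Fin N) (J : Fin N → Fin N) : Fin N := J i

theorem measurable_resampledIndex (i : Fin N) : Measurable (resampledIndex i) :=
  measurable_pi_apply i

theorem iIndepFun_resampledIndex [NeZero N] :
    iIndepFun resampledIndex (uniformOn (Set.univ : Set (Fin N → Fin N))) := by
  rw [uniformOn_univ_pi]
  exact iIndepFun_pi (X := fun _ => id) fun _ => aemeasurable_id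

theorem map_resampledIndex [NeZero N] (i : Fin N) :
    (uniformOn Set.univ).map (resampledIndex i) = uniformOn (Set.univ : Set (Fin N)) := by
  rw [uniformOn_univ_pi]
  exact (measurePreserving_eval _ i).map_eq

theorem squareIntegrable_resampledIndex [NeZero N] (h : (Fin m → Fin N) → ℝ) :
    SquareIntegrable (uniformOn Set.univ) resampledIndex h where
  measurable_sample := measurable_resampledIndex
  indep := iIndepFun_resampledIndex
  measurable_kernel := measurable_of_finite h
  memLp _ := MemLp.of_discrete

theorem integral_pi_map_resampledIndex [NeZero N] (I : Fin m → Fin N) (f : (Fin m → Fin N) → ℝ) :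
    ∫ k, f k ∂(Measure.pi fun l => (uniformOn Set.univ).map (resampledIndex (I l))) =
      ((N : ℝ) ^ m)⁻¹ * ∑ k, f k := by
  simp only [map_resampledIndex]
  rw [← uniformOn_univ_pi, integral_uniformOn_univ]
  simp

theorem integral_resampledIndex [NeZero N] (I : Fin m ↪ Fin N) (f : (Fin m → Fin N) → ℝ) :
    ∫ J, f (fun l => resampledIndex (I l) J) ∂(uniformOn Set.univ) =
      ((N : ℝ) ^ m)⁻¹ * ∑ k, f k := by
  rw [← integral_tuple measurable_resampledIndex iIndepFun_resampledIndex (measurable_of_finite f),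
    integral_pi_map_resampledIndex]

theorem hOne_resampledIndex [NeZero N] (a : (Fin m → Fin N) → ℝ) (h : (Fin m → 𝓧) → ℝ)
    (x : Fin N → 𝓧) (i j : Fin N) :
    hOne (uniformOn Set.univ) resampledIndex a (fun k => h fun l => x (k l)) i j =
      bootOne a h x i j := by
  simp only [hOne_eq_sum, centeredProj, proj, theta]
  refine Finset.sum_congr rfl fun t _ => ?_
  rw [integral_pi_map_resampledIndex, integral_resampledIndex t.2 fun k => h fun l => x (k l)]
  rfl

theorem mainVar_resampledIndex [NeZero N] (a : (Fin m → Fin N) → ℝ) (h : (Fin m → 𝓧) → ℝ)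
    (x : Fin N → 𝓧) :
    mainVar (uniformOn Set.univ) resampledIndex a (fun k => h fun l => x (k l)) =
      ((N : ℝ) ^ 3)⁻¹ * ∑ i, ∑ j, bootOne a h x i j ^ 2 := by
  have second_moment (i : Fin N) :
      ∫ J, bootOne a h x i (resampledIndex i J) ^ 2 ∂(uniformOn Set.univ) =
        (N : ℝ)⁻¹ * ∑ j, bootOne a h x i j ^ 2 := by
    rw [← integral_map (f := fun j => bootOne a h x i j ^ 2)
      (measurable_resampledIndex i).aemeasurable (measurable_of_finite _).aestronglyMeasurable,
      map_resampledIndex, integral_uniformOn_univ, Fintype.card_fin]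
  rw [(squareIntegrable_resampledIndex _).mainVar_eq_sum]
  simp only [hOne_resampledIndex, second_moment]
  rw [← Finset.mul_sum, pow_succ (N : ℝ) 2, mul_inv, mul_assoc]

theorem bootVar_eq_uVar (a : (Fin m → Fin N) → ℝ) (h : (Fin m → 𝓧) → ℝ) (x : Fin N → 𝓧) :
    bootVar a h x =
      uVar (uniformOn Set.univ) resampledIndex a (fun k => h fun l => x (k l)) := rfl

theorem inv_mul_sum_bootOne_sq_le_bootVar (hN : 0 < N) (a : (Fin m → Fin N) → ℝ)
    (h : (Fin m → 𝓧) → ℝ) (x : Fin N → 𝓧) :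
    ((N : ℝ) ^ 3)⁻¹ * ∑ i, ∑ j, bootOne a h x i j ^ 2 ≤ bootVar a h x := by
  have : NeZero N := ⟨hN.ne'⟩
  rw [← mainVar_resampledIndex, bootVar_eq_uVar]
  exact (squareIntegrable_resampledIndex _).mainVar_le_uVar hN

theorem bootVar_le_inv_mul_sum_bootOne_sq_add (hN : 0 < N) (a : (Fin m → Fin N) → ℝ)
    (h : (Fin m → 𝓧) → ℝ) (x : Fin N → 𝓧) :
    bootVar a h x ≤ ((N : ℝ) ^ 3)⁻¹ * ∑ i, ∑ j, bootOne a h x i j ^ 2 +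
      ((N : ℝ) ^ 2)⁻¹ * sharedWeight a 2 2 * tupleAvg (fun y => h y ^ 2) x := by
  have : NeZero N := ⟨hN.ne'⟩
  rw [← mainVar_resampledIndex, bootVar_eq_uVar]
  exact (squareIntegrable_resampledIndex _).uVar_le_mainVar_add hN fun I =>
    (integral_resampledIndex I fun k => h (fun l => x (k l)) ^ 2).le

end Bootstrap

section Counting

variable {m N : ℕ}

theorem card_le_pow_of_determined {K : ℕ} (T : Finset (Fin K → (Fin m ↪ Fin N)))
    (B : Finset (Fin K × Fin m))
    (hT : ∀ I ∈ T, ∀ J ∈ T, (∀ t ∉ B, I t.1 t.2 = J t.1 t.2) → I = J) :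
    T.card ≤ N ^ (K * m - B.card) := by
  have card_le : T.card ≤ Fintype.card ({t // t ∉ B} → Fin N) :=
    Finset.card_le_card_of_injOn (fun I t => I t.1.1 t.1.2) (fun _ _ => Finset.mem_univ _)
      fun I hI J hJ hIJ => hT I hI J hJ fun t ht => congrFun hIJ ⟨t, ht⟩
  simpa [Fintype.card_subtype_compl] using card_le

theorem card_sharingTuples_one_le {K : ℕ} :
    (sharingTuples m N (K + 1) 1).card ≤ m ^ (K + 1) * N ^ ((K + 1) * m - K) := by
  classical
  have subset_biUnion : sharingTuples m N (K + 1) 1 ⊆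
      Finset.univ.biUnion fun p : Fin (K + 1) → Fin m =>
        Finset.univ.filter fun I : Fin (K + 1) → (Fin m ↪ Fin N) =>
          ∀ k, I k (p k) = I 0 (p 0) := by
    intro I hI
    obtain ⟨x, hx⟩ := Finset.card_pos.1 (Finset.mem_filter.1 hI).2
    choose p hp using (Finset.mem_filter.1 hx).2
    simp only [Finset.mem_biUnion, Finset.mem_univ, true_and, Finset.mem_filter]
    exact ⟨p, fun k => by rw [hp, hp]⟩
  refine (Finset.card_le_card subset_biUnion).trans (Finset.card_biUnion_le.trans ?_)
  refine (Finset.sum_le_card_nsmul _ _ (N ^ ((K + 1) * m - K)) fun p _ => ?_).trans_eq (by simp)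
  have card_determined :
      ((Finset.univ.erase (0 : Fin (K + 1))).image fun k => (k, p k)).card = K := by
    rw [Finset.card_image_of_injective _ fun k k' h => (Prod.mk.inj h).1]
    simp
  refine (card_le_pow_of_determined _ _ fun I hI J hJ hIJ => ?_).trans_eq (by rw [card_determined])
  have hI' := (Finset.mem_filter.1 hI).2
  have hJ' := (Finset.mem_filter.1 hJ).2
  have zeroth_eq (l : Fin m) : I 0 l = J 0 l := hIJ (0, l) (by simp)
  ext k l : 2
  by_cases hk : k = 0
  · rw [hk, zeroth_eq]
  by_cases hl : l = p k
  · rw [hl, hI', hJ', zeroth_eq]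
  · exact hIJ (k, l) (by simp [Ne.symm hl])

theorem card_filter_two_coincidences_le {p p' q q' : Fin m} (hqq' : q ≠ q') :
    (Finset.univ.filter fun I : Fin 2 → (Fin m ↪ Fin N) =>
      I 0 p = I 1 q ∧ I 0 p' = I 1 q').card ≤ N ^ (2 * m - 2) := by
  have card_determined : ({((1 : Fin 2), q), (1, q')} : Finset (Fin 2 × Fin m)).card = 2 :=
    Finset.card_pair fun h => hqq' (Prod.mk.inj h).2
  refine (card_le_pow_of_determined _ _ fun I hI J hJ hIJ => ?_).trans_eq (by rw [card_determined])
  have hI' := (Finset.mem_filter.1 hI).2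
  have hJ' := (Finset.mem_filter.1 hJ).2
  have zeroth_eq (l : Fin m) : I 0 l = J 0 l := hIJ (0, l) (by simp)
  ext k l : 2
  fin_cases k
  · exact zeroth_eq l
  · rcases eq_or_ne l q with rfl | hq
    · exact hI'.1.symm.trans ((zeroth_eq _).trans hJ'.1)
    rcases eq_or_ne l q' with rfl | hq'
    · exact hI'.2.symm.trans ((zeroth_eq _).trans hJ'.2)
    · exact hIJ (1, l) (by simp [hq, hq'])

theorem card_sharingTuples_two_le :
    (sharingTuples m N 2 2).card ≤ m ^ 4 * N ^ (2 * m - 2) := by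
  classical
  have subset_biUnion : sharingTuples m N 2 2 ⊆
      (Finset.univ.filter fun p : Fin 4 → Fin m => p 1 ≠ p 3).biUnion fun p =>
        Finset.univ.filter fun I : Fin 2 → (Fin m ↪ Fin N) =>
          I 0 (p 0) = I 1 (p 1) ∧ I 0 (p 2) = I 1 (p 3) := by
    intro I hI
    obtain ⟨x, hx, y, hy, hxy⟩ := Finset.one_lt_card.1 (Finset.mem_filter.1 hI).2
    choose p hp using (Finset.mem_filter.1 hx).2
    choose q hq using (Finset.mem_filter.1 hy).2
    simp only [Finset.mem_biUnion, Finset.mem_univ, true_and, Finset.mem_filter]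
    refine ⟨![p 0, p 1, q 0, q 1], fun h => hxy ?_, by simp [hp], by simp [hq]⟩
    rw [← hp 1, ← hq 1, show p 1 = q 1 from h]
  refine (Finset.card_le_card subset_biUnion).trans (Finset.card_biUnion_le.trans ?_)
  calc _ ≤ _ := Finset.sum_le_card_nsmul _ _ (N ^ (2 * m - 2)) fun p hp =>
        card_filter_two_coincidences_le (Finset.mem_filter.1 hp).2
    _ ≤ m ^ 4 * N ^ (2 * m - 2) := by
        rw [smul_eq_mul]
        exact Nat.mul_le_mul_right _ ((Finset.card_filter_le _ _).trans_eq (by simp))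

end Counting

section WeightBounds

variable {m N : ℕ}

theorem normFactor_mul_pow_le (hm : 1 ≤ m) (hN : 2 * m ≤ N) :
    normFactor m N * (N : ℝ) ^ (m - 1) ≤ 2 ^ (m - 1) := by
  have factorial_eq : ((N - m)! : ℝ) * ((N - 1).descFactorial (m - 1) : ℝ) = ((N - 1)! : ℝ) := by
    have := Nat.factorial_mul_descFactorial (n := N - 1) (k := m - 1) (by omega)
    rw [show N - 1 - (m - 1) = N - m by omega] at this
    exact_mod_cast this
  have pow_le : (N : ℝ) ^ (m - 1) ≤ 2 ^ (m - 1) * ((N - 1).descFactorial (m - 1) : ℝ) := by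
    have : N ^ (m - 1) ≤ 2 ^ (m - 1) * (N - 1).descFactorial (m - 1) :=
      calc N ^ (m - 1) ≤ (2 * (N - 1 + 1 - (m - 1))) ^ (m - 1) :=
            Nat.pow_le_pow_left (by omega) _
        _ = 2 ^ (m - 1) * (N - 1 + 1 - (m - 1)) ^ (m - 1) := Nat.mul_pow _ _ _
        _ ≤ _ := Nat.mul_le_mul_left _ (Nat.pow_sub_le_descFactorial _ _)
    exact_mod_cast this
  rw [normFactor, div_mul_eq_mul_div, div_le_iff₀ (by positivity), ← factorial_eq,
    mul_left_comm (2 ^ (m - 1))]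
  exact mul_le_mul_of_nonneg_left pow_le (by positivity)

theorem avgWeight_nonneg (a : (Fin m → Fin N) → ℝ) (K q : ℕ) : 0 ≤ avgWeight a K q :=
  mul_nonneg (by positivity) (Finset.sum_nonneg fun _ _ => abs_nonneg _)

theorem sum_sharingTuples_le (a : (Fin m → Fin N) → ℝ) {K q : ℕ} {c : ℝ}
    (hc : ((sharingTuples m N K q).card : ℝ) ≤ c) :
    ∑ I ∈ sharingTuples m N K q, |∏ k, a (I k)| ≤ c * avgWeight a K q := by
  refine le_trans (le_of_eq ?_) (mul_le_mul_of_nonneg_right hc (avgWeight_nonneg _ _ _))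
  rcases (sharingTuples m N K q).eq_empty_or_nonempty with hS | hS
  · simp [hS]
  · rw [avgWeight, mul_inv_cancel_left₀ (Nat.cast_ne_zero.2 hS.card_ne_zero)]

theorem sharedWeight_two_le_one (a : (Fin m → Fin N) → ℝ) (K : ℕ) :
    sharedWeight a K 2 ≤ sharedWeight a K 1 := by
  refine mul_le_mul_of_nonneg_left ?_ (pow_nonneg (normFactor_nonneg _ _) _)
  refine Finset.sum_le_sum_of_subset_of_nonneg (fun I hI => ?_) fun _ _ _ => abs_nonneg _
  exact Finset.mem_filter.2 ⟨Finset.mem_univ _, one_le_two.trans (Finset.mem_filter.1 hI).2⟩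

theorem sharedWeight_one_le (hm : 1 ≤ m) (hN : 2 * m ≤ N) (a : (Fin m → Fin N) → ℝ) (K : ℕ) :
    sharedWeight a (K + 1) 1 ≤ (2 ^ (m - 1) * m) ^ (K + 1) * N * avgWeight a (K + 1) 1 := by
  have exponent_eq : (K + 1) * m - K = (m - 1) * (K + 1) + 1 := by
    obtain ⟨m, rfl⟩ : ∃ k, m = k + 1 := ⟨m - 1, by omega⟩
    rw [Nat.add_sub_cancel]
    have : (K + 1) * (m + 1) = m * (K + 1) + 1 + K := by ring
    omega
  have hc : ((sharingTuples m N (K + 1) 1).card : ℝ) ≤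
      (m : ℝ) ^ (K + 1) * (N : ℝ) ^ ((K + 1) * m - K) := by
    exact_mod_cast card_sharingTuples_one_le
  have hA := avgWeight_nonneg a (K + 1) 1
  have hF := normFactor_nonneg m N
  calc sharedWeight a (K + 1) 1
      ≤ normFactor m N ^ (K + 1) *
          ((m : ℝ) ^ (K + 1) * (N : ℝ) ^ ((K + 1) * m - K) * avgWeight a (K + 1) 1) :=
        mul_le_mul_of_nonneg_left (sum_sharingTuples_le a hc) (by positivity)
    _ = (normFactor m N * (N : ℝ) ^ (m - 1)) ^ (K + 1) * m ^ (K + 1) * N *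
          avgWeight a (K + 1) 1 := by
        rw [exponent_eq, pow_succ (N : ℝ), pow_mul]; ring
    _ ≤ (2 ^ (m - 1)) ^ (K + 1) * m ^ (K + 1) * N * avgWeight a (K + 1) 1 := by
        gcongr; exact normFactor_mul_pow_le hm hN
    _ = _ := by ring

theorem sharedWeight_two_le (hm : 1 ≤ m) (hN : 2 * m ≤ N) (a : (Fin m → Fin N) → ℝ) :
    sharedWeight a 2 2 ≤ (2 ^ (m - 1)) ^ 2 * m ^ 4 * avgWeight a 2 2 := by
  have hc : ((sharingTuples m N 2 2).card : ℝ) ≤ (m : ℝ) ^ 4 * (N : ℝ) ^ (2 * m - 2) := by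
    exact_mod_cast card_sharingTuples_two_le
  have hA := avgWeight_nonneg a 2 2
  have hF := normFactor_nonneg m N
  calc sharedWeight a 2 2
      ≤ normFactor m N ^ 2 * ((m : ℝ) ^ 4 * (N : ℝ) ^ (2 * m - 2) * avgWeight a 2 2) :=
        mul_le_mul_of_nonneg_left (sum_sharingTuples_le a hc) (by positivity)
    _ = (normFactor m N * (N : ℝ) ^ (m - 1)) ^ 2 * m ^ 4 * avgWeight a 2 2 := by
        rw [show 2 * m - 2 = (m - 1) * 2 by omega, pow_mul]; ring
    _ ≤ _ := by gcongr; exact normFactor_mul_pow_le hm hN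

/-- The total absolute weight in `h_{1,i}`. -/
noncomputable def totalWeight (a : (Fin m → Fin N) → ℝ) (i : Fin N) : ℝ := ∑ t, |coef a i t|

theorem totalWeight_nonneg (a : (Fin m → Fin N) → ℝ) (i : Fin N) : 0 ≤ totalWeight a i :=
  Finset.sum_nonneg fun _ _ => abs_nonneg _

theorem sum_prod_abs_coef_le (a : (Fin m → Fin N) → ℝ) {K : ℕ} (l : Fin (K + 1) → Fin m)
    (I : Fin (K + 1) → (Fin m ↪ Fin N)) :
    ∑ i, ∏ k, |coef a i (l k, I k)| ≤
      if I ∈ sharingTuples m N (K + 1) 1 then normFactor m N ^ (K + 1) * |∏ k, a (I k)| else 0 := by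
  rw [Finset.sum_eq_single_of_mem (I 0 (l 0)) (Finset.mem_univ _) fun i _ hi =>
    Finset.prod_eq_zero (Finset.mem_univ 0) (by simp [coef, hi.symm])]
  by_cases hall : ∀ k, I k (l k) = I 0 (l 0)
  · have shared : I ∈ sharingTuples m N (K + 1) 1 :=
      Finset.mem_filter.2 ⟨Finset.mem_univ _, Finset.card_pos.2 ⟨I 0 (l 0),
        Finset.mem_filter.2 ⟨Finset.mem_univ _, fun k => ⟨l k, hall k⟩⟩⟩⟩
    rw [if_pos shared]
    simp [coef, hall, abs_mul, Finset.prod_mul_distrib, Finset.abs_prod,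
      abs_of_nonneg (normFactor_nonneg m N)]
  · push Not at hall
    obtain ⟨k, hk⟩ := hall
    rw [Finset.prod_eq_zero (Finset.mem_univ k) (by simp [coef, hk])]
    split_ifs
    · exact mul_nonneg (pow_nonneg (normFactor_nonneg _ _) _) (abs_nonneg _)
    · exact le_rfl

theorem sum_totalWeight_pow_le (a : (Fin m → Fin N) → ℝ) (K : ℕ) :
    ∑ i, totalWeight a i ^ (K + 1) ≤ (m : ℝ) ^ (K + 1) * sharedWeight a (K + 1) 1 := by
  simp only [totalWeight, Fintype.sum_pow]
  rw [Finset.sum_comm, ← (Equiv.arrowProdEquivProdArrow (Fin (K + 1)) (fun _ => Fin m)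
    fun _ => Fin m ↪ Fin N).symm.sum_comp, Fintype.sum_prod_type]
  calc _ ≤ ∑ _ : Fin (K + 1) → Fin m, ∑ I, if I ∈ sharingTuples m N (K + 1) 1 then
          normFactor m N ^ (K + 1) * |∏ k, a (I k)| else 0 :=
        Finset.sum_le_sum fun l _ => Finset.sum_le_sum fun I _ => sum_prod_abs_coef_le a l I
    _ = _ := by
        rw [Finset.sum_const, ← Finset.sum_filter, ← Finset.mul_sum, sharedWeight]
        simp

end WeightBounds

section Generic

variable {m N : ℕ} {ι : Type*} [Fintype ι]

theorem card_mul_le_of_determined (T : Finset (ι → Fin N)) (p : ι)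
    (hT : ∀ κ ∈ T, ∀ κ' ∈ T, (∀ i ≠ p, κ i = κ' i) → κ = κ') :
    T.card * N ≤ N ^ Fintype.card ι := by
  classical
  have update_injOn : Set.InjOn (fun t : (ι → Fin N) × Fin N => Function.update t.1 p t.2)
      ↑(T ×ˢ (Finset.univ : Finset (Fin N))) := by
    rintro ⟨κ, y⟩ hκ ⟨κ', y'⟩ hκ' h
    rw [Finset.mem_coe, Finset.mem_product] at hκ hκ'
    have hy : y = y' := by simpa using congrFun h p
    have agree : ∀ i ≠ p, κ i = κ' i := fun i hi => by simpa [hi] using congrFun h i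
    rw [hT κ hκ.1 κ' hκ'.1 agree, hy]
  simpa using Finset.card_le_card_of_injOn _ (fun _ _ => Finset.mem_univ _) update_injOn

variable [DecidableEq ι]

theorem card_filter_apply_eq_apply_mul_le {p q : ι} (hpq : p ≠ q) :
    (Finset.univ.filter fun κ : ι → Fin N => κ p = κ q).card * N ≤ N ^ Fintype.card ι := by
  refine card_mul_le_of_determined _ q fun κ hκ κ' hκ' h => funext fun i => ?_
  by_cases hi : i = q
  · rw [hi, ← (Finset.mem_filter.1 hκ).2, ← (Finset.mem_filter.1 hκ').2, h p hpq]
  · exact h i hi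

theorem card_filter_apply_eq_mul_le (p : ι) (x : Fin N) :
    (Finset.univ.filter fun κ : ι → Fin N => κ p = x).card * N ≤ N ^ Fintype.card ι := by
  refine card_mul_le_of_determined _ p fun κ hκ κ' hκ' h => funext fun i => ?_
  by_cases hi : i = p
  · rw [hi, (Finset.mem_filter.1 hκ).2, (Finset.mem_filter.1 hκ').2]
  · exact h i hi

/-- The index tuples that have a repetition or meet `F`. -/
def exceptionalTuples (ι : Type*) [Fintype ι] [DecidableEq ι] (F : Finset (Fin N)) :
    Finset (ι → Fin N) :=
  ((Finset.univ.filter fun p : ι × ι => p.1 ≠ p.2).biUnion fun p =>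
      Finset.univ.filter fun κ => κ p.1 = κ p.2) ∪
    (Finset.univ ×ˢ F).biUnion fun p => Finset.univ.filter fun κ => κ p.1 = p.2

theorem injective_and_notMem_of_notMem_exceptionalTuples {F : Finset (Fin N)} {κ : ι → Fin N}
    (hκ : κ ∉ exceptionalTuples ι F) : Function.Injective κ ∧ ∀ i, κ i ∉ F := by
  simp only [exceptionalTuples, Finset.mem_union, Finset.mem_biUnion, Finset.mem_filter,
    Finset.mem_univ, true_and, Finset.mem_product, Prod.exists, not_or, not_exists, not_and] at hκ
  exact ⟨fun i j hij => by_contra fun hne => hκ.1 i j hne hij, fun i hi => hκ.2 i (κ i) hi rfl⟩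

theorem card_exceptionalTuples_mul_le (F : Finset (Fin N)) :
    (exceptionalTuples ι F).card * N ≤
      (Fintype.card ι ^ 2 + Fintype.card ι * F.card) * N ^ Fintype.card ι := by
  refine (Nat.mul_le_mul_right _ <| (Finset.card_union_le _ _).trans <|
    add_le_add Finset.card_biUnion_le Finset.card_biUnion_le).trans ?_
  rw [add_mul, add_mul, Finset.sum_mul, Finset.sum_mul]
  refine add_le_add ((Finset.sum_le_card_nsmul _ _ _ fun p hp =>
      card_filter_apply_eq_apply_mul_le (Finset.mem_filter.1 hp).2).trans ?_)
    ((Finset.sum_le_card_nsmul _ _ _ fun p _ => card_filter_apply_eq_mul_le p.1 p.2).trans_eq ?_)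
  · rw [smul_eq_mul]
    exact Nat.mul_le_mul_right _ ((Finset.card_filter_le _ _).trans_eq (by simp [pow_two]))
  · rw [smul_eq_mul, Finset.card_product, Finset.card_univ]

theorem average_le_of_generic (hN : 0 < N) (F : Finset (Fin N)) (f : (ι → Fin N) → ℝ) {u v : ℝ}
    (hu0 : 0 ≤ u) (hv0 : 0 ≤ v)
    (hu : ∀ κ, Function.Injective κ → (∀ i, κ i ∉ F) → f κ ≤ u) (hv : ∀ κ, f κ ≤ v) :
    ((N : ℝ) ^ Fintype.card ι)⁻¹ * ∑ κ, f κ ≤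
      u + v * ((Fintype.card ι : ℝ) ^ 2 + Fintype.card ι * F.card) / N := by
  have hN' : (0 : ℝ) < N := by exact_mod_cast hN
  have card_le : ((exceptionalTuples ι F).card : ℝ) * N ≤
      ((Fintype.card ι : ℝ) ^ 2 + Fintype.card ι * F.card) * (N : ℝ) ^ Fintype.card ι := by
    exact_mod_cast card_exceptionalTuples_mul_le F
  have apply_le (κ : ι → Fin N) : f κ ≤ u + if κ ∈ exceptionalTuples ι F then v else 0 := by
    split_ifs with h
    · exact (hv κ).trans (le_add_of_nonneg_left hu0)
    · have generic := injective_and_notMem_of_notMem_exceptionalTuples h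
      exact (hu κ generic.1 generic.2).trans_eq (add_zero u).symm
  have sum_le : ∑ κ, f κ ≤ (N : ℝ) ^ Fintype.card ι * u + (exceptionalTuples ι F).card * v := by
    refine (Finset.sum_le_sum fun κ _ => apply_le κ).trans_eq ?_
    rw [Finset.sum_add_distrib, Finset.sum_ite_mem]
    simp
  rw [inv_mul_le_iff₀ (by positivity), mul_add]
  refine sum_le.trans (add_le_add_right ?_ _)
  rw [mul_div_assoc', le_div_iff₀ hN']
  linarith [mul_le_mul_of_nonneg_left card_le hv0]

theorem average_pair_le_of_generic (hN : 0 < N) (F : Finset (Fin N))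
    (f : (Fin m → Fin N) → (Fin m → Fin N) → ℝ) {u v : ℝ} (hu0 : 0 ≤ u) (hv0 : 0 ≤ v)
    (hu : ∀ k k', Function.Injective (Sum.elim k k') → (∀ l, k l ∉ F) → (∀ l, k' l ∉ F) →
      f k k' ≤ u) (hv : ∀ k k', f k k' ≤ v) :
    ((N : ℝ) ^ m)⁻¹ * ((N : ℝ) ^ m)⁻¹ * ∑ k, ∑ k', f k k' ≤
      u + v * (4 * (m : ℝ) ^ 2 + 2 * m * F.card) / N := by
  have average_le := average_le_of_generic (ι := Fin m ⊕ Fin m) hN F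
    (fun κ => f (κ ∘ Sum.inl) (κ ∘ Sum.inr)) hu0 hv0
    (fun κ hκ hF => hu _ _ (by simpa using hκ) (fun _ => hF _) (fun _ => hF _))
    (fun _ => hv _ _)
  rw [← (Equiv.sumArrowEquivProdArrow (Fin m) (Fin m) (Fin N)).symm.sum_comp,
    Fintype.sum_prod_type, Fintype.card_sum, Fintype.card_fin, pow_add, mul_inv] at average_le
  refine average_le.trans_eq ?_
  push_cast
  ring

theorem average_sub (hN : 0 < N) (f : (Fin m → Fin N) → ℝ) (c : ℝ) :
    ((N : ℝ) ^ m)⁻¹ * ∑ k, f k - c = ((N : ℝ) ^ m)⁻¹ * ∑ k, (f k - c) := by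
  rw [Finset.sum_sub_distrib, mul_sub, sub_right_inj]
  simp only [Finset.sum_const, Finset.card_univ, Fintype.card_fun, Fintype.card_fin, nsmul_eq_mul,
    Nat.cast_pow]
  field_simp

end Generic

section GenericCovariance

variable {m N : ℕ} {Ω : Type*} [MeasurableSpace Ω] {P : Measure Ω}

theorem abs_integral_average_mul_average_le (hN : 0 < N) (F : Finset (Fin N))
    {f g : (Fin m → Fin N) → Ω → ℝ} {u v : ℝ} (hu0 : 0 ≤ u) (hv0 : 0 ≤ v)
    (hf : ∀ k, MemLp (f k) 2 P) (hg : ∀ k, MemLp (g k) 2 P)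
    (hu : ∀ k k', Function.Injective (Sum.elim k k') → (∀ l, k l ∉ F) → (∀ l, k' l ∉ F) →
      |∫ ω, f k ω * g k' ω ∂P| ≤ u)
    (hfv : ∀ k, ∫ ω, f k ω ^ 2 ∂P ≤ v) (hgv : ∀ k, ∫ ω, g k ω ^ 2 ∂P ≤ v) :
    |∫ ω, (((N : ℝ) ^ m)⁻¹ * ∑ k, f k ω) * (((N : ℝ) ^ m)⁻¹ * ∑ k, g k ω) ∂P| ≤
      u + v * (4 * (m : ℝ) ^ 2 + 2 * m * F.card) / N := by
  have hexpand : ∫ ω, (((N : ℝ) ^ m)⁻¹ * ∑ k, f k ω) * (((N : ℝ) ^ m)⁻¹ * ∑ k, g k ω) ∂P =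
      ((N : ℝ) ^ m)⁻¹ * ((N : ℝ) ^ m)⁻¹ * ∑ k, ∑ k', ∫ ω, f k ω * g k' ω ∂P := by
    simpa only [← Finset.mul_sum] using integral_sum_mul_sum .univ .univ
      (fun _ => ((N : ℝ) ^ m)⁻¹) (fun _ => ((N : ℝ) ^ m)⁻¹) (fun k _ => hf k) fun k _ => hg k
  rw [hexpand, abs_mul, abs_of_nonneg (by positivity)]
  calc ((N : ℝ) ^ m)⁻¹ * ((N : ℝ) ^ m)⁻¹ * |∑ k, ∑ k', ∫ ω, f k ω * g k' ω ∂P|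
      ≤ ((N : ℝ) ^ m)⁻¹ * ((N : ℝ) ^ m)⁻¹ * ∑ k, ∑ k', |∫ ω, f k ω * g k' ω ∂P| := by
        gcongr
        exact (Finset.abs_sum_le_sum_abs _ _).trans
          (Finset.sum_le_sum fun k _ => Finset.abs_sum_le_sum_abs _ _)
    _ ≤ u + v * (4 * (m : ℝ) ^ 2 + 2 * m * F.card) / N :=
        average_pair_le_of_generic hN F _ hu0 hv0 hu fun k k' =>
          abs_integral_mul_le (hf k) (hg k') (hfv k) (hgv k')

end GenericCovariance

section SecondMomentBounds

variable {Ω : Type*} [MeasurableSpace Ω] {P : Measure Ω} {f g : Ω → ℝ} {K L : ℝ}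

theorem integral_sq_le_of_integral_pow_four_le [IsProbabilityMeasure P] (hK : 0 ≤ K)
    (hf : AEStronglyMeasurable f P) (hint : Integrable (fun ω => f ω ^ 4) P)
    (hfK : ∫ ω, f ω ^ 4 ∂P ≤ K ^ 2) : ∫ ω, f ω ^ 2 ∂P ≤ K := by
  have hpow : (fun ω => (f ω ^ 2) ^ 2) = fun ω => f ω ^ 4 := by ext ω; ring
  have hsq := even_pow_integral_le (μ := P) even_two two_ne_zero (hf.pow 2) (hpow ▸ hint)
  exact (abs_le_of_sq_le_sq' (hsq.trans (hpow ▸ hfK)) hK).2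

theorem integral_add_sq_le (hf : MemLp f 2 P) (hg : MemLp g 2 P)
    (hfK : ∫ ω, f ω ^ 2 ∂P ≤ K) (hgL : ∫ ω, g ω ^ 2 ∂P ≤ L) :
    ∫ ω, (f ω + g ω) ^ 2 ∂P ≤ 2 * K + 2 * L := by
  calc ∫ ω, (f ω + g ω) ^ 2 ∂P ≤ ∫ ω, (2 * f ω ^ 2 + 2 * g ω ^ 2) ∂P :=
        integral_mono (hf.add hg).integrable_sq
          ((hf.integrable_sq.const_mul 2).add (hg.integrable_sq.const_mul 2))
          fun ω => by nlinarith [sq_nonneg (f ω - g ω)]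
    _ = 2 * ∫ ω, f ω ^ 2 ∂P + 2 * ∫ ω, g ω ^ 2 ∂P := by
        rw [integral_add (hf.integrable_sq.const_mul 2) (hg.integrable_sq.const_mul 2),
          integral_const_mul, integral_const_mul]
    _ ≤ 2 * K + 2 * L := by gcongr

theorem integral_sub_sq_le (hf : MemLp f 2 P) (hg : MemLp g 2 P)
    (hfK : ∫ ω, f ω ^ 2 ∂P ≤ K) (hgL : ∫ ω, g ω ^ 2 ∂P ≤ L) :
    ∫ ω, (f ω - g ω) ^ 2 ∂P ≤ 2 * K + 2 * L := by
  simpa only [sub_eq_add_neg, Pi.neg_apply] using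
    integral_add_sq_le hf hg.neg hfK (by simpa using hgL)

end SecondMomentBounds

section MeanGap

variable {𝓧 : Type*} {m N : ℕ} {Ω : Type*} [MeasurableSpace Ω] {P : Measure Ω}
  {X : Fin N → Ω → 𝓧} {h : (Fin m → 𝓧) → ℝ}

theorem meanGap_nonneg : 0 ≤ meanGap P X h := Real.iSup_nonneg fun _ => abs_nonneg _

theorem abs_theta_sub_theta_le_meanGap (I J : Fin m ↪ Fin N) :
    |theta P X h I - theta P X h J| ≤ meanGap P X h :=
  le_ciSup (f := fun t : (Fin m ↪ Fin N) × (Fin m ↪ Fin N) =>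
    |theta P X h t.1 - theta P X h t.2|) (Set.finite_range _).bddAbove (I, J)

end MeanGap

section SampleBounds

variable {𝓧 : Type*} [MeasurableSpace 𝓧] {m N : ℕ} {Ω : Type*} [MeasurableSpace Ω]

/-- A sample of independent variables, together with a kernel whose fourth moments at distinct
indices are at most `B ^ 2`, and whose second moments are at most `C` also when indices repeat. As
in the conditions on the bootstrap, a repeated index stands both for one and the same variable and
for independent copies of it. -/
structure SampleBounds (P : Measure Ω) (X : Fin N → Ω → 𝓧) (h : (Fin m → 𝓧) → ℝ) (B C : ℝ) :
    Prop where
  measurable_sample : ∀ i, Measurable (X i)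
  indep : iIndepFun X P
  measurable_kernel : Measurable h
  fourth_nonneg : 0 ≤ B
  second_nonneg : 0 ≤ C
  integrable_pow_four : ∀ I : Fin m ↪ Fin N, Integrable (fun ω => h (fun l => X (I l) ω) ^ 4) P
  integral_pow_four_le : ∀ I : Fin m ↪ Fin N, ∫ ω, h (fun l => X (I l) ω) ^ 4 ∂P ≤ B ^ 2
  integrable_sq : ∀ k : Fin m → Fin N, Integrable (fun ω => h (fun l => X (k l) ω) ^ 2) P
  integral_sq_le : ∀ k : Fin m → Fin N, ∫ ω, h (fun l => X (k l) ω) ^ 2 ∂P ≤ C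
  integrable_sq_pi : ∀ k : Fin m → Fin N,
    Integrable (fun y => h y ^ 2) (Measure.pi fun l => P.map (X (k l)))
  integral_sq_pi_le : ∀ k : Fin m → Fin N,
    ∫ y, h y ^ 2 ∂(Measure.pi fun l => P.map (X (k l))) ≤ C

variable {P : Measure Ω} {X : Fin N → Ω → 𝓧} {h : (Fin m → 𝓧) → ℝ} {B C : ℝ}

namespace SampleBounds

theorem memLp (H : SampleBounds P X h B C) (k : Fin m → Fin N) :
    MemLp (fun ω => h fun l => X (k l) ω) 2 P :=
  (memLp_two_iff_integrable_sq (H.measurable_kernel.comp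
    (measurable_pi_lambda _ fun l => H.measurable_sample (k l))).aestronglyMeasurable).2
    (H.integrable_sq k)

theorem squareIntegrable (H : SampleBounds P X h B C) : SquareIntegrable P X h :=
  ⟨H.measurable_sample, H.indep, H.measurable_kernel, fun I => H.memLp I⟩

theorem memLp_tupleAvg (H : SampleBounds P X h B C) :
    MemLp (fun ω => tupleAvg h fun i => X i ω) 2 P :=
  (memLp_finsetSum _ fun k _ => H.memLp k).const_mul _

variable [IsProbabilityMeasure P]

theorem integral_sq_le_of_injective (H : SampleBounds P X h B C) (I : Fin m ↪ Fin N) :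
    ∫ ω, h (fun l => X (I l) ω) ^ 2 ∂P ≤ B :=
  integral_sq_le_of_integral_pow_four_le H.fourth_nonneg (H.memLp I).aestronglyMeasurable
    (H.integrable_pow_four I) (H.integral_pow_four_le I)

theorem theta_sq_le (H : SampleBounds P X h B C) (I : Fin m ↪ Fin N) : theta P X h I ^ 2 ≤ C :=
  (even_pow_integral_le even_two two_ne_zero (H.memLp I).aestronglyMeasurable
    (H.integrable_sq I)).trans (H.integral_sq_le I)

theorem theta_pow_four_le (H : SampleBounds P X h B C) (I : Fin m ↪ Fin N) :
    theta P X h I ^ 4 ≤ B ^ 2 :=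
  (even_pow_integral_le (by decide) (by norm_num) (H.memLp I).aestronglyMeasurable
    (H.integrable_pow_four I)).trans (H.integral_pow_four_le I)

theorem measurable_proj (H : SampleBounds P X h B C) (I : Fin m ↪ Fin N) (l : Fin m)
    (j : Fin N) : Measurable fun ω => proj P X h I l (X j ω) :=
  (WeightedU.measurable_proj H.measurable_sample H.measurable_kernel I l).comp
    (H.measurable_sample j)

theorem memLp_proj (H : SampleBounds P X h B C) (I : Fin m ↪ Fin N) (l : Fin m) (j : Fin N) :
    MemLp (fun ω => proj P X h I l (X j ω)) 2 P :=
  (memLp_two_iff_integrable_sq (H.measurable_proj I l j).aestronglyMeasurable).2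
    (integrable_proj_even_pow H.measurable_sample H.measurable_kernel even_two two_ne_zero
      (H.integrable_sq_pi _))

theorem integral_proj_sq_le (H : SampleBounds P X h B C) (I : Fin m ↪ Fin N) (l : Fin m)
    (j : Fin N) : ∫ ω, proj P X h I l (X j ω) ^ 2 ∂P ≤ C :=
  (integral_proj_even_pow_le H.measurable_sample H.measurable_kernel even_two two_ne_zero
    (H.integrable_sq_pi _)).trans (H.integral_sq_pi_le _)

section ForallNe

variable {I : Fin m ↪ Fin N} {l : Fin m} {j : Fin N}

theorem integrable_pow_four_pi (H : SampleBounds P X h B C) (hj : ∀ k, k ≠ l → I k ≠ j) :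
    Integrable (fun y => h y ^ 4) (Measure.pi fun k => P.map (X (Function.update I l j k))) :=
  (integrable_tuple H.measurable_sample H.indep (H.measurable_kernel.pow_const 4)
    (replaceIndex I l j hj)).2 (H.integrable_pow_four _)

theorem integrable_proj_pow_four (H : SampleBounds P X h B C) (hj : ∀ k, k ≠ l → I k ≠ j) :
    Integrable (fun ω => proj P X h I l (X j ω) ^ 4) P :=
  integrable_proj_even_pow H.measurable_sample H.measurable_kernel (by decide) (by norm_num)
    (H.integrable_pow_four_pi hj)

theorem integral_proj_pow_four_le (H : SampleBounds P X h B C) (hj : ∀ k, k ≠ l → I k ≠ j) :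
    ∫ ω, proj P X h I l (X j ω) ^ 4 ∂P ≤ B ^ 2 :=
  calc ∫ ω, proj P X h I l (X j ω) ^ 4 ∂P
      ≤ ∫ y, h y ^ 4 ∂(Measure.pi fun k => P.map (X (Function.update I l j k))) :=
        integral_proj_even_pow_le H.measurable_sample H.measurable_kernel (by decide) (by norm_num)
          (H.integrable_pow_four_pi hj)
    _ = ∫ ω, h (fun k => X (replaceIndex I l j hj k) ω) ^ 4 ∂P :=
        integral_tuple H.measurable_sample H.indep (H.measurable_kernel.pow_const 4)
          (replaceIndex I l j hj)
    _ ≤ B ^ 2 := H.integral_pow_four_le _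

theorem integral_proj_sq_le_of_forall_ne (H : SampleBounds P X h B C)
    (hj : ∀ k, k ≠ l → I k ≠ j) : ∫ ω, proj P X h I l (X j ω) ^ 2 ∂P ≤ B :=
  integral_sq_le_of_integral_pow_four_le H.fourth_nonneg
    (H.measurable_proj I l j).aestronglyMeasurable (H.integrable_proj_pow_four hj)
    (H.integral_proj_pow_four_le hj)

end ForallNe

theorem integral_tupleAvg_sq_le (H : SampleBounds P X h B C) (hN : 0 < N) :
    ∫ ω, tupleAvg (fun y => h y ^ 2) (fun i => X i ω) ∂P ≤ B + C * (m : ℝ) ^ 2 / N := by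
  simp only [tupleAvg]
  rw [integral_const_mul, integral_finsetSum _ fun k _ => H.integrable_sq k]
  simpa using average_le_of_generic hN ∅
    (fun k : Fin m → Fin N => ∫ ω, h (fun l => X (k l) ω) ^ 2 ∂P) H.fourth_nonneg H.second_nonneg
    (fun k hk _ => H.integral_sq_le_of_injective ⟨k, hk⟩) H.integral_sq_le

theorem abs_integral_sub_theta_mul_sub_theta_le (H : SampleBounds P X h B C) (I : Fin m ↪ Fin N)
    {k k' : Fin m → Fin N} (hk : Function.Injective (Sum.elim k k')) :
    |∫ ω, (h (fun l => X (k l) ω) - theta P X h I) *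
      (h (fun l => X (k' l) ω) - theta P X h I) ∂P| ≤ meanGap P X h ^ 2 := by
  have hmem : ∀ k : Fin m → Fin N, MemLp (fun ω => h (fun l => X (k l) ω) - theta P X h I) 2 P :=
    fun k => (H.memLp k).sub (memLp_const (theta P X h I))
  have hmean : ∀ J : Fin m ↪ Fin N,
      |∫ ω, (h (fun l => X (J l) ω) - theta P X h I) ∂P| ≤ meanGap P X h := fun J => by
    rw [integral_sub ((H.memLp J).integrable one_le_two) (integrable_const _), integral_const,
      probReal_univ, one_smul]
    exact abs_theta_sub_theta_le_meanGap J I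
  have hmeas : ∀ k : Fin m → Fin N,
      Measurable fun x : Fin N → 𝓧 => h (fun l => x (k l)) - theta P X h I := fun k =>
    (H.measurable_kernel.comp (by fun_prop)).sub_const _
  have hdep : ∀ {A : Set (Fin N)} {k : Fin m → Fin N}, (∀ l, k l ∈ A) →
      DependsOn (fun x : Fin N → 𝓧 => h (fun l => x (k l)) - theta P X h I) A :=
    fun hA x y hxy => by simp only [hxy _ (hA _)]
  rw [integral_mul_of_dependsOn_compl H.measurable_sample H.indep (A := Set.range k) (hmeas k')
    (hmeas k) (hdep Set.mem_range_self)
    (hdep fun l' ⟨l, hl⟩ => Sum.inl_ne_inr (hk (a₁ := .inl l) (a₂ := .inr l') hl))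
    ((hmem k).integrable_mul (hmem k')), abs_mul, pow_two]
  exact mul_le_mul (hmean ⟨k, hk.comp Sum.inl_injective⟩) (hmean ⟨k', hk.comp Sum.inr_injective⟩)
    (abs_nonneg _) meanGap_nonneg

theorem integral_tupleAvg_sub_theta_sq_le (H : SampleBounds P X h B C) (hN : 0 < N)
    (I : Fin m ↪ Fin N) :
    ∫ ω, (tupleAvg h (fun i => X i ω) - theta P X h I) ^ 2 ∂P ≤
      meanGap P X h ^ 2 + 4 * C * (4 * (m : ℝ) ^ 2) / N := by
  have hmem : ∀ k : Fin m → Fin N, MemLp (fun ω => h (fun l => X (k l) ω) - theta P X h I) 2 P :=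
    fun k => (H.memLp k).sub (memLp_const (theta P X h I))
  have hsq : ∀ k : Fin m → Fin N,
      ∫ ω, (h (fun l => X (k l) ω) - theta P X h I) ^ 2 ∂P ≤ 4 * C := fun k =>
    (integral_sub_sq_le (H.memLp k) (memLp_const _) (H.integral_sq_le k)
      (by simpa using H.theta_sq_le I)).trans_eq (by ring)
  simp only [tupleAvg, average_sub hN, pow_two (((N : ℝ) ^ m)⁻¹ * _)]
  simpa using (le_abs_self _).trans (abs_integral_average_mul_average_le hN ∅
    (sq_nonneg (meanGap P X h)) (mul_nonneg zero_le_four H.second_nonneg) hmem hmem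
    (fun k k' hk _ _ => H.abs_integral_sub_theta_mul_sub_theta_le I hk) hsq hsq)

end SampleBounds

end SampleBounds

section MeetAt

variable {m N : ℕ} {r s : Fin m ↪ Fin N} {p q : Fin m}

/-- The index tuples `r` and `s` have exactly the index `r p = s q` in common. -/
def MeetAt (r s : Fin m ↪ Fin N) (p q : Fin m) : Prop := ∀ x y, r x = s y ↔ x = p ∧ y = q

theorem MeetAt.apply_eq (hrs : MeetAt r s p q) : r p = s q := (hrs p q).2 ⟨rfl, rfl⟩

theorem MeetAt.symm (hrs : MeetAt r s p q) : MeetAt s r q p := fun x y => by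
  rw [eq_comm, hrs, and_comm]

theorem MeetAt.commonIndices_eq (hrs : MeetAt r s p q) : commonIndices ![r, s] = {s q} := by
  ext x
  rw [mem_commonIndices_pair, Finset.mem_singleton]
  constructor
  · rintro ⟨⟨l, rfl⟩, l', hl'⟩
    rw [((hrs l l').1 hl'.symm).1, hrs.apply_eq]
  · rintro rfl
    exact ⟨⟨p, hrs.apply_eq⟩, q, rfl⟩

theorem meetAt_of_card_lt_two (hpq : r p = s q) (hcard : (commonIndices ![r, s]).card < 2) :
    MeetAt r s p q := by
  refine fun x y => ⟨fun hxy => ?_, fun ⟨hx, hy⟩ => hx ▸ hy ▸ hpq⟩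
  have hxp : r x = r p := Finset.card_le_one.1 (Nat.lt_succ_iff.1 hcard) (r x)
    (mem_commonIndices_pair.2 ⟨⟨x, rfl⟩, y, hxy.symm⟩) (r p)
    (mem_commonIndices_pair.2 ⟨⟨p, rfl⟩, q, hpq.symm⟩)
  exact ⟨r.injective hxp, s.injective (by rw [← hxy, hxp, hpq])⟩

theorem meetAt_replaceIndex {j : Fin N} (hr : ∀ x, x ≠ p → r x ≠ j) (hs : ∀ y, y ≠ q → s y ≠ j)
    (hrs : ∀ x y, x ≠ p → r x ≠ s y) :
    MeetAt (replaceIndex r p j hr) (replaceIndex s q j hs) p q := by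
  intro x y
  refine ⟨fun hxy => ?_, by rintro ⟨rfl, rfl⟩; simp only [replaceIndex_self]⟩
  by_cases hx : x = p <;> by_cases hy : y = q
  · exact ⟨hx, hy⟩
  · rw [hx, replaceIndex_self, replaceIndex_of_ne _ _ _ _ hy] at hxy
    exact absurd hxy.symm (hs y hy)
  · rw [hy, replaceIndex_self, replaceIndex_of_ne _ _ _ _ hx] at hxy
    exact absurd hxy (hr x hx)
  · rw [replaceIndex_of_ne _ _ _ _ hx, replaceIndex_of_ne _ _ _ _ hy] at hxy
    exact absurd hxy (hrs x y hx)

end MeetAt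

section CrossGap

variable {𝓧 : Type*} [MeasurableSpace 𝓧] {m N : ℕ} {Ω : Type*} [MeasurableSpace Ω]
  {P : Measure Ω} {X : Fin N → Ω → 𝓧} {h : (Fin m → 𝓧) → ℝ}

theorem crossGap_nonneg : 0 ≤ crossGap P X h := Real.iSup_nonneg fun _ => abs_nonneg _

theorem abs_integral_sub_integral_le_crossGap [IsFiniteMeasure P] (hX : ∀ i, Measurable (X i))
    {r s k : Fin m ↪ Fin N} {p q : Fin m} (hrs : MeetAt r s p q) (hks : MeetAt k s p q) :
    |∫ ω, h (fun l => X (r l) ω) * h (fun l => X (s l) ω) ∂P -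
      ∫ ω, h (fun l => X (k l) ω) * h (fun l => X (s l) ω) ∂P| ≤ crossGap P X h := by
  have hcrossMoment : ∀ r : Fin m ↪ Fin N, crossMoment P X h r s (k p) =
      ∫ ω, h (fun l => X (r l) ω) * h (fun l => X (s l) ω) ∂P :=
    fun r => integral_condExp (hX (k p)).comap_le
  rw [← hcrossMoment, ← hcrossMoment]
  exact le_ciSup (f := fun t : CrossConfig m N =>
    |crossMoment P X h t.1.2.1 t.1.2.2.1 (t.1.2.2.2 t.1.1.1) -
      crossMoment P X h t.1.2.2.2 t.1.2.2.1 (t.1.2.2.2 t.1.1.1)|) (Set.finite_range _).bddAbove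
    ⟨((p, q), (r, s, k)), hrs.commonIndices_eq, hrs.apply_eq, hks.commonIndices_eq, hks.apply_eq⟩

end CrossGap

section ProjAvg

variable {𝓧 : Type*} [MeasurableSpace 𝓧] {m N : ℕ} {Ω : Type*} [MeasurableSpace Ω]
  {P : Measure Ω} {X : Fin N → Ω → 𝓧} {h : (Fin m → 𝓧) → ℝ} {B C : ℝ}

namespace SampleBounds

theorem memLp_projAvg (H : SampleBounds P X h B C) (l : Fin m) (j : Fin N) :
    MemLp (fun ω => projAvg h (fun i => X i ω) l j) 2 P :=
  (memLp_finsetSum _ fun k _ => H.memLp (Function.update k l j)).const_mul _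

theorem integral_projAvg_sq_le_average (H : SampleBounds P X h B C) (hN : 0 < N) (l : Fin m)
    (j : Fin N) :
    ∫ ω, projAvg h (fun i => X i ω) l j ^ 2 ∂P ≤ ((N : ℝ) ^ m)⁻¹ * ∑ k : Fin m → Fin N,
      ∫ ω, h (fun l' => X (Function.update k l j l') ω) ^ 2 ∂P := by
  have hint : ∀ k ∈ Finset.univ, Integrable
      (fun ω => h (fun l' => X (Function.update k l j l') ω) ^ 2) P :=
    fun k _ => H.integrable_sq (Function.update k l j)
  rw [← integral_finsetSum _ hint, ← integral_const_mul]
  refine integral_mono (H.memLp_projAvg l j).integrable_sq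
    ((integrable_finsetSum _ hint).const_mul _) fun ω => ?_
  have cauchy_schwarz := sq_sum_le_card_mul_sum_sq (s := Finset.univ)
    (f := fun k : Fin m → Fin N => h fun l' => X (Function.update k l j l') ω)
  rw [Finset.card_univ, Fintype.card_fun, Fintype.card_fin, Fintype.card_fin, Nat.cast_pow]
    at cauchy_schwarz
  simp only [projAvg]
  rw [mul_pow, pow_two (((N : ℝ) ^ m)⁻¹), mul_assoc]
  gcongr
  rwa [inv_mul_le_iff₀ (by positivity)]

theorem integral_projAvg_sq_le (H : SampleBounds P X h B C) (hN : 0 < N) (l : Fin m)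
    (j : Fin N) : ∫ ω, projAvg h (fun i => X i ω) l j ^ 2 ∂P ≤ C := by
  refine (H.integral_projAvg_sq_le_average hN l j).trans ?_
  rw [inv_mul_le_iff₀ (by positivity)]
  exact (Finset.sum_le_card_nsmul _ _ C fun k _ => H.integral_sq_le _).trans_eq (by simp)

variable [IsProbabilityMeasure P]

theorem integral_projAvg_sq_le_add (H : SampleBounds P X h B C) (hN : 0 < N) (l : Fin m)
    (j : Fin N) :
    ∫ ω, projAvg h (fun i => X i ω) l j ^ 2 ∂P ≤ B + C * ((m : ℝ) ^ 2 + m) / N := by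
  refine (H.integral_projAvg_sq_le_average hN l j).trans ?_
  simpa using average_le_of_generic hN {j} (fun k : Fin m → Fin N =>
    ∫ ω, h (fun l' => X (Function.update k l j l') ω) ^ 2 ∂P) H.fourth_nonneg H.second_nonneg
    (fun k hk hj => H.integral_sq_le_of_injective
      (replaceIndex ⟨k, hk⟩ l j fun a _ => by simpa using hj a))
    (fun k => H.integral_sq_le _)

theorem integral_mul_proj (H : SampleBounds P X h B C) {r s : Fin m ↪ Fin N} {p q : Fin m}
    (hrs : MeetAt r s p q) :
    ∫ ω, h (fun l => X (r l) ω) * proj P X h s q (X (s q) ω) ∂P =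
      ∫ ω, h (fun l => X (r l) ω) * h (fun l => X (s l) ω) ∂P :=
  WeightedU.integral_mul_proj H.measurable_sample H.indep H.measurable_kernel
    (A := Set.range r) (g := fun x => h fun l => x (r l)) (H.measurable_kernel.comp (by fun_prop))
    (fun x y hxy => by simp only [hxy _ (Set.mem_range_self _)])
    (fun l => ⟨fun ⟨x, hx⟩ => ((hrs x l).1 hx).2, fun hl => ⟨p, hl ▸ hrs.apply_eq⟩⟩)
    ((H.memLp r).integrable_mul (H.memLp s))

theorem integral_proj_mul_proj (H : SampleBounds P X h B C) {r s : Fin m ↪ Fin N} {p q : Fin m}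
    (hrs : MeetAt r s p q) :
    ∫ ω, proj P X h r p (X (r p) ω) * proj P X h s q (X (s q) ω) ∂P =
      ∫ ω, h (fun l => X (r l) ω) * h (fun l => X (s l) ω) ∂P := by
  have hproj : ∫ ω, proj P X h s q (X (s q) ω) * proj P X h r p (X (r p) ω) ∂P =
      ∫ ω, proj P X h s q (X (s q) ω) * h (fun l => X (r l) ω) ∂P :=
    WeightedU.integral_mul_proj H.measurable_sample H.indep H.measurable_kernel
      (A := {s q}) (g := fun x => proj P X h s q (x (s q)))
      ((WeightedU.measurable_proj H.measurable_sample H.measurable_kernel s q).comp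
        (measurable_pi_apply _)) (fun x y hxy => by simp only [hxy _ rfl])
      (fun l => by rw [Set.mem_singleton_iff, ← hrs.apply_eq, r.injective.eq_iff])
      ((H.memLp_proj s q _).integrable_mul (H.memLp r))
  rw [← H.integral_mul_proj hrs]
  simpa only [mul_comm] using hproj

theorem abs_integral_sub_proj_mul_sub_proj_le (H : SampleBounds P X h B C)
    {r s k t : Fin m ↪ Fin N} {p q : Fin m} (hrs : MeetAt r s p q) (hrt : MeetAt r t p q)
    (hks : MeetAt k s p q) (hkt : MeetAt k t p q) :
    |∫ ω, (h (fun l => X (r l) ω) - proj P X h k p (X (k p) ω)) *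
      (h (fun l => X (s l) ω) - proj P X h t q (X (t q) ω)) ∂P| ≤ 2 * crossGap P X h := by
  have hrs_int : Integrable (fun ω => h (fun l => X (r l) ω) * h (fun l => X (s l) ω)) P :=
    (H.memLp r).integrable_mul (H.memLp s)
  have hsk_int :
      Integrable (fun ω => h (fun l => X (s l) ω) * proj P X h k p (X (k p) ω)) P :=
    (H.memLp s).integrable_mul (H.memLp_proj k p _)
  have hrt_int :
      Integrable (fun ω => h (fun l => X (r l) ω) * proj P X h t q (X (t q) ω)) P :=
    (H.memLp r).integrable_mul (H.memLp_proj t q _)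
  have hkt_int :
      Integrable (fun ω => proj P X h k p (X (k p) ω) * proj P X h t q (X (t q) ω)) P :=
    (H.memLp_proj k p _).integrable_mul (H.memLp_proj t q _)
  have hrsk_int : Integrable (fun ω => h (fun l => X (r l) ω) * h (fun l => X (s l) ω) -
      h (fun l => X (s l) ω) * proj P X h k p (X (k p) ω)) P := hrs_int.sub hsk_int
  have hrtk_int : Integrable (fun ω => h (fun l => X (r l) ω) * proj P X h t q (X (t q) ω) -
      proj P X h k p (X (k p) ω) * proj P X h t q (X (t q) ω)) P := hrt_int.sub hkt_int
  have hexpand : ∫ ω, (h (fun l => X (r l) ω) - proj P X h k p (X (k p) ω)) *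
        (h (fun l => X (s l) ω) - proj P X h t q (X (t q) ω)) ∂P =
      (∫ ω, h (fun l => X (r l) ω) * h (fun l => X (s l) ω) ∂P -
        ∫ ω, h (fun l => X (k l) ω) * h (fun l => X (s l) ω) ∂P) -
      (∫ ω, h (fun l => X (r l) ω) * h (fun l => X (t l) ω) ∂P -
        ∫ ω, h (fun l => X (k l) ω) * h (fun l => X (t l) ω) ∂P) := by
    simp only [mul_comm (h fun l => X (k l) _) (h fun l => X (s l) _)]
    rw [← H.integral_mul_proj hks.symm, ← H.integral_mul_proj hrt, ← H.integral_proj_mul_proj hkt,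
      ← integral_sub hrs_int hsk_int, ← integral_sub hrt_int hkt_int,
      ← integral_sub hrsk_int hrtk_int]
    congr 1 with ω
    ring
  rw [hexpand, two_mul]
  exact (abs_sub _ _).trans
    (add_le_add (abs_integral_sub_integral_le_crossGap H.measurable_sample hrs hks)
      (abs_integral_sub_integral_le_crossGap H.measurable_sample hrt hkt))

section Pair

variable {I J : Fin m ↪ Fin N} {p q : Fin m} {j : Fin N}

theorem abs_integral_update_sub_proj_mul_update_sub_proj_le (H : SampleBounds P X h B C)
    (hIJ : MeetAt I J p q) (hI : ∀ x, x ≠ p → I x ≠ j) (hJ : ∀ y, y ≠ q → J y ≠ j)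
    {k k' : Fin m → Fin N} (hkk' : Function.Injective (Sum.elim k k')) (hkj : ∀ x, k x ≠ j)
    (hkj' : ∀ y, k' y ≠ j) (hkJ : ∀ x y, k x ≠ J y) (hkI : ∀ y x, k' y ≠ I x) :
    |∫ ω, (h (fun l => X (Function.update k p j l) ω) - proj P X h I p (X j ω)) *
      (h (fun l => X (Function.update k' q j l) ω) - proj P X h J q (X j ω)) ∂P| ≤
      2 * crossGap P X h := by
  let r : Fin m ↪ Fin N := ⟨k, hkk'.comp Sum.inl_injective⟩
  let s : Fin m ↪ Fin N := ⟨k', hkk'.comp Sum.inr_injective⟩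
  have hr : ∀ x, x ≠ p → r x ≠ j := fun x _ => hkj x
  have hs : ∀ y, y ≠ q → s y ≠ j := fun y _ => hkj' y
  have hcross := H.abs_integral_sub_proj_mul_sub_proj_le
    (meetAt_replaceIndex hr hs fun x y _ hxy =>
      Sum.inl_ne_inr (hkk' (a₁ := .inl x) (a₂ := .inr y) hxy))
    (meetAt_replaceIndex hr hJ fun x y _ => hkJ x y)
    (meetAt_replaceIndex hI hs fun x y _ hxy => hkI y x hxy.symm)
    (meetAt_replaceIndex hI hJ fun x y hx hxy => hx ((hIJ x y).1 hxy).1)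
  have hproj : ∀ {K : Fin m ↪ Fin N} {l : Fin m} (hK : ∀ x, x ≠ l → K x ≠ j) (y : 𝓧),
      proj P X h (replaceIndex K l j hK) l y = proj P X h K l y := fun hK =>
    proj_congr H.measurable_sample H.measurable_kernel fun _ hx => replaceIndex_of_ne _ _ _ hK hx
  simp only [replaceIndex_self, hproj] at hcross
  exact hcross

theorem abs_integral_projAvg_sub_proj_mul_projAvg_sub_proj_le (H : SampleBounds P X h B C)
    (hN : 0 < N) (hIJ : MeetAt I J p q) (hI : ∀ x, x ≠ p → I x ≠ j) (hJ : ∀ y, y ≠ q → J y ≠ j) :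
    |∫ ω, (projAvg h (fun i => X i ω) p j - proj P X h I p (X j ω)) *
      (projAvg h (fun i => X i ω) q j - proj P X h J q (X j ω)) ∂P| ≤
      2 * crossGap P X h + 4 * C * (4 * (m : ℝ) ^ 2 + 2 * m * (2 * m + 1)) / N := by
  classical
  have hmem : ∀ (K : Fin m ↪ Fin N) (l : Fin m) (k : Fin m → Fin N), MemLp (fun ω =>
      h (fun l' => X (Function.update k l j l') ω) - proj P X h K l (X j ω)) 2 P :=
    fun K l k => (H.memLp _).sub (H.memLp_proj K l j)
  have hsq : ∀ (K : Fin m ↪ Fin N) (l : Fin m) (k : Fin m → Fin N), ∫ ω,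
      (h (fun l' => X (Function.update k l j l') ω) - proj P X h K l (X j ω)) ^ 2 ∂P ≤ 4 * C :=
    fun K l k => (integral_sub_sq_le (H.memLp _) (H.memLp_proj K l j) (H.integral_sq_le _)
      (H.integral_proj_sq_le K l j)).trans_eq (by ring)
  let F : Finset (Fin N) := insert j (Finset.univ.image I ∪ Finset.univ.image J)
  have hF : ∀ {i}, i ∉ F → i ≠ j ∧ (∀ x, i ≠ I x) ∧ ∀ y, i ≠ J y := fun {i} hi => by
    simpa [F, eq_comm (a := i)] using hi
  have hFcard : (F.card : ℝ) ≤ 2 * m + 1 := by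
    have : F.card ≤ m + m + 1 := (Finset.card_insert_le _ _).trans (Nat.succ_le_succ
      ((Finset.card_union_le _ _).trans (add_le_add (Finset.card_image_le.trans_eq (by simp))
        (Finset.card_image_le.trans_eq (by simp)))))
    rw [two_mul]
    exact_mod_cast this
  simp only [projAvg, average_sub hN]
  refine (abs_integral_average_mul_average_le hN F (mul_nonneg zero_le_two crossGap_nonneg)
    (mul_nonneg zero_le_four H.second_nonneg) (hmem I p) (hmem J q) (fun k k' hkk' hk hk' =>
      H.abs_integral_update_sub_proj_mul_update_sub_proj_le hIJ hI hJ hkk'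
        (fun x => (hF (hk x)).1) (fun y => (hF (hk' y)).1) (fun x => (hF (hk x)).2.2)
        fun y => (hF (hk' y)).2.1) (hsq I p) (hsq J q)).trans ?_
  have := H.second_nonneg
  gcongr

end Pair

end SampleBounds

end ProjAvg

section AvoidsElsewhere

variable {m N : ℕ}

/-- The index `j` does not occur in the tuple of `t = (l, I)` in a position other than `l`. -/
def AvoidsElsewhere (j : Fin N) (t : Fin m × (Fin m ↪ Fin N)) : Prop := ∀ k, k ≠ t.1 → t.2 k ≠ j

open Classical in
/-- The coefficients of `h_{1,i}` whose tuples contain `j` at most in the free position. Only for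
these does the fourth moment condition control `h_{1,i}(X_j)`. -/
noncomputable def offCoef (a : (Fin m → Fin N) → ℝ) (i j : Fin N)
    (t : Fin m × (Fin m ↪ Fin N)) : ℝ := if AvoidsElsewhere j t then coef a i t else 0

open Classical in
/-- The coefficients of `h_{1,i}` whose tuples contain `j` in a position that is integrated out. -/
noncomputable def diagCoef (a : (Fin m → Fin N) → ℝ) (i j : Fin N)
    (t : Fin m × (Fin m ↪ Fin N)) : ℝ := if AvoidsElsewhere j t then 0 else coef a i t

theorem offCoef_add_diagCoef (a : (Fin m → Fin N) → ℝ) (i j : Fin N)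
    (t : Fin m × (Fin m ↪ Fin N)) : offCoef a i j t + diagCoef a i j t = coef a i t := by
  unfold offCoef diagCoef
  split_ifs <;> simp

theorem abs_offCoef_le (a : (Fin m → Fin N) → ℝ) (i j : Fin N)
    (t : Fin m × (Fin m ↪ Fin N)) : |offCoef a i j t| ≤ |coef a i t| := by
  unfold offCoef
  split_ifs <;> simp

theorem sum_abs_diagCoef_le (a : (Fin m → Fin N) → ℝ) (i : Fin N)
    (t : Fin m × (Fin m ↪ Fin N)) : ∑ j, |diagCoef a i j t| ≤ m * |coef a i t| := by
  classical
  have le_indicator (j : Fin N) : |diagCoef a i j t| ≤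
      if j ∈ Finset.univ.image t.2 then |coef a i t| else 0 := by
    by_cases hj : AvoidsElsewhere j t
    · rw [diagCoef, if_pos hj, abs_zero]
      positivity
    · rw [diagCoef, if_neg hj, if_pos]
      simp only [AvoidsElsewhere, not_forall, not_not] at hj
      obtain ⟨k, -, hk⟩ := hj
      exact Finset.mem_image.2 ⟨k, Finset.mem_univ _, hk⟩
  refine (Finset.sum_le_sum fun j _ => le_indicator j).trans ?_
  rw [Finset.sum_ite_mem, Finset.univ_inter, Finset.sum_const, nsmul_eq_mul]
  gcongr
  exact Finset.card_image_le.trans_eq (Finset.card_fin m)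

theorem sum_sq_sum_abs_diagCoef_le (a : (Fin m → Fin N) → ℝ) (i : Fin N) :
    ∑ j, (∑ t, |diagCoef a i j t|) ^ 2 ≤ (m : ℝ) ^ 2 * totalWeight a i ^ 2 := by
  have sum_nonneg (j : Fin N) : 0 ≤ ∑ t, |diagCoef a i j t| :=
    Finset.sum_nonneg fun _ _ => abs_nonneg _
  calc ∑ j, (∑ t, |diagCoef a i j t|) ^ 2 ≤ (∑ j, ∑ t, |diagCoef a i j t|) ^ 2 :=
        Finset.sum_sq_le_sq_sum_of_nonneg fun j _ => sum_nonneg j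
    _ ≤ (m * totalWeight a i) ^ 2 := by
        refine pow_le_pow_left₀ (Finset.sum_nonneg fun j _ => sum_nonneg j) ?_ 2
        rw [Finset.sum_comm, totalWeight, Finset.mul_sum]
        exact Finset.sum_le_sum fun t _ => sum_abs_diagCoef_le a i t
    _ = _ := mul_pow _ _ _

theorem sum_abs_coef_mul_abs_coef_le (a : (Fin m → Fin N) → ℝ)
    (t t' : Fin m × (Fin m ↪ Fin N)) :
    ∑ i, |coef a i t| * |coef a i t'| ≤ normFactor m N ^ 2 * |a t.2 * a t'.2| := by
  calc _ = ∑ i, ∏ k : Fin 2, |coef a i (![t.1, t'.1] k, ![t.2, t'.2] k)| := by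
        simp only [Fin.prod_univ_two, Matrix.cons_val_zero, Matrix.cons_val_one]
    _ ≤ if ![t.2, t'.2] ∈ sharingTuples m N 2 1 then
        normFactor m N ^ 2 * |∏ k : Fin 2, a (![t.2, t'.2] k)| else 0 :=
        sum_prod_abs_coef_le a ![t.1, t'.1] ![t.2, t'.2]
    _ ≤ _ := by
        split_ifs
        exacts [(by rw [Fin.prod_univ_two]; rfl), by positivity]

theorem sum_coef_pair_le (a : (Fin m → Fin N) → ℝ) :
    ∑ i, ∑ t, ∑ t', (if ![t.2, t'.2] ∈ sharingTuples m N 2 2 then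
        |coef a i t| * |coef a i t'| else 0) ≤ (m : ℝ) ^ 2 * sharedWeight a 2 2 := by
  have sum_le (t t' : Fin m × (Fin m ↪ Fin N)) :
      (∑ i, if ![t.2, t'.2] ∈ sharingTuples m N 2 2 then |coef a i t| * |coef a i t'| else 0) ≤
        if ![t.2, t'.2] ∈ sharingTuples m N 2 2 then normFactor m N ^ 2 * |a t.2 * a t'.2|
        else 0 := by
    split_ifs
    exacts [sum_abs_coef_mul_abs_coef_le a t t', Finset.sum_const_zero.le]
  have pair_sum := sum_sharingTuples_two (N := N) (m := m) 2 fun I J =>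
    normFactor m N ^ 2 * |a I * a J|
  rw [Finset.sum_comm]
  simp only [Finset.sum_comm (s := Finset.univ (α := Fin N))]
  refine (Finset.sum_le_sum fun t _ => Finset.sum_le_sum fun t' _ => sum_le t t').trans_eq ?_
  simp only [Fintype.sum_prod_type, Finset.sum_const, Finset.card_univ, Fintype.card_fin,
    nsmul_eq_mul, ← Finset.mul_sum]
  rw [← pair_sum, sharedWeight, ← Finset.mul_sum]
  simp only [Fin.prod_univ_two]
  ring

end AvoidsElsewhere

theorem integral_sum_mul_sq_le {ι Ω : Type*} [Fintype ι] [MeasurableSpace Ω] {P : Measure Ω}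
    (c : ι → ℝ) {f : ι → Ω → ℝ} {K : ℝ} (hf : ∀ t, MemLp (f t) 2 P)
    (hK : ∀ t, ∫ ω, f t ω ^ 2 ∂P ≤ K) :
    ∫ ω, (∑ t, c t * f t ω) ^ 2 ∂P ≤ (∑ t, |c t|) ^ 2 * K := by
  rw [integral_sum_sq _ _ fun t _ => hf t, pow_two, Finset.sum_mul_sum, Finset.sum_mul]
  refine Finset.sum_le_sum fun t _ => ?_
  rw [Finset.sum_mul]
  refine Finset.sum_le_sum fun t' _ => (le_abs_self _).trans ?_
  rw [abs_mul, abs_mul]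
  exact mul_le_mul_of_nonneg_left (abs_integral_mul_le (hf t) (hf t') (hK t) (hK t'))
    (by positivity)

section HomogeneityGap

variable {𝓧 : Type*} {m N : ℕ} {Ω : Type*} [MeasurableSpace Ω] [MeasurableSpace 𝓧]
  {P : Measure Ω} {X : Fin N → Ω → 𝓧} {h : (Fin m → 𝓧) → ℝ}

/-- The factor `M_1² + M_2 + N⁻¹` of the third homogeneity condition. -/
noncomputable def homogeneityGap (P : Measure Ω) (X : Fin N → Ω → 𝓧)
    (h : (Fin m → 𝓧) → ℝ) : ℝ :=
  meanGap P X h ^ 2 + crossGap P X h + (N : ℝ)⁻¹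

theorem meanGap_sq_le_homogeneityGap : meanGap P X h ^ 2 ≤ homogeneityGap P X h := by
  have := crossGap_nonneg (P := P) (X := X) (h := h)
  rw [homogeneityGap, add_assoc]
  exact le_add_of_nonneg_right (by positivity)

theorem crossGap_le_homogeneityGap : crossGap P X h ≤ homogeneityGap P X h := by
  rw [homogeneityGap, add_right_comm]
  exact le_add_of_nonneg_left (by positivity)

theorem inv_le_homogeneityGap : (N : ℝ)⁻¹ ≤ homogeneityGap P X h := by
  have := crossGap_nonneg (P := P) (X := X) (h := h)
  exact le_add_of_nonneg_left (by positivity)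

theorem homogeneityGap_nonneg : 0 ≤ homogeneityGap P X h :=
  (sq_nonneg _).trans meanGap_sq_le_homogeneityGap

theorem one_le_mul_homogeneityGap (hN : 0 < N) : 1 ≤ N * homogeneityGap P X h := by
  have hN' : (0 : ℝ) < N := by exact_mod_cast hN
  simpa [hN'.ne'] using mul_le_mul_of_nonneg_left
    (inv_le_homogeneityGap (P := P) (X := X) (h := h)) hN'.le

end HomogeneityGap

section Comparison

variable {𝓧 : Type*} [MeasurableSpace 𝓧] {m N : ℕ} {Ω : Type*} [MeasurableSpace Ω]
  {P : Measure Ω} {X : Fin N → Ω → 𝓧} {h : (Fin m → 𝓧) → ℝ} {B C : ℝ}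
  {a : (Fin m → Fin N) → ℝ}

/-- The part of `h_{1,i}(X_j)` that comes from the tuples containing `j` at most in the free
position; only this part is controlled by fourth moments at distinct indices. -/
noncomputable def offOne (P : Measure Ω) (X : Fin N → Ω → 𝓧) (a : (Fin m → Fin N) → ℝ)
    (h : (Fin m → 𝓧) → ℝ) (i j : Fin N) (x : 𝓧) : ℝ :=
  ∑ t : Fin m × (Fin m ↪ Fin N), offCoef a i j t * centeredProj P X h t.2 t.1 x

theorem sum_integral_diagCoef_sq_le {f : Fin N → Fin m × (Fin m ↪ Fin N) → Ω → ℝ} {K : ℝ}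
    (hK : 0 ≤ K) (hf : ∀ j t, MemLp (f j t) 2 P) (hfK : ∀ j t, ∫ ω, f j t ω ^ 2 ∂P ≤ K) :
    ∑ i, ∑ j, ∫ ω, (∑ t, diagCoef a i j t * f j t ω) ^ 2 ∂P ≤
      (m : ℝ) ^ 2 * K * ∑ i, totalWeight a i ^ 2 := by
  rw [Finset.mul_sum]
  refine Finset.sum_le_sum fun i _ => ?_
  calc _ ≤ ∑ j, (∑ t, |diagCoef a i j t|) ^ 2 * K :=
        Finset.sum_le_sum fun j _ => integral_sum_mul_sq_le _ (hf j) (hfK j)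
    _ ≤ ((m : ℝ) ^ 2 * totalWeight a i ^ 2) * K := by
        rw [← Finset.sum_mul]
        exact mul_le_mul_of_nonneg_right (sum_sq_sum_abs_diagCoef_le a i) hK
    _ = _ := by ring

theorem hOne_sub_offOne (i j : Fin N) (x : 𝓧) : hOne P X a h i x - offOne P X a h i j x =
    ∑ t : Fin m × (Fin m ↪ Fin N), diagCoef a i j t * centeredProj P X h t.2 t.1 x := by
  rw [hOne_eq_sum, offOne, ← Finset.sum_sub_distrib]
  refine Finset.sum_congr rfl fun t _ => ?_
  rw [← offCoef_add_diagCoef a i j t]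
  ring

theorem bootOne_sub_hOne (x : Fin N → 𝓧) (i j : Fin N) :
    bootOne a h x i j - hOne P X a h i (x j) =
      (∑ t, offCoef a i j t * (projAvg h x t.1 j - proj P X h t.2 t.1 (x j)) +
        ∑ t, diagCoef a i j t * (projAvg h x t.1 j - proj P X h t.2 t.1 (x j))) -
      ∑ t : Fin m × (Fin m ↪ Fin N), coef a i t * (tupleAvg h x - theta P X h t.2) := by
  rw [hOne_eq_sum, bootOne, ← Finset.sum_sub_distrib, ← Finset.sum_add_distrib,
    ← Finset.sum_sub_distrib]
  refine Finset.sum_congr rfl fun t _ => ?_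
  rw [← offCoef_add_diagCoef a i j t, centeredProj]
  ring

namespace SampleBounds

theorem memLp_bootOne (H : SampleBounds P X h B C) (i j : Fin N) :
    MemLp (fun ω => bootOne a h (fun k => X k ω) i j) 2 P :=
  memLp_finsetSum _ fun t _ => ((H.memLp_projAvg t.1 j).sub H.memLp_tupleAvg).const_mul _

variable [IsProbabilityMeasure P]

theorem memLp_centeredProj (H : SampleBounds P X h B C) (I : Fin m ↪ Fin N) (l : Fin m)
    (j : Fin N) : MemLp (fun ω => centeredProj P X h I l (X j ω)) 2 P :=
  (H.memLp_proj I l j).sub (memLp_const (theta P X h I))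

theorem integral_centeredProj_sq_le (H : SampleBounds P X h B C) (I : Fin m ↪ Fin N)
    (l : Fin m) (j : Fin N) : ∫ ω, centeredProj P X h I l (X j ω) ^ 2 ∂P ≤ 4 * C := by
  refine (integral_sub_sq_le (H.memLp_proj I l j) (memLp_const _) (H.integral_proj_sq_le I l j)
    (L := C) ?_).trans_eq (by ring)
  simpa only [integral_const, probReal_univ, one_smul] using H.theta_sq_le I

theorem memLp_hOne (H : SampleBounds P X h B C) (i j : Fin N) :
    MemLp (fun ω => hOne P X a h i (X j ω)) 2 P := by
  simp only [hOne_eq_sum]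
  exact memLp_finsetSum _ fun t _ => (H.memLp_centeredProj t.2 t.1 j).const_mul _

theorem memLp_offOne (H : SampleBounds P X h B C) (i j : Fin N) :
    MemLp (fun ω => offOne P X a h i j (X j ω)) 2 P :=
  memLp_finsetSum _ fun t _ => (H.memLp_centeredProj t.2 t.1 j).const_mul _

theorem memLp_projAvg_sub_proj (H : SampleBounds P X h B C) (I : Fin m ↪ Fin N) (l : Fin m)
    (j : Fin N) :
    MemLp (fun ω => projAvg h (fun i => X i ω) l j - proj P X h I l (X j ω)) 2 P :=
  (H.memLp_projAvg l j).sub (H.memLp_proj I l j)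

theorem memLp_tupleAvg_sub_theta (H : SampleBounds P X h B C) (I : Fin m ↪ Fin N) :
    MemLp (fun ω => tupleAvg h (fun i => X i ω) - theta P X h I) 2 P :=
  H.memLp_tupleAvg.sub (memLp_const (theta P X h I))

theorem sum_integral_hOne_sub_offOne_sq_le (H : SampleBounds P X h B C) :
    ∑ i, ∑ j, ∫ ω, (hOne P X a h i (X j ω) - offOne P X a h i j (X j ω)) ^ 2 ∂P ≤
      (m : ℝ) ^ 2 * (4 * C) * ∑ i, totalWeight a i ^ 2 := by
  have := H.second_nonneg
  simp only [hOne_sub_offOne]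
  exact sum_integral_diagCoef_sq_le (by positivity) (fun j t => H.memLp_centeredProj t.2 t.1 j)
    fun j t => H.integral_centeredProj_sq_le t.2 t.1 j

theorem sum_integral_diagCoef_projAvg_sub_proj_sq_le (H : SampleBounds P X h B C) (hN : 0 < N) :
    ∑ i, ∑ j, ∫ ω, (∑ t, diagCoef a i j t *
        (projAvg h (fun k => X k ω) t.1 j - proj P X h t.2 t.1 (X j ω))) ^ 2 ∂P ≤
      (m : ℝ) ^ 2 * (4 * C) * ∑ i, totalWeight a i ^ 2 := by
  have := H.second_nonneg
  exact sum_integral_diagCoef_sq_le (by positivity)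
    (fun j t => H.memLp_projAvg_sub_proj t.2 t.1 j) fun j t =>
      (integral_sub_sq_le (H.memLp_projAvg t.1 j) (H.memLp_proj t.2 t.1 j)
        (H.integral_projAvg_sq_le hN t.1 j) (H.integral_proj_sq_le t.2 t.1 j)).trans_eq (by ring)

theorem sum_integral_coef_tupleAvg_sub_theta_sq_le (H : SampleBounds P X h B C) (hN : 0 < N) :
    ∑ i, ∑ _j : Fin N, ∫ ω, (∑ t : Fin m × (Fin m ↪ Fin N), coef a i t *
        (tupleAvg h (fun k => X k ω) - theta P X h t.2)) ^ 2 ∂P ≤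
      N * (1 + 16 * C * m ^ 2) * homogeneityGap P X h * ∑ i, totalWeight a i ^ 2 := by
  have hC := H.second_nonneg
  have gap_le : meanGap P X h ^ 2 + 4 * C * (4 * (m : ℝ) ^ 2) / N ≤
      (1 + 16 * C * m ^ 2) * homogeneityGap P X h := by
    calc _ = meanGap P X h ^ 2 + 16 * C * m ^ 2 * (N : ℝ)⁻¹ := by ring
      _ ≤ homogeneityGap P X h + 16 * C * m ^ 2 * homogeneityGap P X h := by
          gcongr
          exacts [meanGap_sq_le_homogeneityGap, inv_le_homogeneityGap]
      _ = _ := by ring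
  have integral_le (i : Fin N) : ∫ ω, (∑ t : Fin m × (Fin m ↪ Fin N), coef a i t *
      (tupleAvg h (fun k => X k ω) - theta P X h t.2)) ^ 2 ∂P ≤
      totalWeight a i ^ 2 * ((1 + 16 * C * m ^ 2) * homogeneityGap P X h) :=
    integral_sum_mul_sq_le (coef a i) (fun t => H.memLp_tupleAvg_sub_theta t.2)
      fun t => (H.integral_tupleAvg_sub_theta_sq_le hN t.2).trans gap_le
  simp only [Finset.sum_const, Finset.card_fin, nsmul_eq_mul, ← Finset.mul_sum]
  calc _ ≤ (N : ℝ) * ∑ i, totalWeight a i ^ 2 *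
        ((1 + 16 * C * m ^ 2) * homogeneityGap P X h) := by
        gcongr with i
        exact integral_le i
    _ = _ := by rw [← Finset.sum_mul]; ring

theorem integral_projAvg_sub_proj_sq_le (H : SampleBounds P X h B C) (hN : 0 < N) {j : Fin N}
    {t : Fin m × (Fin m ↪ Fin N)} (ht : AvoidsElsewhere j t) :
    ∫ ω, (projAvg h (fun k => X k ω) t.1 j - proj P X h t.2 t.1 (X j ω)) ^ 2 ∂P ≤
      4 * B + 4 * C * m ^ 2 / N := by
  have hC := H.second_nonneg
  have cast_le_sq : (m : ℝ) ≤ (m : ℝ) ^ 2 := by exact_mod_cast Nat.le_self_pow two_ne_zero m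
  calc _ ≤ 2 * (B + C * ((m : ℝ) ^ 2 + m) / N) + 2 * B :=
        integral_sub_sq_le (H.memLp_projAvg t.1 j) (H.memLp_proj t.2 t.1 j)
          (H.integral_projAvg_sq_le_add hN t.1 j) (H.integral_proj_sq_le_of_forall_ne ht)
    _ ≤ 2 * (B + C * ((m : ℝ) ^ 2 + (m : ℝ) ^ 2) / N) + 2 * B := by gcongr
    _ = _ := by ring

theorem abs_integral_projAvg_sub_proj_mul_le (H : SampleBounds P X h B C) (hN : 0 < N)
    {j : Fin N} {t t' : Fin m × (Fin m ↪ Fin N)} (ht : AvoidsElsewhere j t)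
    (ht' : AvoidsElsewhere j t') (hmeet : MeetAt t.2 t'.2 t.1 t'.1) :
    |∫ ω, (projAvg h (fun k => X k ω) t.1 j - proj P X h t.2 t.1 (X j ω)) *
      (projAvg h (fun k => X k ω) t'.1 j - proj P X h t'.2 t'.1 (X j ω)) ∂P| ≤
      (2 + 40 * C * m ^ 2) * homogeneityGap P X h := by
  have hC := H.second_nonneg
  have cast_le_sq : (m : ℝ) ≤ (m : ℝ) ^ 2 := by exact_mod_cast Nat.le_self_pow two_ne_zero m
  calc _ ≤ 2 * crossGap P X h + 4 * C * (4 * (m : ℝ) ^ 2 + 2 * m * (2 * m + 1)) / N :=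
        H.abs_integral_projAvg_sub_proj_mul_projAvg_sub_proj_le hN hmeet ht ht'
    _ = 2 * crossGap P X h + 4 * C * (8 * (m : ℝ) ^ 2 + 2 * m) * (N : ℝ)⁻¹ := by ring
    _ ≤ 2 * homogeneityGap P X h +
        4 * C * (8 * (m : ℝ) ^ 2 + 2 * (m : ℝ) ^ 2) * homogeneityGap P X h := by
        gcongr
        exacts [crossGap_le_homogeneityGap, inv_le_homogeneityGap]
    _ = _ := by ring

/-- Two tuples of `h_{1,i}` share the index `i`; only the few pairs that share a second index need
the bound by second moments. -/
theorem offCoef_mul_offCoef_mul_integral_le (H : SampleBounds P X h B C) (hN : 0 < N)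
    (i j : Fin N) (t t' : Fin m × (Fin m ↪ Fin N)) :
    offCoef a i j t * offCoef a i j t' *
      ∫ ω, (projAvg h (fun k => X k ω) t.1 j - proj P X h t.2 t.1 (X j ω)) *
        (projAvg h (fun k => X k ω) t'.1 j - proj P X h t'.2 t'.1 (X j ω)) ∂P ≤
      (2 + 40 * C * m ^ 2) * homogeneityGap P X h * (|coef a i t| * |coef a i t'|) +
        (4 * B + 4 * C * m ^ 2 / N) * (if ![t.2, t'.2] ∈ sharingTuples m N 2 2 then
          |coef a i t| * |coef a i t'| else 0) := by
  have hB := H.fourth_nonneg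
  have hC := H.second_nonneg
  have hgap := homogeneityGap_nonneg (P := P) (X := X) (h := h)
  by_cases hvanish : offCoef a i j t = 0 ∨ offCoef a i j t' = 0
  · rw [mul_eq_zero.2 hvanish, zero_mul]
    positivity
  simp only [offCoef, coef, ite_eq_right_iff, not_or, Classical.not_imp] at hvanish
  obtain ⟨⟨ht, hi, -⟩, ht', hi', -⟩ := hvanish
  refine (le_abs_self _).trans ?_
  rw [abs_mul, abs_mul, offCoef, if_pos ht, offCoef, if_pos ht',
    mul_comm (|coef a i t| * |coef a i t'|)]
  by_cases hcard : 2 ≤ (commonIndices ![t.2, t'.2]).card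
  · have hshare : ![t.2, t'.2] ∈ sharingTuples m N 2 2 :=
      Finset.mem_filter.2 ⟨Finset.mem_univ _, hcard⟩
    rw [if_pos hshare]
    refine le_add_of_nonneg_of_le (by positivity) (mul_le_mul_of_nonneg_right ?_ (by positivity))
    exact abs_integral_mul_le (H.memLp_projAvg_sub_proj t.2 t.1 j)
      (H.memLp_projAvg_sub_proj t'.2 t'.1 j) (H.integral_projAvg_sub_proj_sq_le hN ht)
      (H.integral_projAvg_sub_proj_sq_le hN ht')
  · refine le_add_of_le_of_nonneg (mul_le_mul_of_nonneg_right ?_ (by positivity)) (by positivity)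
    exact H.abs_integral_projAvg_sub_proj_mul_le hN ht ht'
      (meetAt_of_card_lt_two (hi.trans hi'.symm) (not_le.1 hcard))

theorem sum_integral_offCoef_projAvg_sub_proj_sq_le (H : SampleBounds P X h B C) (hN : 0 < N)
    (j : Fin N) :
    ∑ i, ∫ ω, (∑ t, offCoef a i j t *
        (projAvg h (fun k => X k ω) t.1 j - proj P X h t.2 t.1 (X j ω))) ^ 2 ∂P ≤
      (2 + 40 * C * m ^ 2) * homogeneityGap P X h * ∑ i, totalWeight a i ^ 2 +
        (4 * B + 4 * C * m ^ 2 / N) * ((m : ℝ) ^ 2 * sharedWeight a 2 2) := by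
  have hB := H.fourth_nonneg
  have hC := H.second_nonneg
  calc _ ≤ ∑ i, ∑ t, ∑ t',
        ((2 + 40 * C * m ^ 2) * homogeneityGap P X h * (|coef a i t| * |coef a i t'|) +
          (4 * B + 4 * C * m ^ 2 / N) * (if ![t.2, t'.2] ∈ sharingTuples m N 2 2 then
            |coef a i t| * |coef a i t'| else 0)) := by
        refine Finset.sum_le_sum fun i _ => ?_
        rw [integral_sum_sq _ _ fun t _ => H.memLp_projAvg_sub_proj t.2 t.1 j]
        exact Finset.sum_le_sum fun t _ => Finset.sum_le_sum fun t' _ =>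
          H.offCoef_mul_offCoef_mul_integral_le hN i j t t'
    _ = (2 + 40 * C * m ^ 2) * homogeneityGap P X h * ∑ i, totalWeight a i ^ 2 +
        (4 * B + 4 * C * m ^ 2 / N) * ∑ i, ∑ t, ∑ t',
          (if ![t.2, t'.2] ∈ sharingTuples m N 2 2 then |coef a i t| * |coef a i t'| else 0) := by
        simp only [Finset.sum_add_distrib, ← Finset.mul_sum, ← Finset.sum_mul, totalWeight,
          pow_two]
    _ ≤ _ := by
        gcongr
        exact sum_coef_pair_le a

theorem integral_bootOne_sub_hOne_sq_le (H : SampleBounds P X h B C) (i j : Fin N) :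
    ∫ ω, (bootOne a h (fun k => X k ω) i j - hOne P X a h i (X j ω)) ^ 2 ∂P ≤
      4 * ∫ ω, (∑ t, offCoef a i j t *
          (projAvg h (fun k => X k ω) t.1 j - proj P X h t.2 t.1 (X j ω))) ^ 2 ∂P +
        4 * ∫ ω, (∑ t, diagCoef a i j t *
          (projAvg h (fun k => X k ω) t.1 j - proj P X h t.2 t.1 (X j ω))) ^ 2 ∂P +
        2 * ∫ ω, (∑ t : Fin m × (Fin m ↪ Fin N), coef a i t *
          (tupleAvg h (fun k => X k ω) - theta P X h t.2)) ^ 2 ∂P := by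
  have memLp_projPart (c : Fin m × (Fin m ↪ Fin N) → ℝ) : MemLp (fun ω => ∑ t, c t *
      (projAvg h (fun k => X k ω) t.1 j - proj P X h t.2 t.1 (X j ω))) 2 P :=
    memLp_finsetSum _ fun t _ => (H.memLp_projAvg_sub_proj t.2 t.1 j).const_mul (c t)
  have memLp_meanPart : MemLp (fun ω => ∑ t : Fin m × (Fin m ↪ Fin N), coef a i t *
      (tupleAvg h (fun k => X k ω) - theta P X h t.2)) 2 P :=
    memLp_finsetSum _ fun t _ => (H.memLp_tupleAvg_sub_theta t.2).const_mul (coef a i t)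
  simp only [bootOne_sub_hOne]
  exact (integral_sub_sq_le ((memLp_projPart (offCoef a i j)).add (memLp_projPart (diagCoef a i j)))
    memLp_meanPart (integral_add_sq_le (memLp_projPart _) (memLp_projPart _) le_rfl le_rfl)
    le_rfl).trans_eq (by ring)

theorem sum_integral_bootOne_sub_hOne_sq_le (H : SampleBounds P X h B C) (hN : 0 < N) :
    ∑ i, ∑ j, ∫ ω, (bootOne a h (fun k => X k ω) i j - hOne P X a h i (X j ω)) ^ 2 ∂P ≤
      N * (m : ℝ) ^ 2 * ((10 + 224 * C * m ^ 2) * (homogeneityGap P X h * sharedWeight a 2 1) +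
        16 * (B * sharedWeight a 2 2)) := by
  have hC := H.second_nonneg
  have hgap := homogeneityGap_nonneg (P := P) (X := X) (h := h)
  have one_le := one_le_mul_homogeneityGap (P := P) (X := X) (h := h) hN
  have inv_mul_le : (N : ℝ)⁻¹ * sharedWeight a 2 2 ≤ homogeneityGap P X h * sharedWeight a 2 1 :=
    mul_le_mul inv_le_homogeneityGap (sharedWeight_two_le_one a 2) (sharedWeight_nonneg _ _ _) hgap
  have sum_le : ∑ i, totalWeight a i ^ 2 ≤ (m : ℝ) ^ 2 * sharedWeight a 2 1 :=
    sum_totalWeight_pow_le a 1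
  have offPart_le := Finset.sum_le_sum fun j (_ : j ∈ Finset.univ) =>
    H.sum_integral_offCoef_projAvg_sub_proj_sq_le (a := a) hN j
  have diagPart_le := (H.sum_integral_diagCoef_projAvg_sub_proj_sq_le (a := a) hN).trans
    (le_mul_of_one_le_right (by positivity) one_le)
  have meanPart_le := H.sum_integral_coef_tupleAvg_sub_theta_sq_le (a := a) hN
  rw [Finset.sum_comm, Finset.sum_const, Finset.card_fin, nsmul_eq_mul] at offPart_le
  refine (Finset.sum_le_sum fun i _ => Finset.sum_le_sum fun j _ =>
    H.integral_bootOne_sub_hOne_sq_le i j).trans ?_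
  simp only [Finset.sum_add_distrib, ← Finset.mul_sum]
  calc _ ≤ 4 * (N * ((2 + 40 * C * m ^ 2) * homogeneityGap P X h * ∑ i, totalWeight a i ^ 2 +
          (4 * B + 4 * C * m ^ 2 / N) * ((m : ℝ) ^ 2 * sharedWeight a 2 2))) +
        4 * ((m : ℝ) ^ 2 * (4 * C) * (∑ i, totalWeight a i ^ 2) *
          (N * homogeneityGap P X h)) +
        2 * (N * (1 + 16 * C * m ^ 2) * homogeneityGap P X h * ∑ i, totalWeight a i ^ 2) := by
        gcongr
    _ = N * ((10 + 208 * C * m ^ 2) * homogeneityGap P X h * ∑ i, totalWeight a i ^ 2 +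
        (m : ℝ) ^ 2 * (16 * C * m ^ 2 * ((N : ℝ)⁻¹ * sharedWeight a 2 2) +
          16 * (B * sharedWeight a 2 2))) := by
        ring
    _ ≤ N * ((10 + 208 * C * m ^ 2) * homogeneityGap P X h * ((m : ℝ) ^ 2 * sharedWeight a 2 1) +
        (m : ℝ) ^ 2 * (16 * C * m ^ 2 * (homogeneityGap P X h * sharedWeight a 2 1) +
          16 * (B * sharedWeight a 2 2))) := by gcongr
    _ = _ := by ring

end SampleBounds

end Comparison

section Variance

theorem sq_sum_mul_le {ι : Type*} [Fintype ι] (c z : ι → ℝ) :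
    (∑ i, c i * z i) ^ 2 ≤ (∑ i, |c i|) * ∑ i, |c i| * z i ^ 2 :=
  Finset.sum_sq_le_sum_mul_sum_of_sq_le_mul _ (fun _ _ => abs_nonneg _)
    (fun _ _ => by positivity) fun i _ => by rw [mul_pow, ← sq_abs (c i)]; exact le_of_eq (by ring)

variable {𝓧 : Type*} [MeasurableSpace 𝓧] {m N : ℕ} {Ω : Type*} [MeasurableSpace Ω]
  {P : Measure Ω} {X : Fin N → Ω → 𝓧} {h : (Fin m → 𝓧) → ℝ} {B C : ℝ}
  {a : (Fin m → Fin N) → ℝ}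

theorem sum_abs_offCoef_le (i j : Fin N) : ∑ t, |offCoef a i j t| ≤ totalWeight a i :=
  Finset.sum_le_sum fun t _ => abs_offCoef_le a i j t

theorem sum_offOne_sq_le (j : Fin N) (x : 𝓧) :
    ∑ i, offOne P X a h i j x ^ 2 ≤
      ∑ s : Fin N × (Fin m × (Fin m ↪ Fin N)), totalWeight a s.1 * |offCoef a s.1 j s.2| *
        centeredProj P X h s.2.2 s.2.1 x ^ 2 := by
  rw [Fintype.sum_prod_type]
  refine Finset.sum_le_sum fun i _ => (sq_sum_mul_le _ _).trans ?_
  simp only [mul_assoc, ← Finset.mul_sum]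
  gcongr
  exact sum_abs_offCoef_le i j

theorem sq_sum_offOne_sq_le (j : Fin N) (x : 𝓧) :
    (∑ i, offOne P X a h i j x ^ 2) ^ 2 ≤ (∑ i, totalWeight a i ^ 2) *
      ∑ i, totalWeight a i * ∑ t, |offCoef a i j t| * centeredProj P X h t.2 t.1 x ^ 4 := by
  refine (pow_le_pow_left₀ (Finset.sum_nonneg fun i _ => sq_nonneg _)
    (sum_offOne_sq_le j x) 2).trans ((sq_sum_mul_le _ _).trans ?_)
  rw [Fintype.sum_prod_type (α₁ := Fin N), Fintype.sum_prod_type (α₁ := Fin N)]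
  simp only [abs_mul, abs_abs, abs_of_nonneg (totalWeight_nonneg _ _), mul_assoc, ← Finset.mul_sum,
    ← pow_mul, Nat.reduceMul, pow_two (totalWeight _ _)]
  gcongr with i
  exacts [Finset.sum_nonneg fun i _ => mul_nonneg (totalWeight_nonneg _ _)
    (Finset.sum_nonneg fun t _ => by positivity), totalWeight_nonneg _ _, sum_abs_offCoef_le i j]

variable [IsProbabilityMeasure P]

namespace SampleBounds

theorem measurable_centeredProj (H : SampleBounds P X h B C) (I : Fin m ↪ Fin N) (l : Fin m) :
    Measurable (centeredProj P X h I l) :=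
  WeightedU.measurable_centeredProj H.measurable_sample H.measurable_kernel I l

theorem measurable_sum_offOne_sq (H : SampleBounds P X h B C) (j : Fin N) :
    Measurable fun x => ∑ i, offOne P X a h i j x ^ 2 :=
  Finset.measurable_sum _ fun _ _ => Measurable.pow_const (Finset.measurable_sum _ fun t _ =>
    (H.measurable_centeredProj t.2 t.1).const_mul _) 2

theorem integrable_centeredProj_pow_four (H : SampleBounds P X h B C) {j : Fin N}
    {t : Fin m × (Fin m ↪ Fin N)} (ht : AvoidsElsewhere j t) :
    Integrable (fun ω => centeredProj P X h t.2 t.1 (X j ω) ^ 4) P := by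
  refine (((H.integrable_proj_pow_four ht).add
    (integrable_const ((-theta P X h t.2) ^ 4))).const_mul (2 ^ 3)).mono'
    (((H.measurable_centeredProj t.2 t.1).comp
      (H.measurable_sample j)).pow_const 4).aestronglyMeasurable (.of_forall fun ω => ?_)
  rw [Real.norm_eq_abs, abs_of_nonneg (by positivity), centeredProj, sub_eq_add_neg]
  exact Even.add_pow_le ⟨2, rfl⟩

theorem integral_centeredProj_pow_four_le (H : SampleBounds P X h B C) {j : Fin N}
    {t : Fin m × (Fin m ↪ Fin N)} (ht : AvoidsElsewhere j t) :
    ∫ ω, centeredProj P X h t.2 t.1 (X j ω) ^ 4 ∂P ≤ 16 * B ^ 2 := by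
  have hproj := H.integrable_proj_pow_four ht
  calc _ ≤ ∫ ω, 2 ^ 3 * (proj P X h t.2 t.1 (X j ω) ^ 4 + (-theta P X h t.2) ^ 4) ∂P := by
        refine integral_mono (H.integrable_centeredProj_pow_four ht)
          ((hproj.add (integrable_const _)).const_mul _) fun ω => ?_
        rw [centeredProj, sub_eq_add_neg]
        exact Even.add_pow_le ⟨2, rfl⟩
    _ = 8 * (∫ ω, proj P X h t.2 t.1 (X j ω) ^ 4 ∂P + theta P X h t.2 ^ 4) := by
        rw [integral_const_mul, integral_add hproj (integrable_const _), integral_const,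
          probReal_univ, one_smul, Even.neg_pow ⟨2, rfl⟩]
        norm_num
    _ ≤ 8 * (B ^ 2 + B ^ 2) := by
        gcongr
        exacts [H.integral_proj_pow_four_le ht, H.theta_pow_four_le t.2]
    _ = 16 * B ^ 2 := by ring

theorem integrable_abs_offCoef_mul_centeredProj_pow_four (H : SampleBounds P X h B C)
    (i j : Fin N) (t : Fin m × (Fin m ↪ Fin N)) :
    Integrable (fun ω => |offCoef a i j t| * centeredProj P X h t.2 t.1 (X j ω) ^ 4) P := by
  by_cases ht : AvoidsElsewhere j t
  · exact (H.integrable_centeredProj_pow_four ht).const_mul _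
  · simp only [offCoef, if_neg ht, abs_zero, zero_mul]
    exact integrable_zero _ _ _

theorem integral_abs_offCoef_mul_centeredProj_pow_four_le (H : SampleBounds P X h B C)
    (i j : Fin N) (t : Fin m × (Fin m ↪ Fin N)) :
    ∫ ω, |offCoef a i j t| * centeredProj P X h t.2 t.1 (X j ω) ^ 4 ∂P ≤
      |coef a i t| * (16 * B ^ 2) := by
  by_cases ht : AvoidsElsewhere j t
  · rw [integral_const_mul]
    exact mul_le_mul (abs_offCoef_le a i j t) (H.integral_centeredProj_pow_four_le ht)
      (integral_nonneg fun ω => by positivity) (abs_nonneg _)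
  · simp only [offCoef, if_neg ht, abs_zero, zero_mul, integral_zero]
    positivity

theorem integrable_totalWeight_mul_sum (H : SampleBounds P X h B C) (j i : Fin N) :
    Integrable (fun ω => totalWeight a i * ∑ t, |offCoef a i j t| *
      centeredProj P X h t.2 t.1 (X j ω) ^ 4) P :=
  (integrable_finsetSum _ fun t _ =>
    H.integrable_abs_offCoef_mul_centeredProj_pow_four i j t).const_mul _

theorem integral_totalWeight_mul_sum_le (H : SampleBounds P X h B C) (j i : Fin N) :
    ∫ ω, totalWeight a i * ∑ t, |offCoef a i j t| *
      centeredProj P X h t.2 t.1 (X j ω) ^ 4 ∂P ≤ totalWeight a i ^ 2 * (16 * B ^ 2) := by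
  rw [integral_const_mul, integral_finsetSum _ fun t _ =>
    H.integrable_abs_offCoef_mul_centeredProj_pow_four i j t, pow_two, mul_assoc]
  refine mul_le_mul_of_nonneg_left ?_ (totalWeight_nonneg _ _)
  rw [totalWeight, Finset.sum_mul]
  exact Finset.sum_le_sum fun t _ => H.integral_abs_offCoef_mul_centeredProj_pow_four_le i j t

theorem memLp_sum_offOne_sq (H : SampleBounds P X h B C) (j : Fin N) :
    MemLp (fun ω => ∑ i, offOne P X a h i j (X j ω) ^ 2) 2 P := by
  have hmeas := (H.measurable_sum_offOne_sq (a := a) j).comp (H.measurable_sample j)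
  refine (memLp_two_iff_integrable_sq hmeas.aestronglyMeasurable).2 ?_
  refine ((integrable_finsetSum Finset.univ fun i _ =>
      H.integrable_totalWeight_mul_sum (a := a) j i).const_mul
    (∑ i, totalWeight a i ^ 2)).mono' (hmeas.pow_const 2).aestronglyMeasurable
    (.of_forall fun ω => ?_)
  rw [Real.norm_eq_abs, abs_of_nonneg (sq_nonneg _)]
  exact sq_sum_offOne_sq_le j (X j ω)

theorem integral_sq_sum_offOne_sq_le (H : SampleBounds P X h B C) (j : Fin N) :
    ∫ ω, (∑ i, offOne P X a h i j (X j ω) ^ 2) ^ 2 ∂P ≤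
      16 * B ^ 2 * (∑ i, totalWeight a i ^ 2) ^ 2 := by
  have hint (i : Fin N) := H.integrable_totalWeight_mul_sum (a := a) j i
  refine (integral_mono (H.memLp_sum_offOne_sq j).integrable_sq
    ((integrable_finsetSum _ fun i _ => hint i).const_mul _)
    fun ω => sq_sum_offOne_sq_le j (X j ω)).trans ?_
  rw [integral_const_mul, integral_finsetSum _ fun i _ => hint i]
  calc _ ≤ (∑ i, totalWeight a i ^ 2) * ∑ i, totalWeight a i ^ 2 * (16 * B ^ 2) := by
        gcongr with i
        exact H.integral_totalWeight_mul_sum_le j i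
    _ = _ := by rw [← Finset.sum_mul]; ring

theorem memLp_sum_sum_offOne_sq (H : SampleBounds P X h B C) :
    MemLp (fun ω => ∑ j, ∑ i, offOne P X a h i j (X j ω) ^ 2) 2 P :=
  memLp_finsetSum _ fun j _ => H.memLp_sum_offOne_sq j

theorem variance_sum_sum_offOne_sq_le (H : SampleBounds P X h B C) :
    variance (fun ω => ∑ j, ∑ i, offOne P X a h i j (X j ω) ^ 2) P ≤
      N * (16 * B ^ 2 * (∑ i, totalWeight a i ^ 2) ^ 2) := by
  have variance_eq := IndepFun.variance_sum (s := Finset.univ)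
    (fun j _ => H.memLp_sum_offOne_sq (a := a) j) fun i _ j _ hij =>
      (H.indep.indepFun hij).comp (H.measurable_sum_offOne_sq i) (H.measurable_sum_offOne_sq j)
  rw [Finset.sum_fn] at variance_eq
  rw [variance_eq]
  refine (Finset.sum_le_card_nsmul _ _ (16 * B ^ 2 * (∑ i, totalWeight a i ^ 2) ^ 2)
    fun j _ => ?_).trans_eq (by rw [Finset.card_fin, nsmul_eq_mul])
  exact (variance_le_expectation_sq (H.memLp_sum_offOne_sq j).aestronglyMeasurable).trans
    (H.integral_sq_sum_offOne_sq_le j)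

end SampleBounds

end Variance

section Convergence

theorem abs_sq_sub_sq_le (x y : ℝ) {δ : ℝ} (hδ : 0 < δ) :
    |x ^ 2 - y ^ 2| ≤ δ * y ^ 2 + (δ⁻¹ + 1) * (x - y) ^ 2 := by
  have young : |2 * y * (x - y)| ≤ δ * y ^ 2 + δ⁻¹ * (x - y) ^ 2 := by
    have expand (s : ℝ) : 0 ≤ δ * y ^ 2 + 2 * s * y * (x - y) + δ⁻¹ * (s * (x - y)) ^ 2 := by
      have hsq : δ * (y + δ⁻¹ * (s * (x - y))) ^ 2 =
          δ * y ^ 2 + 2 * s * y * (x - y) + δ⁻¹ * (s * (x - y)) ^ 2 := by field_simp; ring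
      exact hsq ▸ by positivity
    rw [abs_le]
    constructor <;> linarith [expand 1, expand (-1)]
  calc |x ^ 2 - y ^ 2| = |2 * y * (x - y) + (x - y) ^ 2| := by ring_nf
    _ ≤ |2 * y * (x - y)| + (x - y) ^ 2 :=
        (abs_add_le _ _).trans_eq (by rw [abs_of_nonneg (sq_nonneg (x - y))])
    _ ≤ _ := by linarith

theorem abs_mul_sum_sq_sub_le {ι : Type*} [Fintype ι] (x y : ι → ℝ) {κ δ : ℝ} (hκ : 0 ≤ κ)
    (hδ : 0 < δ) : |κ * ∑ t, x t ^ 2 - κ * ∑ t, y t ^ 2| ≤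
      δ * (κ * ∑ t, y t ^ 2) + (δ⁻¹ + 1) * (κ * ∑ t, (x t - y t) ^ 2) := by
  have hsum : |∑ t, (x t ^ 2 - y t ^ 2)| ≤
      ∑ t, (δ * y t ^ 2 + (δ⁻¹ + 1) * (x t - y t) ^ 2) :=
    (Finset.abs_sum_le_sum_abs _ _).trans
      (Finset.sum_le_sum fun t _ => abs_sq_sub_sq_le (x t) (y t) hδ)
  rw [← mul_sub, abs_mul, abs_of_nonneg hκ, ← Finset.sum_sub_distrib]
  refine (mul_le_mul_of_nonneg_left hsum hκ).trans_eq ?_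
  rw [Finset.sum_add_distrib, ← Finset.mul_sum, ← Finset.mul_sum]
  ring

theorem tendsto_zero_of_forall_eventually_le {u v w : ℕ → ℝ} {c : ℝ} (hu : ∀ n, 0 ≤ u n)
    (hv : Tendsto v atTop (𝓝 c)) (hw : Tendsto w atTop (𝓝 0))
    (hle : ∀ δ, 0 < δ → ∀ᶠ n in atTop, u n ≤ δ * v n + (δ⁻¹ + 1) * w n) :
    Tendsto u atTop (𝓝 0) := by
  refine tendsto_order.2 ⟨fun ε hε => .of_forall fun n => hε.trans_le (hu n), fun ε hε => ?_⟩
  obtain ⟨δ, hδ, hδε⟩ : ∃ δ, 0 < δ ∧ δ * c < ε := by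
    refine ⟨ε / (2 * (|c| + 1)), by positivity, ?_⟩
    rw [div_mul_eq_mul_div, div_lt_iff₀ (by positivity)]
    nlinarith [le_abs_self c, abs_nonneg c]
  have hlim : Tendsto (fun n => δ * v n + (δ⁻¹ + 1) * w n) atTop (𝓝 (δ * c)) := by
    simpa using (hv.const_mul δ).add (hw.const_mul (δ⁻¹ + 1))
  filter_upwards [hle δ hδ, hlim.eventually_lt_const hδε] with n h1 h2
  exact h1.trans_lt h2

theorem integral_abs_sub_le_sqrt_variance {α : Type*} [MeasurableSpace α] {μ : Measure α}
    [IsProbabilityMeasure μ] {f : α → ℝ} (hf : MemLp f 2 μ) :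
    ∫ x, |f x - ∫ y, f y ∂μ| ∂μ ≤ √(variance f μ) := by
  have hsub : MemLp (fun x => f x - ∫ y, f y ∂μ) 2 μ := hf.sub (memLp_const _)
  refine Real.le_sqrt_of_sq_le ?_
  rw [variance_eq_integral hf.aestronglyMeasurable.aemeasurable]
  simpa only [Real.norm_eq_abs, sq_abs] using even_pow_integral_le (μ := μ) even_two two_ne_zero
    hsub.aestronglyMeasurable.norm (by simpa using hsub.integrable_sq)

variable {Ω : ℕ → Type*} [∀ n, MeasurableSpace (Ω n)] {P : ∀ n, Measure (Ω n)}
  {Y Z W : ∀ n, Ω n → ℝ} {c d : ℝ}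

/-- Convergence in mean (in `L¹`) of random variables on varying probability spaces to a constant;
finitely many of the variables may fail to be integrable. -/
def TendstoInMean (P : ∀ n, Measure (Ω n)) (Y : ∀ n, Ω n → ℝ) (c : ℝ) : Prop :=
  (∀ᶠ n in atTop, Integrable (Y n) (P n)) ∧
    Tendsto (fun n => ∫ ω, |Y n ω - c| ∂P n) atTop (𝓝 0)

theorem TendstoInProb.of_abs_sub_lt (hZ : TendstoInProb P Z c) (hW : TendstoInProb P W d)
    {e : ℝ} (hlt : ∀ ε, 0 < ε → ∃ η, 0 < η ∧ ∃ η', 0 < η' ∧ ∀ n ω,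
      |Z n ω - c| < η → |W n ω - d| < η' → |Y n ω - e| < ε) : TendstoInProb P Y e := by
  intro ε hε
  obtain ⟨η, hη, η', hη', hlt⟩ := hlt ε hε
  have hlim := (hZ η hη).add (hW η' hη')
  rw [add_zero] at hlim
  refine tendsto_of_tendsto_of_tendsto_of_le_of_le tendsto_const_nhds hlim (fun _ => zero_le)
    fun n => (measure_mono fun ω hω => ?_).trans (measure_union_le _ _)
  by_contra hcon
  simp only [Set.mem_union, Set.mem_ofPred_eq, not_or, not_le] at hcon
  exact absurd hω (not_le.2 (hlt n ω hcon.1 hcon.2))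

section SumSq

variable {ι : ℕ → Type*} [∀ n, Fintype (ι n)] {A G : ∀ n, ι n → Ω n → ℝ} {κ : ℕ → ℝ}

theorem TendstoInProb.mul_sum_sq (hκ : ∀ n, 0 ≤ κ n)
    (hA : TendstoInProb P (fun n ω => κ n * ∑ t, A n t ω ^ 2) c)
    (hGA : TendstoInProb P (fun n ω => κ n * ∑ t, (G n t ω - A n t ω) ^ 2) 0) :
    TendstoInProb P (fun n ω => κ n * ∑ t, G n t ω ^ 2) c := by
  refine hA.of_abs_sub_lt hGA fun ε hε => ?_
  have hδ : 0 < ε / (4 * (|c| + 1)) := by positivity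
  refine ⟨min (ε / 4) 1, by positivity, ε / 4 / ((ε / (4 * (|c| + 1)))⁻¹ + 1), by positivity,
    fun n ω hnear hclose => ?_⟩
  have hnonneg : 0 ≤ κ n * ∑ t, (G n t ω - A n t ω) ^ 2 :=
    mul_nonneg (hκ n) (Finset.sum_nonneg fun t _ => sq_nonneg _)
  rw [sub_zero, abs_of_nonneg hnonneg, lt_div_iff₀' (by positivity)] at hclose
  obtain ⟨hnear, hbdd⟩ := lt_min_iff.1 hnear
  have hA_lt : κ n * ∑ t, A n t ω ^ 2 < |c| + 1 := by
    linarith [le_abs_self (κ n * ∑ t, A n t ω ^ 2 - c), le_abs_self c]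
  have small : ε / (4 * (|c| + 1)) * (κ n * ∑ t, A n t ω ^ 2) < ε / 4 := by
    rw [div_mul_eq_mul_div, div_lt_iff₀ (by positivity)]
    nlinarith
  have hdiff := abs_mul_sum_sq_sub_le (fun t => G n t ω) (fun t => A n t ω) (hκ n) hδ
  have htri := abs_sub_le (κ n * ∑ t, G n t ω ^ 2) (κ n * ∑ t, A n t ω ^ 2) c
  linarith

end SumSq

namespace TendstoInMean

theorem tendstoInProb [∀ n, IsFiniteMeasure (P n)] (hY : TendstoInMean P Y c) :
    TendstoInProb P Y c := by
  intro ε hε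
  have hlim : Tendsto (fun n => ENNReal.ofReal (ε⁻¹ * ∫ ω, |Y n ω - c| ∂P n)) atTop (𝓝 0) := by
    simpa using ENNReal.tendsto_ofReal (hY.2.const_mul ε⁻¹)
  refine tendsto_of_tendsto_of_tendsto_of_le_of_le' tendsto_const_nhds hlim
    (.of_forall fun _ => zero_le) ?_
  filter_upwards [hY.1] with n hn
  rw [← ofReal_measureReal]
  refine ENNReal.ofReal_le_ofReal ?_
  rw [inv_mul_eq_div, le_div_iff₀ hε, mul_comm]
  exact mul_meas_ge_le_integral_of_nonneg (.of_forall fun ω => abs_nonneg _)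
    (hn.sub (integrable_const c)).abs ε

theorem tendsto_integral [∀ n, IsProbabilityMeasure (P n)] (hY : TendstoInMean P Y c) :
    Tendsto (fun n => ∫ ω, Y n ω ∂P n) atTop (𝓝 c) := by
  rw [tendsto_iff_norm_sub_tendsto_zero]
  refine squeeze_zero' (.of_forall fun _ => norm_nonneg _) ?_ hY.2
  filter_upwards [hY.1] with n hn
  calc ‖∫ ω, Y n ω ∂P n - c‖ = ‖∫ ω, (Y n ω - c) ∂P n‖ := by
        rw [integral_sub hn (integrable_const c), integral_const, probReal_univ, one_smul]
    _ ≤ ∫ ω, |Y n ω - c| ∂P n := norm_integral_le_integral_norm _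

theorem of_integral_abs_sub [∀ n, IsFiniteMeasure (P n)] (hY : TendstoInMean P Y c)
    (hZ : ∀ᶠ n in atTop, Integrable (Z n) (P n))
    (hZY : Tendsto (fun n => ∫ ω, |Z n ω - Y n ω| ∂P n) atTop (𝓝 0)) : TendstoInMean P Z c := by
  refine ⟨hZ, squeeze_zero' (.of_forall fun n => integral_nonneg fun ω => abs_nonneg _) ?_
    (by simpa using hZY.add hY.2)⟩
  filter_upwards [hY.1, hZ] with n hYn hZn
  have hsub : Integrable (fun ω => |Z n ω - Y n ω|) (P n) := (hZn.sub hYn).abs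
  have hsub' : Integrable (fun ω => |Y n ω - c|) (P n) := (hYn.sub (integrable_const c)).abs
  rw [← integral_add hsub hsub']
  exact integral_mono (hZn.sub (integrable_const c)).abs (hsub.add hsub')
    fun ω => abs_sub_le _ _ _

section SumSq

variable {ι : ℕ → Type*} [∀ n, Fintype (ι n)] {A G : ∀ n, ι n → Ω n → ℝ} {κ : ℕ → ℝ}

theorem mul_sum_sq_zero (hκ : ∀ n, 0 ≤ κ n) (hA : ∀ᶠ n in atTop, ∀ t, MemLp (A n t) 2 (P n))
    (hlim : Tendsto (fun n => κ n * ∑ t, ∫ ω, A n t ω ^ 2 ∂P n) atTop (𝓝 0)) :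
    TendstoInMean P (fun n ω => κ n * ∑ t, A n t ω ^ 2) 0 := by
  refine ⟨hA.mono fun n hn => (integrable_finsetSum _ fun t _ => (hn t).integrable_sq).const_mul _,
    hlim.congr' (hA.mono fun n hn => ?_)⟩
  rw [← integral_finsetSum _ fun t _ => (hn t).integrable_sq, ← integral_const_mul]
  refine integral_congr_ae (.of_forall fun ω => ?_)
  simp only [sub_zero]
  rw [abs_of_nonneg (mul_nonneg (hκ n) (Finset.sum_nonneg fun t _ => sq_nonneg _))]

theorem mul_sum_sq [∀ n, IsProbabilityMeasure (P n)] (hκ : ∀ n, 0 ≤ κ n)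
    (hA : TendstoInMean P (fun n ω => κ n * ∑ t, A n t ω ^ 2) c)
    (hG : ∀ᶠ n in atTop, ∀ t, MemLp (G n t) 2 (P n))
    (hGA : TendstoInMean P (fun n ω => κ n * ∑ t, (G n t ω - A n t ω) ^ 2) 0) :
    TendstoInMean P (fun n ω => κ n * ∑ t, G n t ω ^ 2) c := by
  have hint : ∀ᶠ n in atTop, Integrable (fun ω => κ n * ∑ t, G n t ω ^ 2) (P n) := hG.mono
    fun n hn => (integrable_finsetSum _ fun t _ => (hn t).integrable_sq).const_mul _
  refine hA.of_integral_abs_sub hint (tendsto_zero_of_forall_eventually_le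
    (fun n => integral_nonneg fun ω => abs_nonneg _) hA.tendsto_integral hGA.tendsto_integral
    fun δ hδ => ?_)
  filter_upwards [hA.1, hint, hGA.1] with n hAn hGn hGAn
  rw [← integral_const_mul, ← integral_const_mul,
    ← integral_add (hAn.const_mul δ) (hGAn.const_mul (δ⁻¹ + 1))]
  exact integral_mono (hGn.sub hAn).abs ((hAn.const_mul δ).add (hGAn.const_mul (δ⁻¹ + 1)))
    fun ω => abs_mul_sum_sq_sub_le _ _ (hκ n) hδ

end SumSq

end TendstoInMean

variable [∀ n, IsProbabilityMeasure (P n)]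

theorem TendstoInProb.tendsto_of_sub (hY : TendstoInProb P Y c) {g : ℕ → ℝ}
    (hYg : TendstoInProb P (fun n ω => Y n ω - g n) 0) : Tendsto g atTop (𝓝 c) := by
  have hconst : TendstoInProb P (fun n _ => g n) c := hY.of_abs_sub_lt hYg fun ε hε =>
    ⟨ε / 2, by positivity, ε / 2, by positivity, fun n ω h1 h2 => by
      have htri := abs_sub_le (g n) (Y n ω) c
      rw [abs_sub_comm (g n) (Y n ω)] at htri
      rw [sub_zero] at h2
      linarith⟩
  refine Metric.tendsto_nhds.2 fun ε hε => ?_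
  filter_upwards [(hconst ε hε).eventually_lt_const one_pos] with n hn
  by_contra hge
  rw [Real.dist_eq, not_lt] at hge
  simp [hge] at hn

theorem TendstoInProb.tendstoInMean_of_variance (hY : TendstoInProb P Y c)
    (hLp : ∀ᶠ n in atTop, MemLp (Y n) 2 (P n))
    (hvar : Tendsto (fun n => variance (Y n) (P n)) atTop (𝓝 0)) : TendstoInMean P Y c := by
  have hint : ∀ᶠ n in atTop, Integrable (Y n) (P n) :=
    hLp.mono fun n hn => hn.integrable one_le_two
  have hdev : TendstoInMean P (fun n ω => Y n ω - ∫ ω, Y n ω ∂P n) 0 := by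
    refine ⟨hint.mono fun n hn => hn.sub (integrable_const _), ?_⟩
    simp only [sub_zero]
    exact squeeze_zero' (.of_forall fun n => integral_nonneg fun ω => abs_nonneg _)
      (hLp.mono fun n hn => integral_abs_sub_le_sqrt_variance hn) (by simpa using hvar.sqrt)
  have hmean := hY.tendsto_of_sub hdev.tendstoInProb
  have hconst : TendstoInMean P (fun n _ => ∫ ω, Y n ω ∂P n) c :=
    ⟨.of_forall fun n => integrable_const _, by
      simpa using (tendsto_iff_norm_sub_tendsto_zero.1 hmean)⟩
  exact hconst.of_integral_abs_sub hint (by simpa using hdev.2)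

end Convergence

section PowerSums

variable {ι : Type*} [Fintype ι] {x : ι → ℝ}

theorem sum_sq_pow_three_le (hx : ∀ i, 0 ≤ x i) :
    (∑ i, x i ^ 2) ^ 3 ≤ Fintype.card ι * (∑ i, x i ^ 3) ^ 2 := by
  have cauchy : (∑ i, x i ^ 2) ^ 2 ≤ (∑ i, x i) * ∑ i, x i ^ 3 :=
    Finset.sum_sq_le_sum_mul_sum_of_sq_le_mul _ (fun i _ => hx i)
      (fun i _ => pow_nonneg (hx i) 3) fun i _ => le_of_eq (by ring)
  have sq_sum_le : (∑ i, x i) ^ 2 ≤ Fintype.card ι * ∑ i, x i ^ 2 :=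
    sq_sum_le_card_mul_sum_sq
  rcases (Finset.sum_nonneg fun i _ => sq_nonneg (x i)).eq_or_lt with hzero | hpos
  · rw [← hzero, zero_pow three_ne_zero]
    positivity
  · refine le_of_mul_le_mul_left ?_ hpos
    calc (∑ i, x i ^ 2) * (∑ i, x i ^ 2) ^ 3 = ((∑ i, x i ^ 2) ^ 2) ^ 2 := by ring
      _ ≤ ((∑ i, x i) * ∑ i, x i ^ 3) ^ 2 := pow_le_pow_left₀ (sq_nonneg _) cauchy 2
      _ = (∑ i, x i) ^ 2 * (∑ i, x i ^ 3) ^ 2 := by ring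
      _ ≤ (Fintype.card ι * ∑ i, x i ^ 2) * (∑ i, x i ^ 3) ^ 2 :=
        mul_le_mul_of_nonneg_right sq_sum_le (sq_nonneg _)
      _ = _ := by ring

end PowerSums

section BootVarApprox

variable {𝓧 : Type*} {m N : ℕ}

theorem abs_bootVar_sub_le (hN : 0 < N) (a : (Fin m → Fin N) → ℝ) (h : (Fin m → 𝓧) → ℝ)
    (x : Fin N → 𝓧) :
    |bootVar a h x - ((N : ℝ) ^ 3)⁻¹ * ∑ i, ∑ j, bootOne a h x i j ^ 2| ≤
      ((N : ℝ) ^ 2)⁻¹ * sharedWeight a 2 2 * tupleAvg (fun y => h y ^ 2) x := by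
  rw [abs_of_nonneg (sub_nonneg.2 (inv_mul_sum_bootOne_sq_le_bootVar hN a h x)), sub_le_iff_le_add']
  exact bootVar_le_inv_mul_sum_bootOne_sq_add hN a h x

end BootVarApprox

section Rates

variable {𝓧 : Type*} [MeasurableSpace 𝓧] {m N : ℕ} {Ω : Type*} [MeasurableSpace Ω]
  {P : Measure Ω} {X : Fin N → Ω → 𝓧} {h : (Fin m → 𝓧) → ℝ}
  {B C : ℝ} {a : (Fin m → Fin N) → ℝ}

theorem measurable_bootVar (hN : 0 < N) (hh : Measurable h) : Measurable (bootVar a h) := by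
  have : NeZero N := ⟨hN.ne'⟩
  have measurable_uStat (J : Fin N → Fin N) :
      Measurable fun x : Fin N → 𝓧 => uStat a h fun k => x (J k) :=
    (Finset.measurable_sum _ fun I _ => (hh.comp (by fun_prop)).const_mul _).const_mul _
  have bootVar_eq : bootVar a h = fun x : Fin N → 𝓧 => (Fintype.card (Fin N → Fin N) : ℝ)⁻¹ *
      ∑ J : Fin N → Fin N, uStat a h (fun k => x (J k)) ^ 2 -
        ((Fintype.card (Fin N → Fin N) : ℝ)⁻¹ *
          ∑ J : Fin N → Fin N, uStat a h fun k => x (J k)) ^ 2 := by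
    ext x
    rw [bootVar, variance_eq_sub MemLp.of_discrete, integral_uniformOn_univ,
      integral_uniformOn_univ]
    rfl
  rw [bootVar_eq]
  fun_prop

namespace SampleBounds

theorem integrable_sum_sum_bootOne_sq (H : SampleBounds P X h B C) :
    Integrable (fun ω => ∑ i, ∑ j, bootOne a h (fun k => X k ω) i j ^ 2) P :=
  integrable_finsetSum _ fun i _ => integrable_finsetSum _ fun j _ =>
    (H.memLp_bootOne i j).integrable_sq

theorem integrable_tupleAvg_sq (H : SampleBounds P X h B C) :
    Integrable (fun ω => tupleAvg (fun y => h y ^ 2) fun k => X k ω) P :=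
  (integrable_finsetSum _ fun k _ => H.integrable_sq k).const_mul _

theorem integrable_bootVar (H : SampleBounds P X h B C) (hN : 0 < N) :
    Integrable (fun ω => bootVar a h fun k => X k ω) P := by
  have hmeas : Measurable fun ω => bootVar a h fun k => X k ω :=
    (measurable_bootVar hN H.measurable_kernel).comp
      (measurable_pi_lambda _ H.measurable_sample)
  have hbound : Integrable (fun ω =>
      ((N : ℝ) ^ 3)⁻¹ * ∑ i, ∑ j, bootOne a h (fun k => X k ω) i j ^ 2 +
        ((N : ℝ) ^ 2)⁻¹ * sharedWeight a 2 2 * tupleAvg (fun y => h y ^ 2) fun k => X k ω) P :=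
    (H.integrable_sum_sum_bootOne_sq.const_mul _).add (H.integrable_tupleAvg_sq.const_mul _)
  refine hbound.mono' hmeas.aestronglyMeasurable (.of_forall fun ω => ?_)
  rw [bootVar, Real.norm_of_nonneg (variance_nonneg _ _)]
  exact bootVar_le_inv_mul_sum_bootOne_sq_add hN a h fun k => X k ω

variable [IsProbabilityMeasure P]

theorem integral_abs_bootVar_sub_le (H : SampleBounds P X h B C) (hN : 0 < N) :
    ∫ ω, |bootVar a h (fun k => X k ω) -
        ((N : ℝ) ^ 3)⁻¹ * ∑ i, ∑ j, bootOne a h (fun k => X k ω) i j ^ 2| ∂P ≤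
      ((N : ℝ) ^ 2)⁻¹ * (B * sharedWeight a 2 2 +
        C * (m : ℝ) ^ 2 * (homogeneityGap P X h * sharedWeight a 2 1)) := by
  have hC := H.second_nonneg
  have hW := sharedWeight_nonneg a 2 2
  have shared_le : (N : ℝ)⁻¹ * sharedWeight a 2 2 ≤ homogeneityGap P X h * sharedWeight a 2 1 :=
    mul_le_mul inv_le_homogeneityGap (sharedWeight_two_le_one a 2) hW homogeneityGap_nonneg
  calc _ ≤ ∫ ω, ((N : ℝ) ^ 2)⁻¹ * sharedWeight a 2 2 *
        tupleAvg (fun y => h y ^ 2) (fun k => X k ω) ∂P :=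
        integral_mono ((H.integrable_bootVar hN).sub
          (H.integrable_sum_sum_bootOne_sq.const_mul _)).abs (H.integrable_tupleAvg_sq.const_mul _)
          fun ω => abs_bootVar_sub_le hN a h fun k => X k ω
    _ = ((N : ℝ) ^ 2)⁻¹ * sharedWeight a 2 2 *
        ∫ ω, tupleAvg (fun y => h y ^ 2) (fun k => X k ω) ∂P := integral_const_mul _ _
    _ ≤ ((N : ℝ) ^ 2)⁻¹ * sharedWeight a 2 2 * (B + C * (m : ℝ) ^ 2 / N) :=
        mul_le_mul_of_nonneg_left (H.integral_tupleAvg_sq_le hN) (by positivity)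
    _ = ((N : ℝ) ^ 2)⁻¹ * (B * sharedWeight a 2 2 +
        C * (m : ℝ) ^ 2 * ((N : ℝ)⁻¹ * sharedWeight a 2 2)) := by ring
    _ ≤ _ := by gcongr

theorem sum_integral_hOne_sub_offOne_sq_le_mul (H : SampleBounds P X h B C) (hN : 0 < N) :
    ∑ i, ∑ j, ∫ ω, (hOne P X a h i (X j ω) - offOne P X a h i j (X j ω)) ^ 2 ∂P ≤
      N * (4 * C * (m : ℝ) ^ 4 * (homogeneityGap P X h * sharedWeight a 2 1)) := by
  have hC := H.second_nonneg
  have hW := sharedWeight_nonneg a 2 1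
  calc _ ≤ (m : ℝ) ^ 2 * (4 * C) * ∑ i, totalWeight a i ^ 2 :=
        H.sum_integral_hOne_sub_offOne_sq_le
    _ ≤ (m : ℝ) ^ 2 * (4 * C) * ((m : ℝ) ^ 2 * sharedWeight a 2 1) :=
        mul_le_mul_of_nonneg_left (sum_totalWeight_pow_le a 1) (by positivity)
    _ = 4 * C * (m : ℝ) ^ 4 * sharedWeight a 2 1 * 1 := by ring
    _ ≤ 4 * C * (m : ℝ) ^ 4 * sharedWeight a 2 1 * (N * homogeneityGap P X h) :=
        mul_le_mul_of_nonneg_left (one_le_mul_homogeneityGap hN) (by positivity)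
    _ = _ := by ring

theorem variance_sum_sum_offOne_sq_pow_three_le (H : SampleBounds P X h B C) :
    variance (fun ω => ∑ j, ∑ i, offOne P X a h i j (X j ω) ^ 2) P ^ 3 ≤
      16 ^ 3 * (m : ℝ) ^ 12 * N ^ 5 * B ^ 6 * sharedWeight a 3 1 ^ 4 := by
  have : 0 ≤ ∑ i, totalWeight a i ^ 3 :=
    Finset.sum_nonneg fun i _ => pow_nonneg (totalWeight_nonneg a i) 3
  have : 0 ≤ ∑ i, totalWeight a i ^ 2 := Finset.sum_nonneg fun i _ => sq_nonneg _
  have sum_sq_le : (∑ i, totalWeight a i ^ 2) ^ 3 ≤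
      N * ((m : ℝ) ^ 3 * sharedWeight a 3 1) ^ 2 := by
    refine (sum_sq_pow_three_le (totalWeight_nonneg a)).trans ?_
    rw [Fintype.card_fin]
    gcongr
    exact sum_totalWeight_pow_le a 2
  calc _ ≤ (N * (16 * B ^ 2 * (∑ i, totalWeight a i ^ 2) ^ 2)) ^ 3 :=
        pow_le_pow_left₀ (variance_nonneg _ _) H.variance_sum_sum_offOne_sq_le 3
    _ = N ^ 3 * 16 ^ 3 * B ^ 6 * ((∑ i, totalWeight a i ^ 2) ^ 3) ^ 2 := by ring
    _ ≤ N ^ 3 * 16 ^ 3 * B ^ 6 * (N * ((m : ℝ) ^ 3 * sharedWeight a 3 1) ^ 2) ^ 2 := by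
        have := H.fourth_nonneg
        gcongr
    _ = _ := by ring

end SampleBounds

end Rates

section Scale

variable {𝓧 Ω : Type*} [MeasurableSpace Ω] {m N : ℕ} {P : Measure Ω} {X : Fin N → Ω → 𝓧}
  {a : (Fin m → Fin N) → ℝ} {h : (Fin m → 𝓧) → ℝ}

/-- The factor `κ` for which `κ ∑ᵢ ∑ⱼ h_{1,i}(X_j)²` is of order one: `1 / (N³ σ²)`. -/
noncomputable def bootScale (P : Measure Ω) (X : Fin N → Ω → 𝓧) (a : (Fin m → Fin N) → ℝ)
    (h : (Fin m → 𝓧) → ℝ) : ℝ :=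
  ((N : ℝ) ^ 3 * uVar P X a h)⁻¹

theorem bootScale_nonneg : 0 ≤ bootScale P X a h :=
  inv_nonneg.2 (mul_nonneg (by positivity) (variance_nonneg _ _))

end Scale

section Consistency

variable {𝓧 : Type*} [MeasurableSpace 𝓧] {m : ℕ} {Ω : ℕ → Type*} [∀ n, MeasurableSpace (Ω n)]

/-- The rates under which the bootstrap variance of a sequence of samples is consistent, in terms
of the moment bounds `B` and `C` and of the unnormalised weights `sharedWeight`. -/
structure ConsistencyRates (P : ∀ n, Measure (Ω n)) (N : ℕ → ℕ) (X : ∀ n, Fin (N n) → Ω n → 𝓧)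
    (a : ∀ n, (Fin m → Fin (N n)) → ℝ) (h : ℕ → (Fin m → 𝓧) → ℝ) (B : ℕ → ℝ) (C : ℝ) : Prop where
  sampleBounds : ∀ᶠ n in atTop, SampleBounds (P n) (X n) (h n) (B n) C
  size_pos : ∀ᶠ n in atTop, 0 < N n
  uVar_pos : ∀ᶠ n in atTop, 0 < uVar (P n) (X n) (a n) (h n)
  homogeneity : TendstoInProb P (fun n ω => bootScale (P n) (X n) (a n) (h n) *
    ∑ i, ∑ j, hOne (P n) (X n) (a n) (h n) i (X n j ω) ^ 2) 1
  gap_rate : Tendsto (fun n => bootScale (P n) (X n) (a n) (h n) *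
    (N n * (homogeneityGap (P n) (X n) (h n) * sharedWeight (a n) 2 1))) atTop (𝓝 0)
  pair_rate : Tendsto (fun n => bootScale (P n) (X n) (a n) (h n) *
    (N n * (B n * sharedWeight (a n) 2 2))) atTop (𝓝 0)
  triple_rate : Tendsto (fun n => bootScale (P n) (X n) (a n) (h n) ^ 6 *
    ((N n : ℝ) ^ 5 * B n ^ 6 * sharedWeight (a n) 3 1 ^ 4)) atTop (𝓝 0)

theorem tendsto_zero_of_pow {u : ℕ → ℝ} {k : ℕ} (hk : k ≠ 0) (hu : ∀ n, 0 ≤ u n)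
    (hlim : Tendsto (fun n => u n ^ k) atTop (𝓝 0)) : Tendsto u atTop (𝓝 0) := by
  have hroot := hlim.rpow_const (p := (k : ℝ)⁻¹) (.inr (by positivity))
  rw [Real.zero_rpow (by positivity)] at hroot
  exact hroot.congr fun n => Real.pow_rpow_inv_natCast (hu n) hk

namespace ConsistencyRates

variable {P : ∀ n, Measure (Ω n)} [∀ n, IsProbabilityMeasure (P n)] {N : ℕ → ℕ}
  {X : ∀ n, Fin (N n) → Ω n → 𝓧} {a : ∀ n, (Fin m → Fin (N n)) → ℝ}
  {h : ℕ → (Fin m → 𝓧) → ℝ} {B : ℕ → ℝ} {C : ℝ}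

theorem tendstoInMean_sum_hOne_sub_offOne_sq (H : ConsistencyRates P N X a h B C) :
    TendstoInMean P (fun n ω => bootScale (P n) (X n) (a n) (h n) *
      ∑ t : Fin (N n) × Fin (N n), (hOne (P n) (X n) (a n) (h n) t.1 (X n t.2 ω) -
        offOne (P n) (X n) (a n) (h n) t.1 t.2 (X n t.2 ω)) ^ 2) 0 := by
  refine TendstoInMean.mul_sum_sq_zero (fun n => bootScale_nonneg)
    (H.sampleBounds.mono fun n hn t => (hn.memLp_hOne t.1 t.2).sub (hn.memLp_offOne t.1 t.2)) ?_
  refine squeeze_zero' (.of_forall fun n => mul_nonneg bootScale_nonneg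
    (Finset.sum_nonneg fun t _ => integral_nonneg fun ω => sq_nonneg _)) ?_
    (by simpa using H.gap_rate.const_mul (4 * C * (m : ℝ) ^ 4))
  filter_upwards [H.sampleBounds, H.size_pos] with n hn hpos
  rw [Fintype.sum_prod_type]
  exact (mul_le_mul_of_nonneg_left (hn.sum_integral_hOne_sub_offOne_sq_le_mul hpos)
    bootScale_nonneg).trans_eq (by ring)

theorem tendstoInMean_sum_bootOne_sub_hOne_sq (H : ConsistencyRates P N X a h B C) :
    TendstoInMean P (fun n ω => bootScale (P n) (X n) (a n) (h n) *
      ∑ t : Fin (N n) × Fin (N n), (bootOne (a n) (h n) (fun k => X n k ω) t.1 t.2 -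
        hOne (P n) (X n) (a n) (h n) t.1 (X n t.2 ω)) ^ 2) 0 := by
  refine TendstoInMean.mul_sum_sq_zero (fun n => bootScale_nonneg)
    (H.sampleBounds.mono fun n hn t => (hn.memLp_bootOne t.1 t.2).sub (hn.memLp_hOne t.1 t.2)) ?_
  refine squeeze_zero' (.of_forall fun n => mul_nonneg bootScale_nonneg
    (Finset.sum_nonneg fun t _ => integral_nonneg fun ω => sq_nonneg _)) ?_
    (by
      simpa using (H.gap_rate.const_mul ((m : ℝ) ^ 2 * (10 + 224 * C * m ^ 2))).add
        (H.pair_rate.const_mul (16 * (m : ℝ) ^ 2)))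
  filter_upwards [H.sampleBounds, H.size_pos] with n hn hpos
  rw [Fintype.sum_prod_type]
  exact (mul_le_mul_of_nonneg_left (hn.sum_integral_bootOne_sub_hOne_sq_le hpos)
    bootScale_nonneg).trans_eq (by ring)

theorem tendstoInProb_sum_offOne_sq (H : ConsistencyRates P N X a h B C) :
    TendstoInProb P (fun n ω => bootScale (P n) (X n) (a n) (h n) *
      ∑ t : Fin (N n) × Fin (N n), offOne (P n) (X n) (a n) (h n) t.1 t.2 (X n t.2 ω) ^ 2) 1 := by
  have hclose := H.tendstoInMean_sum_hOne_sub_offOne_sq.tendstoInProb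
  simp only [sub_sq_comm (hOne _ _ _ _ _ _)] at hclose
  refine TendstoInProb.mul_sum_sq (fun n => bootScale_nonneg) ?_ hclose
  simpa only [Fintype.sum_prod_type] using H.homogeneity

theorem tendsto_variance_sum_offOne_sq (H : ConsistencyRates P N X a h B C) :
    Tendsto (fun n => variance (fun ω => bootScale (P n) (X n) (a n) (h n) *
      ∑ t : Fin (N n) × Fin (N n),
        offOne (P n) (X n) (a n) (h n) t.1 t.2 (X n t.2 ω) ^ 2) (P n)) atTop (𝓝 0) := by
  refine tendsto_zero_of_pow three_ne_zero (fun n => variance_nonneg _ _) ?_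
  refine squeeze_zero' (.of_forall fun n => pow_nonneg (variance_nonneg _ _) 3) ?_
    (by simpa using H.triple_rate.const_mul (16 ^ 3 * (m : ℝ) ^ 12))
  filter_upwards [H.sampleBounds] with n hn
  simp only [Fintype.sum_prod_type_right]
  rw [variance_const_mul, mul_pow, ← pow_mul]
  exact (mul_le_mul_of_nonneg_left hn.variance_sum_sum_offOne_sq_pow_three_le
    (pow_nonneg bootScale_nonneg 6)).trans_eq (by ring)

theorem tendstoInMean_sum_offOne_sq (H : ConsistencyRates P N X a h B C) :
    TendstoInMean P (fun n ω => bootScale (P n) (X n) (a n) (h n) *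
      ∑ t : Fin (N n) × Fin (N n), offOne (P n) (X n) (a n) (h n) t.1 t.2 (X n t.2 ω) ^ 2) 1 := by
  refine H.tendstoInProb_sum_offOne_sq.tendstoInMean_of_variance ?_
    H.tendsto_variance_sum_offOne_sq
  filter_upwards [H.sampleBounds] with n hn
  simp only [Fintype.sum_prod_type_right]
  exact hn.memLp_sum_sum_offOne_sq.const_mul _

theorem tendstoInMean_sum_bootOne_sq (H : ConsistencyRates P N X a h B C) :
    TendstoInMean P (fun n ω => bootScale (P n) (X n) (a n) (h n) *
      ∑ t : Fin (N n) × Fin (N n), bootOne (a n) (h n) (fun k => X n k ω) t.1 t.2 ^ 2) 1 :=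
  have sum_hOne_sq := H.tendstoInMean_sum_offOne_sq.mul_sum_sq (fun _ => bootScale_nonneg)
    (H.sampleBounds.mono fun _ hn t => hn.memLp_hOne t.1 t.2)
    H.tendstoInMean_sum_hOne_sub_offOne_sq
  sum_hOne_sq.mul_sum_sq (fun _ => bootScale_nonneg)
    (H.sampleBounds.mono fun _ hn t => hn.memLp_bootOne t.1 t.2)
    H.tendstoInMean_sum_bootOne_sub_hOne_sq

theorem tendstoInMean_bootVar_div_uVar (H : ConsistencyRates P N X a h B C) :
    TendstoInMean P (fun n ω => bootVar (a n) (h n) (fun k => X n k ω) /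
      uVar (P n) (X n) (a n) (h n)) 1 := by
  refine H.tendstoInMean_sum_bootOne_sq.of_integral_abs_sub ?_ ?_
  · filter_upwards [H.sampleBounds, H.size_pos] with n hn hpos
    exact (hn.integrable_bootVar hpos).div_const _
  refine squeeze_zero' (.of_forall fun n => integral_nonneg fun ω => abs_nonneg _) ?_
    (by simpa using H.pair_rate.add (H.gap_rate.const_mul (C * (m : ℝ) ^ 2)))
  filter_upwards [H.sampleBounds, H.size_pos, H.uVar_pos] with n hn hpos hτ
  have scaled (v S : ℝ) : v / uVar (P n) (X n) (a n) (h n) -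
      bootScale (P n) (X n) (a n) (h n) * S =
        (uVar (P n) (X n) (a n) (h n))⁻¹ * (v - ((N n : ℝ) ^ 3)⁻¹ * S) := by
    rw [bootScale, mul_inv]
    ring
  calc _ = ∫ ω, (uVar (P n) (X n) (a n) (h n))⁻¹ *
        |bootVar (a n) (h n) (fun k => X n k ω) - ((N n : ℝ) ^ 3)⁻¹ *
          ∑ i, ∑ j, bootOne (a n) (h n) (fun k => X n k ω) i j ^ 2| ∂P n := by
        simp only [scaled, abs_mul, abs_of_pos (inv_pos.2 hτ), Fintype.sum_prod_type]
    _ ≤ (uVar (P n) (X n) (a n) (h n))⁻¹ * _ :=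
        (integral_const_mul _ _).trans_le (mul_le_mul_of_nonneg_left
          (hn.integral_abs_bootVar_sub_le hpos) (inv_nonneg.2 hτ.le))
    _ = _ := by rw [bootScale]; field_simp

end ConsistencyRates

end Consistency

section GapRate

variable {𝓧 Ω : Type*} [MeasurableSpace 𝓧] [MeasurableSpace Ω] {m N : ℕ} {P : Measure Ω}
  {X : Fin N → Ω → 𝓧} {a : (Fin m → Fin N) → ℝ} {h : (Fin m → 𝓧) → ℝ}

theorem bootScale_mul_gap_le (hm : 1 ≤ m) (hN : 2 * m ≤ N) :
    bootScale P X a h * (N * (homogeneityGap P X h * sharedWeight a 2 1)) ≤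
      (2 ^ (m - 1) * m) ^ 2 *
        ((N : ℝ)⁻¹ * (uVar P X a h)⁻¹ * avgWeight a 2 1 * homogeneityGap P X h) := by
  have hN' : (N : ℝ) ≠ 0 := by norm_cast; omega
  calc _ ≤ bootScale P X a h * (N * (homogeneityGap P X h *
        ((2 ^ (m - 1) * m) ^ 2 * N * avgWeight a 2 1))) := by
        gcongr
        exacts [bootScale_nonneg, homogeneityGap_nonneg, sharedWeight_one_le hm hN a 1]
    _ = _ := by
        rw [bootScale, mul_inv]
        field_simp

end GapRate

section RateBounds

variable {𝓧 Ω : Type*} [MeasurableSpace Ω] {m N : ℕ} {P : Measure Ω}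
  {X : Fin N → Ω → 𝓧} {a : (Fin m → Fin N) → ℝ} {h : (Fin m → 𝓧) → ℝ} {M V : ℝ}

theorem bootScale_mul_pair_le (hm : 1 ≤ m) (hN : 2 * m ≤ N) (hV : 0 < V)
    (hle : V ≤ uVar P X a h) :
    bootScale P X a h * (N * (√M * sharedWeight a 2 2)) ≤ (2 ^ (m - 1)) ^ 2 * m ^ 4 *
      ((N : ℝ) ^ (-2 : ℝ) * V ^ (-1 : ℝ) * avgWeight a 2 2 * M ^ (1 / 2 : ℝ)) := by
  have hN' : (N : ℝ) ≠ 0 := by norm_cast; omega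
  have := sharedWeight_nonneg a 2 2
  calc _ ≤ ((N : ℝ) ^ 3 * V)⁻¹ *
        (N * (√M * ((2 ^ (m - 1)) ^ 2 * m ^ 4 * avgWeight a 2 2))) := by
        rw [bootScale]
        gcongr
        exact sharedWeight_two_le hm hN a
    _ = _ := by
        rw [← Real.sqrt_eq_rpow, Real.rpow_neg_one, Real.rpow_neg (Nat.cast_nonneg N),
          Real.rpow_two]
        field_simp

theorem rpow_neg_three_halves_pow_four {x : ℝ} (hx : 0 ≤ x) :
    (x ^ (-3 / 2 : ℝ)) ^ 4 = (x ^ 6)⁻¹ := by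
  rw [← Real.rpow_mul_natCast hx, ← Real.rpow_natCast x 6, ← Real.rpow_neg hx]
  norm_num

theorem rpow_three_quarters_pow_four {x : ℝ} (hx : 0 ≤ x) :
    (x ^ (3 / 4 : ℝ)) ^ 4 = √x ^ 6 := by
  rw [Real.sqrt_eq_rpow, ← Real.rpow_mul_natCast hx, ← Real.rpow_mul_natCast hx]
  norm_num

theorem bootScale_pow_six_mul_le (hm : 1 ≤ m) (hN : 2 * m ≤ N) (hM : 0 ≤ M) (hV : 0 < V)
    (hle : V ≤ uVar P X a h) :
    bootScale P X a h ^ 6 * ((N : ℝ) ^ 5 * √M ^ 6 * sharedWeight a 3 1 ^ 4) ≤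
      ((2 ^ (m - 1) * m) ^ 3) ^ 4 * ((N : ℝ)⁻¹ * ((N : ℝ) ^ (-2 : ℝ) * V ^ (-3 / 2 : ℝ) *
        avgWeight a 3 1 * M ^ (3 / 4 : ℝ)) ^ 4) := by
  have hN' : (N : ℝ) ≠ 0 := by norm_cast; omega
  have := sharedWeight_nonneg a 3 1
  have : 0 < uVar P X a h := hV.trans_le hle
  calc _ ≤ (((N : ℝ) ^ 3 * V)⁻¹) ^ 6 * ((N : ℝ) ^ 5 * √M ^ 6 *
        ((2 ^ (m - 1) * m) ^ 3 * N * avgWeight a 3 1) ^ 4) := by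
        rw [bootScale]
        gcongr
        exact sharedWeight_one_le hm hN a 2
    _ = _ := by
        simp only [mul_pow _ _ 4, rpow_neg_three_halves_pow_four hV.le,
          rpow_three_quarters_pow_four hM, Real.rpow_neg (Nat.cast_nonneg N), Real.rpow_two]
        field_simp

end RateBounds

section Conditions

variable {𝓧 : Type*} [MeasurableSpace 𝓧] {m : ℕ} {Ω : ℕ → Type*} [∀ n, MeasurableSpace (Ω n)]

/-- The bootstrap-variance conditions with the first and the third homogeneity condition only. -/
structure VarianceConditions (P : ∀ n, Measure (Ω n)) (N : ℕ → ℕ)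
    (X : ∀ n, Fin (N n) → Ω n → 𝓧) (a : ∀ n, (Fin m → Fin (N n)) → ℝ)
    (h : ℕ → (Fin m → 𝓧) → ℝ) : Prop where
  mainVar_pos : ∀ᶠ n in atTop, 0 < mainVar (P n) (X n) (a n) (h n)
  normality : ∃ M : ℕ → ℝ, (∀ n, 0 < M n) ∧
    (∀ n, ∀ I : Fin m ↪ Fin (N n),
      Integrable (fun ω => h n (fun l => X n (I l) ω) ^ 4) (P n) ∧
      ∫ ω, h n (fun l => X n (I l) ω) ^ 4 ∂(P n) ≤ M n) ∧
    Tendsto (fun n => (N n : ℝ) ^ (-2 : ℝ) * (mainVar (P n) (X n) (a n) (h n)) ^ (-1 : ℝ) *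
      avgWeight (a n) 2 2 * M n ^ (1 / 2 : ℝ)) atTop (𝓝 0) ∧
    Tendsto (fun n => (N n : ℝ) ^ (-2 : ℝ) * (mainVar (P n) (X n) (a n) (h n)) ^ (-3 / 2 : ℝ) *
      avgWeight (a n) 3 1 * M n ^ (3 / 4 : ℝ)) atTop (𝓝 0)
  vonMises : ∃ C : ℝ, ∀ᶠ n in atTop, ∀ k : Fin m → Fin (N n),
    (Integrable (fun ω => h n (fun l => X n (k l) ω) ^ 2) (P n) ∧
      ∫ ω, h n (fun l => X n (k l) ω) ^ 2 ∂(P n) ≤ C) ∧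
    (Integrable (fun y => h n y ^ 2) (Measure.pi fun l => (P n).map (X n (k l))) ∧
      ∫ y, h n y ^ 2 ∂(Measure.pi fun l => (P n).map (X n (k l))) ≤ C)
  homogeneity_one : TendstoInProb P (fun n ω => (N n : ℝ)⁻¹ * ∑ i, ∑ j,
    (hOne (P n) (X n) (a n) (h n) i (X n j ω) /
      ((N n : ℝ) * √(uVar (P n) (X n) (a n) (h n)))) ^ 2) 1
  homogeneity_three : Tendsto (fun n => (N n : ℝ)⁻¹ * (uVar (P n) (X n) (a n) (h n))⁻¹ *
    avgWeight (a n) 2 1 * (meanGap (P n) (X n) (h n) ^ 2 + crossGap (P n) (X n) (h n) +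
      (N n : ℝ)⁻¹)) atTop (𝓝 0)

variable {P : ∀ n, Measure (Ω n)} {N : ℕ → ℕ} {X : ∀ n, Fin (N n) → Ω n → 𝓧}
  {a : ∀ n, (Fin m → Fin (N n)) → ℝ} {h : ℕ → (Fin m → 𝓧) → ℝ}

theorem BootstrapConditions.varianceConditions (H : BootstrapConditions P N X a h) :
    VarianceConditions P N X a h where
  mainVar_pos := H.mainVar_pos
  normality := H.normality
  vonMises := H.vonMises
  homogeneity_one := H.homogeneity_one
  homogeneity_three := H.homogeneity_three

theorem tendsto_zero_of_le_const_mul {u v : ℕ → ℝ} {κ : ℝ} (hu : ∀ n, 0 ≤ u n)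
    (huv : ∀ᶠ n in atTop, u n ≤ κ * v n) (hv : Tendsto v atTop (𝓝 0)) :
    Tendsto u atTop (𝓝 0) :=
  squeeze_zero' (.of_forall hu) huv (by simpa using hv.const_mul κ)

namespace VarianceConditions

theorem homogeneity (H : VarianceConditions P N X a h) :
    TendstoInProb P (fun n ω => bootScale (P n) (X n) (a n) (h n) *
      ∑ i, ∑ j, hOne (P n) (X n) (a n) (h n) i (X n j ω) ^ 2) 1 := by
  refine cast (congrArg (fun Y => TendstoInProb P Y 1) ?_) H.homogeneity_one
  ext n ω
  have hsq : √(uVar (P n) (X n) (a n) (h n)) ^ 2 = uVar (P n) (X n) (a n) (h n) :=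
    Real.sq_sqrt (variance_nonneg _ _)
  simp only [div_pow, mul_pow, ← Finset.sum_div, hsq, bootScale]
  ring

theorem exists_sampleBounds (H : VarianceConditions P N X a h)
    (hX : ∀ n i, Measurable (X n i)) (hind : ∀ n, iIndepFun (X n) (P n))
    (hh : ∀ n, Measurable (h n)) {M : ℕ → ℝ} (hM : ∀ n, 0 ≤ M n)
    (hfourth : ∀ n, ∀ I : Fin m ↪ Fin (N n),
      Integrable (fun ω => h n (fun l => X n (I l) ω) ^ 4) (P n) ∧
      ∫ ω, h n (fun l => X n (I l) ω) ^ 4 ∂(P n) ≤ M n) :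
    ∃ C, ∀ᶠ n in atTop, SampleBounds (P n) (X n) (h n) √(M n) C := by
  obtain ⟨C, hC⟩ := H.vonMises
  exact ⟨max C 0, hC.mono fun n hn =>
    { measurable_sample := hX n
      indep := hind n
      measurable_kernel := hh n
      fourth_nonneg := Real.sqrt_nonneg _
      second_nonneg := le_max_right _ _
      integrable_pow_four := fun I => (hfourth n I).1
      integral_pow_four_le := fun I => (hfourth n I).2.trans_eq (Real.sq_sqrt (hM n)).symm
      integrable_sq := fun k => (hn k).1.1
      integral_sq_le := fun k => (hn k).1.2.trans (le_max_left _ _)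
      integrable_sq_pi := fun k => (hn k).2.1
      integral_sq_pi_le := fun k => (hn k).2.2.trans (le_max_left _ _) }⟩

variable [∀ n, IsProbabilityMeasure (P n)]

theorem exists_consistencyRates (H : VarianceConditions P N X a h) (hm : 1 ≤ m)
    (hN : Tendsto N atTop atTop) (hX : ∀ n i, Measurable (X n i))
    (hind : ∀ n, iIndepFun (X n) (P n)) (hh : ∀ n, Measurable (h n)) :
    ∃ B C, ConsistencyRates P N X a h B C := by
  obtain ⟨M, hM, hfourth, hpair, htriple⟩ := H.normality
  obtain ⟨C, hbounds⟩ := H.exists_sampleBounds hX hind hh (fun n => (hM n).le) hfourth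
  have hsize : ∀ᶠ n in atTop, 2 * m ≤ N n := hN.eventually_ge_atTop _
  have hpos : ∀ᶠ n in atTop, 0 < N n := hN.eventually_gt_atTop _
  have hle : ∀ᶠ n in atTop, mainVar (P n) (X n) (a n) (h n) ≤ uVar (P n) (X n) (a n) (h n) :=
    (hbounds.and hpos).mono fun n hn => hn.1.squareIntegrable.mainVar_le_uVar hn.2
  have hlarge := hsize.and (H.mainVar_pos.and hle)
  have hinv : Tendsto (fun n => (N n : ℝ)⁻¹) atTop (𝓝 0) :=
    tendsto_inv_atTop_zero.comp (tendsto_natCast_atTop_atTop.comp hN)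
  have hlim := hinv.mul (htriple.pow 4)
  rw [zero_mul] at hlim
  have hweight (n K q : ℕ) : 0 ≤ sharedWeight (a n) K q := sharedWeight_nonneg _ _ _
  refine ⟨_, C, hbounds, hpos, (H.mainVar_pos.and hle).mono fun n hn => hn.1.trans_le hn.2,
    H.homogeneity, ?_, ?_, ?_⟩
  · exact tendsto_zero_of_le_const_mul (fun n => mul_nonneg bootScale_nonneg (mul_nonneg
      (Nat.cast_nonneg _) (mul_nonneg homogeneityGap_nonneg (hweight n 2 1))))
      (hsize.mono fun n hn => bootScale_mul_gap_le hm hn) H.homogeneity_three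
  · exact tendsto_zero_of_le_const_mul (fun n => mul_nonneg bootScale_nonneg (mul_nonneg
      (Nat.cast_nonneg _) (mul_nonneg (Real.sqrt_nonneg _) (hweight n 2 2))))
      (hlarge.mono fun n hn => bootScale_mul_pair_le hm hn.1 hn.2.1 hn.2.2) hpair
  · exact tendsto_zero_of_le_const_mul (fun n => mul_nonneg (pow_nonneg bootScale_nonneg 6)
      (mul_nonneg (by positivity) (pow_nonneg (hweight n 3 1) 4)))
      (hlarge.mono fun n hn => bootScale_pow_six_mul_le hm hn.1 (hM n).le hn.2.1 hn.2.2) hlim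

end VarianceConditions

end Conditions

section Choice

variable {K : ℕ → ℕ}

theorem eventually_forall_le_of_choice {p : ℕ → ℕ → Prop}
    (hp : ∀ i : ℕ → ℕ, (∀ n, i n ≤ K n) → ∀ᶠ n in atTop, p n (i n)) :
    ∀ᶠ n in atTop, ∀ j ≤ K n, p n j := by
  have worst (n : ℕ) : ∃ i ≤ K n, p n i → ∀ j ≤ K n, p n j := by
    by_cases hall : ∀ j ≤ K n, p n j
    · exact ⟨0, Nat.zero_le _, fun _ => hall⟩
    · push Not at hall
      obtain ⟨j, hj, hpj⟩ := hall
      exact ⟨j, hj, fun h => absurd h hpj⟩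
  choose i hi hworst using worst
  exact (hp i hi).mono hworst

theorem tendsto_average_of_choice {F : ℕ → ℕ → ℝ} (hF : ∀ n j, 0 ≤ F n j)
    (hlim : ∀ i : ℕ → ℕ, (∀ n, i n ≤ K n) → Tendsto (fun n => F n (i n)) atTop (𝓝 0)) :
    Tendsto (fun n => ((K n + 1 : ℕ) : ℝ)⁻¹ * ∑ j ∈ Finset.range (K n + 1), F n j)
      atTop (𝓝 0) := by
  refine tendsto_order.2 ⟨fun ε hε => .of_forall fun n => hε.trans_le
    (mul_nonneg (by positivity) (Finset.sum_nonneg fun j _ => hF n j)), fun ε hε => ?_⟩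
  filter_upwards [eventually_forall_le_of_choice (p := fun n j => F n j < ε) fun i hi =>
    (hlim i hi).eventually_lt_const hε] with n hn
  rw [inv_mul_lt_iff₀ (by positivity)]
  calc ∑ j ∈ Finset.range (K n + 1), F n j < ∑ _j ∈ Finset.range (K n + 1), ε :=
        Finset.sum_lt_sum_of_nonempty Finset.nonempty_range_add_one
          fun j hj => hn j (Finset.mem_range_succ_iff.1 hj)
    _ = (K n + 1 : ℕ) * ε := by rw [Finset.sum_const, Finset.card_range, nsmul_eq_mul]

end Choice

namespace TendstoInMean

variable {Ω : ℕ → Type*} [∀ n, MeasurableSpace (Ω n)] {P : ∀ n, Measure (Ω n)}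
  {Y Z : ∀ n, Ω n → ℝ} {c : ℝ}

theorem congr' (hY : TendstoInMean P Y c) (hYZ : ∀ᶠ n in atTop, Y n = Z n) :
    TendstoInMean P Z c :=
  ⟨(hY.1.and hYZ).mono fun _ hn => hn.2 ▸ hn.1, hY.2.congr' (hYZ.mono fun _ hn => by rw [hn])⟩

variable [∀ n, IsProbabilityMeasure (P n)]

theorem const_mul (hZ : TendstoInMean P Z c) {ρ : ℕ → ℝ} {r : ℝ} (hρ : Tendsto ρ atTop (𝓝 r)) :
    TendstoInMean P (fun n ω => ρ n * Z n ω) (r * c) := by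
  have hlim : Tendsto (fun n => |ρ n| * ∫ ω, |Z n ω - c| ∂P n + |ρ n - r| * |c|) atTop (𝓝 0) := by
    simpa using (hρ.abs.mul hZ.2).add ((hρ.sub_const r).abs.mul_const |c|)
  refine ⟨hZ.1.mono fun n hn => hn.const_mul _,
    squeeze_zero' (.of_forall fun n => integral_nonneg fun ω => abs_nonneg _) ?_ hlim⟩
  filter_upwards [hZ.1] with n hn
  have hdev : Integrable (fun ω => |ρ n| * |Z n ω - c|) (P n) :=
    (hn.sub (integrable_const c)).abs.const_mul _
  calc ∫ ω, |ρ n * Z n ω - r * c| ∂P n ≤ ∫ ω, (|ρ n| * |Z n ω - c| + |ρ n - r| * |c|) ∂P n := by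
        refine integral_mono ((hn.const_mul _).sub (integrable_const _)).abs
          (hdev.add (integrable_const _)) fun ω => ?_
        rw [← abs_mul, ← abs_mul]
        exact (abs_add_le _ _).trans_eq' (by ring_nf)
    _ = _ := by
        rw [integral_add hdev (integrable_const _), integral_const_mul, integral_const,
          probReal_univ, one_smul]

theorem average {K : ℕ → ℕ} {Z : ∀ n, ℕ → Ω n → ℝ}
    (hZ : ∀ i : ℕ → ℕ, (∀ n, i n ≤ K n) → TendstoInMean P (fun n => Z n (i n)) c) :
    TendstoInMean P
      (fun n ω => ((K n + 1 : ℕ) : ℝ)⁻¹ * ∑ j ∈ Finset.range (K n + 1), Z n j ω) c := by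
  have hint : ∀ᶠ n in atTop, ∀ j ∈ Finset.range (K n + 1), Integrable (Z n j) (P n) :=
    (eventually_forall_le_of_choice fun i hi => (hZ i hi).1).mono
      fun n hn j hj => hn j (Finset.mem_range_succ_iff.1 hj)
  refine ⟨hint.mono fun n hn => (integrable_finsetSum _ hn).const_mul _,
    squeeze_zero' (.of_forall fun n => integral_nonneg fun ω => abs_nonneg _) ?_
      (tendsto_average_of_choice (fun n j => integral_nonneg fun ω => abs_nonneg (Z n j ω - c))
        fun i hi => (hZ i hi).2)⟩
  filter_upwards [hint] with n hn
  have hdev : ∀ j ∈ Finset.range (K n + 1), Integrable (fun ω => |Z n j ω - c|) (P n) :=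
    fun j hj => ((hn j hj).sub (integrable_const c)).abs
  rw [← integral_finsetSum _ hdev, ← integral_const_mul]
  refine integral_mono (((integrable_finsetSum _ hn).const_mul _).sub (integrable_const c)).abs
    ((integrable_finsetSum _ hdev).const_mul _) fun ω => ?_
  have hcenter : ((K n + 1 : ℕ) : ℝ)⁻¹ * (∑ j ∈ Finset.range (K n + 1), Z n j ω) - c =
      ((K n + 1 : ℕ) : ℝ)⁻¹ * ∑ j ∈ Finset.range (K n + 1), (Z n j ω - c) := by
    rw [Finset.sum_sub_distrib, Finset.sum_const, Finset.card_range, nsmul_eq_mul, mul_sub,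
      inv_mul_cancel_left₀ (by positivity)]
  calc _ = ((K n + 1 : ℕ) : ℝ)⁻¹ * |∑ j ∈ Finset.range (K n + 1), (Z n j ω - c)| := by
        rw [hcenter, abs_mul, abs_of_nonneg (by positivity)]
    _ ≤ _ := by
        gcongr
        exact Finset.abs_sum_le_sum_abs _ _

theorem sub_const (hY : TendstoInMean P Y c) : TendstoInMean P (fun n ω => Y n ω - c) 0 :=
  ⟨hY.1.mono fun _ hn => hn.sub (integrable_const c), by simpa using hY.2⟩

theorem div_of_isEquivalent {u s : ℕ → ℝ} (hY : TendstoInMean P (fun n ω => Y n ω / u n) c)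
    (hu : ∀ᶠ n in atTop, u n ≠ 0) (hus : u ~[atTop] s) :
    TendstoInMean P (fun n ω => Y n ω / s n) c := by
  obtain ⟨ρ, hρ, hmul⟩ := hus.exists_eq_mul
  rw [← one_mul c]
  refine (hY.const_mul hρ).congr' ?_
  filter_upwards [hu, hmul] with n hn hun
  rw [Pi.mul_apply] at hun
  have hρn : ρ n ≠ 0 := left_ne_zero_of_mul (hun ▸ hn)
  ext ω
  rw [hun, mul_div_assoc', mul_div_mul_left _ _ hρn]

end TendstoInMean

section Blocks

theorem variance_inv_sqrt_mul {Ω : Type*} [MeasurableSpace Ω] {P : Measure Ω} {U : Ω → ℝ}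
    (hU : variance U P ≠ 0) : variance (fun ω => (√(variance U P))⁻¹ * U ω) P = 1 := by
  rw [variance_const_mul, inv_pow, Real.sq_sqrt (variance_nonneg _ _), inv_mul_cancel₀ hU]

variable {𝓧 : Type*} {m : ℕ}

theorem div_mul_inv_mul_movingBlockVar {n b : ℕ} (hbn : b ≤ n) {c s τ ρ ζ : ℝ} (hc : c ≠ 0)
    (hρ : ρ * ζ ≠ 0) (hζ : s / τ = ρ * ζ) (a : (Fin m → Fin b) → ℝ) (h : (Fin m → 𝓧) → ℝ)
    (x : ℕ → 𝓧) : c / ζ * (τ⁻¹ * movingBlockVar n b c a h x) = ρ * (((n - b + 1 : ℕ) : ℝ)⁻¹ *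
      ∑ i ∈ Finset.range (n - b + 1), bootVar a h (block b i x) / s) := by
  have hcast : (n : ℝ) - b + 1 = (n - b + 1 : ℕ) := by push_cast [Nat.cast_sub hbn]; rfl
  obtain ⟨hs, hτ⟩ := div_ne_zero_iff.1 (hζ ▸ hρ)
  have hζ0 : ζ ≠ 0 := right_ne_zero_of_mul hρ
  rw [← Finset.sum_div, movingBlockVar, hcast, eq_div_of_mul_eq hζ0 hζ.symm]
  field_simp

variable {Ω : ℕ → Type*} [∀ n, MeasurableSpace (Ω n)] {P : ∀ n, Measure (Ω n)}
  [∀ n, IsProbabilityMeasure (P n)] {N b : ℕ → ℕ}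

theorem tendstoInMean_movingBlockVar {X : ∀ n, ℕ → Ω n → 𝓧} {a : ∀ n, (Fin m → Fin (b n)) → ℝ}
    {h : ℕ → (Fin m → 𝓧) → ℝ} (hb : ∀ n, b n ≤ n) {c s τ ζ : ℕ → ℝ} (hc : ∀ n, c n ≠ 0)
    (hζ : ∀ᶠ n in atTop, ζ n ≠ 0) (hratio : (fun n => s n / τ n) ~[atTop] ζ)
    (hboot : ∀ i : ℕ → ℕ, (∀ n, i n + b n ≤ n) → TendstoInMean P (fun n ω =>
      bootVar (a n) (h n) (block (b n) (i n) fun j => X n j ω) / s n) 1) :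
    TendstoInMean P (fun n ω => c n / ζ n *
      ((τ n)⁻¹ * movingBlockVar n (b n) (c n) (a n) (h n) fun j => X n j ω)) 1 := by
  obtain ⟨ρ, hρ, hmul⟩ := hratio.exists_eq_mul
  have haverage := TendstoInMean.average (K := fun n => n - b n)
    (Z := fun n i ω => bootVar (a n) (h n) (block (b n) i fun j => X n j ω) / s n)
    fun i hi => hboot i fun n => Nat.add_le_of_le_sub (hb n) (hi n)
  rw [← one_mul (1 : ℝ)]
  refine (haverage.const_mul hρ).congr' ?_
  filter_upwards [hmul, hζ, hρ.eventually_ne one_ne_zero] with n hn hζn hρn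
  ext ω
  exact (div_mul_inv_mul_movingBlockVar (hb n) (hc n) (mul_ne_zero hρn hζn) hn _ _ _).symm

variable [MeasurableSpace 𝓧]

theorem VarianceConditions.tendstoInMean_bootVar_div {X : ∀ n, Fin (N n) → Ω n → 𝓧}
    {a : ∀ n, (Fin m → Fin (N n)) → ℝ} {h : ℕ → (Fin m → 𝓧) → ℝ}
    (H : VarianceConditions P N X a h) (hm : 1 ≤ m) (hN : Tendsto N atTop atTop)
    (hX : ∀ n i, Measurable (X n i)) (hind : ∀ n, iIndepFun (X n) (P n))
    (hh : ∀ n, Measurable (h n)) {s : ℕ → ℝ}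
    (hs : (fun n => uVar (P n) (X n) (a n) (h n)) ~[atTop] s) :
    TendstoInMean P (fun n ω => bootVar (a n) (h n) (fun k => X n k ω) / s n) 1 := by
  obtain ⟨B, C, hrates⟩ := H.exists_consistencyRates hm hN hX hind hh
  exact hrates.tendstoInMean_bootVar_div_uVar.div_of_isEquivalent
    (hrates.uVar_pos.mono fun _ hn => hn.ne') hs

theorem iIndepFun_block {Ω : Type*} [MeasurableSpace Ω] {P : Measure Ω} {X : ℕ → Ω → 𝓧}
    {n b i : ℕ} (hX : iIndepFun (fun j : Fin n => X j) P) (hi : i + b ≤ n) :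
    iIndepFun (fun k : Fin b => X (i + k)) P :=
  hX.precomp (g := fun k : Fin b => (⟨i + k, by omega⟩ : Fin n)) fun k l hkl =>
    Fin.ext (Nat.add_left_cancel (Fin.mk.inj_iff.1 hkl))

end Blocks

end WeightedU

theorem mainTheorem5_general {𝓧 : Type*} [MeasurableSpace 𝓧] {Ω : ℕ → Type*}
    [∀ n, MeasurableSpace (Ω n)] (P : ∀ n, Measure (Ω n)) [∀ n, IsProbabilityMeasure (P n)]
    (X : ∀ n, ℕ → Ω n → 𝓧) (hX_meas : ∀ n, ∀ j < n, Measurable (X n j))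
    (m : ℕ) (hm : 1 ≤ m) (b : ℕ → ℕ) (hb_le : ∀ n, b n ≤ n) (hb : Tendsto b atTop atTop)
    (hX_indep : ∀ n i, i + b n ≤ n → iIndepFun (fun k : Fin (b n) => X n (i + k)) (P n))
    (a' : ∀ n, (Fin m → Fin (b n)) → ℝ) (h' : ℕ → (Fin m → 𝓧) → ℝ)
    (hh' : ∀ n, Measurable (h' n)) (c : ℕ → ℝ) (hc : ∀ n, c n ≠ 0)
    (U : ∀ n, Ω n → ℝ) (s : ℕ → ℝ) (ζ : ℕ → ℝ) (hζ : ∀ n, 0 < ζ n)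
    (h_cond : ∀ i : ℕ → ℕ, (∀ n, i n + b n ≤ n) →
      WeightedU.VarianceConditions P b (fun n (k : Fin (b n)) => X n (i n + k)) a' h')
    (h_var : ∀ i : ℕ → ℕ, (∀ n, i n + b n ≤ n) →
      (fun n => WeightedU.uVar (P n) (fun k : Fin (b n) => X n (i n + k)) (a' n) (h' n))
        ~[atTop] s)
    (h_ratio : (fun n => s n / variance (U n) (P n)) ~[atTop] ζ) :
    ∃ R : ∀ n, Ω n → ℝ, WeightedU.TendstoInMean P R 0 ∧
      ∀ᶠ n in atTop, ∀ ω : Ω n,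
        (variance (U n) (P n))⁻¹ *
            WeightedU.movingBlockVar n (b n) (c n) (a' n) (h' n) (fun j => X n j ω) -
          variance (fun ω' => (√(variance (U n) (P n)))⁻¹ * U n ω') (P n) =
        ζ n / c n * (1 + R n ω) - 1 := by
  have hblock := WeightedU.tendstoInMean_movingBlockVar hb_le hc (.of_forall fun n => (hζ n).ne')
    h_ratio fun i hi => (h_cond i hi).tendstoInMean_bootVar_div hm hb
      (fun n k => hX_meas n _ (by have := hi n; omega)) (fun n => hX_indep n _ (hi n)) hh'
      (h_var i hi)
  refine ⟨_, hblock.sub_const, ?_⟩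
  filter_upwards [h_ratio.isTheta.eq_zero_iff] with n hn ω
  have hU : variance (U n) (P n) ≠ 0 := (div_ne_zero_iff.1 (hn.not.2 (hζ n).ne')).2
  have := hc n
  have := (hζ n).ne'
  rw [WeightedU.variance_inv_sqrt_mul hU]
  field_simp
  ring

/-- `X n 0, …, X n (n - 1)` is the `n`-th row of the triangular array. The full statistic `U_n` has
weights `a n` and kernel `h n`; the statistic of a block of length `b n` has weights `a' n` and
kernel `h' n`. `s n` is `σ_b²`, and `c n` is the scale parameter `h_n`. "Each block" is read through
arbitrary choices `i n` of a block, i.e. the conditions hold uniformly over the blocks. -/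
theorem mainTheorem5 {𝓧 : Type*} [MeasurableSpace 𝓧] {Ω : ℕ → Type*}
    [∀ n, MeasurableSpace (Ω n)] (P : ∀ n, Measure (Ω n)) [∀ n, IsProbabilityMeasure (P n)]
    (X : ∀ n, ℕ → Ω n → 𝓧)
    (hX_meas : ∀ n, ∀ j < n, Measurable (X n j))
    (hX_indep : ∀ n, iIndepFun (fun j : Fin n => X n j) (P n))
    (m : ℕ) (hm : 1 ≤ m)
    (b : ℕ → ℕ) (hb_le : ∀ n, b n ≤ n) (hb : Tendsto b atTop atTop)
    (a : ∀ n, (Fin m → Fin n) → ℝ) (h : ℕ → (Fin m → 𝓧) → ℝ) (hh : ∀ n, Measurable (h n))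
    (a' : ∀ n, (Fin m → Fin (b n)) → ℝ) (h' : ℕ → (Fin m → 𝓧) → ℝ)
    (hh' : ∀ n, Measurable (h' n))
    (c : ℕ → ℝ) (hc : ∀ n, c n ≠ 0)
    (s : ℕ → ℝ) (ζ : ℕ → ℝ) (hζ : ∀ n, 0 < ζ n)
    (h_cond : ∀ i : ℕ → ℕ, (∀ n, i n + b n ≤ n) →
      WeightedU.BootstrapConditions P b
        (fun n k ω => WeightedU.block (b n) (i n) (fun j => X n j ω) k) a' h')
    (h_var : ∀ i : ℕ → ℕ, (∀ n, i n + b n ≤ n) →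
      (fun n => WeightedU.uVar (P n)
        (fun k ω => WeightedU.block (b n) (i n) (fun j => X n j ω) k) (a' n) (h' n))
        ~[atTop] s)
    (h_ratio : (fun n => s n / WeightedU.uVar (P n) (fun k : Fin n => X n k) (a n) (h n))
      ~[atTop] ζ) :
    ∃ R : ∀ n, Ω n → ℝ, WeightedU.TendstoInProb P R 0 ∧
      ∀ᶠ n in atTop, ∀ ω : Ω n,
        (WeightedU.uVar (P n) (fun k : Fin n => X n k) (a n) (h n))⁻¹ *
            WeightedU.movingBlockVar n (b n) (c n) (a' n) (h' n) (fun j => X n j ω) -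
          variance (fun ω' => (√(WeightedU.uVar (P n) (fun k : Fin n => X n k) (a n) (h n)))⁻¹ *
            WeightedU.uStat (a n) (h n) (fun k => X n k ω')) (P n) =
        ζ n / c n * (1 + R n ω) - 1 := by
  obtain ⟨R, hR, hident⟩ := mainTheorem5_general P X hX_meas m hm b hb_le hb
    (fun n _ hi => WeightedU.iIndepFun_block (hX_indep n) hi) a' h' hh' c hc
    (fun n ω => WeightedU.uStat (a n) (h n) fun k => X n k ω) s ζ hζ
    (fun i hi => (h_cond i hi).varianceConditions) h_var h_ratio
  exact ⟨R, hR.tendstoInProb, hident⟩
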